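/- **Setting.** Let $\mathcal E,\mu,\omega>0$ and $h\in\mathbb R$ with $\mathcal E+h>0$, and put $V_I(z)=\mathcal E+h+\frac{\mu}{|z|}$, $V_E(z)=\mathcal E-\frac{\omega^2}{2}|z|^2$ on the plane. Let $D\subset\mathbb R^2$ be a bounded domain with $0\in D$ whose boundary is a regular simple closed curve of class $C^2$, parametrised by a $2\pi$-periodic map $\gamma$ of class $C^2$. A particle moves with zero energy, solving $z''=\nabla V_E(z)$, $\frac12|z'|^2=V_E(z)$ outside $D$ and $z''=\nabla V_I(z)$, $\frac12|z'|^2=V_I(z)$ inside $D$, where inner motions are continued through collisions with the origin by Levi-Civita regularisation ($z=w^2$, $ds=2|w|^2d\tau$, $\frac{d^2w}{d\tau^2}=2(\mathcal E+h)w$, $\frac12|\frac{dw}{d\tau}|^2-(\mathcal E+h)|w|^2=\mu$). When it crosses $\partial D$ at $\bar z$ it is refracted by Snell's law: $\sqrt{V_E(\bar z)}\,\frac{z_E'}{|z_E'|}\cdot e=\sqrt{V_I(\bar z)}\,\frac{z_I'}{|z_I'|}\cdot e$, where $e$ is the unit tangent to $\partial D$ at $\bar z$ and $z_E',z_I'$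 are the velocities on the outer and inner side. Let $t(\xi)=\dot\gamma(\xi)/|\dot\gamma(\xi)|$ and let $n(\xi)$ be the outward unit normal at $\gamma(\xi)$. A pair $(\xi_0,\alpha_0)$, $\alpha_0\in[-\frac\pi2,\frac\pi2]$, represents the initial position $\gamma(\xi_0)$ and initial velocity $\sqrt{2V_E(\gamma(\xi_0))}\,(\cos\alpha_0\,n(\xi_0)+\sin\alpha_0\,t(\xi_0))$. The first return map $F$ sends $(\xi_0,\alpha_0)$ to the pair $(\xi_1,\alpha_1)$ that describes the position and outgoing direction after one outer arc (followed until it first meets $\partial D$), refraction, one inner arc (followed until it first meets $\partial D$) and refraction to the outside. Let $k(\xi)=-\ddot\gamma(\xi)\cdot n(\xi)/|\dot\gamma(\xi)|^2$ be the curvature of $\partial D$ (equal to $1/R$ for a disc of radius $R$). **Theorem.** Let $p=\gamma(\bar\xi)\in\partial D$ be such that $V_E(p)>0$, the vector $p$ is orthogonal to $\partial D$ at $p$, i.e. $\gamma(\bar\xi)\cdot\dot\gamma(\bar\xi)=0$, and $\{tp : t\ge 0\}\cap\partial D=\{p\}$. Then there is a homothetic collision–ejection orbit in the direction of $p$: it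 starts at $p$ with velocity $\sqrt{2V_E(p)}\,p/|p|$, stays on the ray from $0$ through $p$, collides with $0$, and closes up after one outer and one inner arc. The first return map $F$ is well defined in a neighbourhood of $(\bar\xi,0)$ (with $\xi_1$ taken in $(\bar\xi-\pi,\bar\xi+\pi)$), it is of class $C^1$ near $(\bar\xi,0)$, and $F(\bar\xi,0)=(\bar\xi,0)$. Put $$\Delta(\bar\xi)=A\,B\,C\,D,$$ $$A=\frac{16}{\mathcal E^2\mu^2}\Big(\sqrt{V_I(p)}-\sqrt{V_E(p)}\Big)\big(|p|k(\bar\xi)-1\big),$$ $$B=\mathcal E-\big(|p|k(\bar\xi)-1\big)\Big(\sqrt{V_I(p)}-\sqrt{V_E(p)}\Big)\sqrt{V_E(p)},$$ $$C=-\mu\sqrt{V_E(p)}+2|p|\,B\,\sqrt{V_I(p)},$$ $$D=\mu+2|p|\big(|p|k(\bar\xi)-1\big)\sqrt{V_I(p)}\Big(\sqrt{V_I(p)}-\sqrt{V_E(p)}\Big)$$ (the factor $D$ is not to be confused with the domain). - If $\Delta(\bar\xi)>0$, then $(\bar\xi,0)$ is linearly unstable for $F$: it is a saddle, i.e. $DF(\bar\xi,0)$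 has real eigenvalues $\lambda,1/\lambda$ with $|\lambda|>1$, and $|DF(\bar\xi,0)^n u|\to\infty$ for some vector $u$. - If $\Delta(\bar\xi)<0$, then $(\bar\xi,0)$ is linearly stable for $F$: it is a center, i.e. the eigenvalues of $DF(\bar\xi,0)$ are two distinct complex conjugate numbers of modulus $1$, and the powers $DF(\bar\xi,0)^n$, $n\ge 0$, are bounded. -/

import Mathlib

open Real Set Filter Topology

noncomputable section

namespace GalacticRefraction

/-! The plane is `ℂ` (Euclidean norm, real inner product `inner ℝ`). The physical parameters are
`E h μ ω : ℝ`. -/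

/-- Inner (Keplerian) potential `V_I(z) = E + h + μ / |z|`. -/
def innerPotential (E h μ : ℝ) (z : ℂ) : ℝ := E + h + μ / ‖z‖

/-- Outer (harmonic) potential `V_E(z) = E - (ω² / 2) |z|²`. -/
def outerPotential (E ω : ℝ) (z : ℂ) : ℝ := E - ω ^ 2 / 2 * ‖z‖ ^ 2

/-- `D` is a bounded plane domain containing the origin, whose boundary is a regular simple closed
curve of class `C²`, parametrised by the `2π`-periodic map `γ`. -/
structure IsRegularDomain (D : Set ℂ) (γ : ℝ → ℂ) : Prop where
  isOpen : IsOpen D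
  isConnected : IsConnected D
  isBounded : Bornology.IsBounded D
  zero_mem : (0 : ℂ) ∈ D
  contDiff : ContDiff ℝ 2 γ
  periodic : Function.Periodic γ (2 * π)
  injOn : InjOn γ (Ico 0 (2 * π))
  deriv_ne_zero : ∀ ξ, deriv γ ξ ≠ 0
  frontier_eq : frontier D = γ '' Icc 0 (2 * π)

/-- Unit tangent vector `t(ξ) = γ'(ξ) / |γ'(ξ)|`. -/
def unitTangent (γ : ℝ → ℂ) (ξ : ℝ) : ℂ := (‖deriv γ ξ‖⁻¹ : ℝ) • deriv γ ξ

open Classical in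
/-- Outward-pointing unit normal `n(ξ)` of `D` at `γ(ξ)`: the one of the two unit vectors `∓ i t(ξ)`
that points to the complement of `D`. -/
def outwardNormal (D : Set ℂ) (γ : ℝ → ℂ) (ξ : ℝ) : ℂ :=
  if ∀ᶠ ε : ℝ in 𝓝[>] 0, γ ξ + ε • (-Complex.I * unitTangent γ ξ) ∉ closure D
  then -Complex.I * unitTangent γ ξ
  else Complex.I * unitTangent γ ξ

/-- Curvature of the boundary of `D` at `γ(ξ)`, with the sign for which a circle bounding a disc of
radius `R` has curvature `1 / R`. -/
def curvature (D : Set ℂ) (γ : ℝ → ℂ) (ξ : ℝ) : ℝ :=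
  -(inner ℝ (deriv (deriv γ) ξ) (outwardNormal D γ ξ)) / ‖deriv γ ξ‖ ^ 2

/-- The unit vector `cos α n(ξ) + sin α t(ξ)`, at angle `α` with the outward normal. -/
def direction (D : Set ℂ) (γ : ℝ → ℂ) (ξ α : ℝ) : ℂ :=
  Real.cos α • outwardNormal D γ ξ + Real.sin α • unitTangent γ ξ

/-- `z`, with velocity `v`, is a zero-energy solution on `[0, T]` of the outer problem
`z'' = ∇ V_E(z) = -ω² z`, `|z'|² / 2 = V_E(z)`. -/
structure IsOuterArc (E ω : ℝ) (T : ℝ) (z v : ℝ → ℂ) : Prop where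
  deriv_pos : ∀ s ∈ Icc 0 T, HasDerivWithinAt z (v s) (Icc 0 T) s
  deriv_vel : ∀ s ∈ Icc 0 T, HasDerivWithinAt v (-((ω ^ 2 : ℝ) • z s)) (Icc 0 T) s
  energy : ∀ s ∈ Icc 0 T, ‖v s‖ ^ 2 / 2 = outerPotential E ω (z s)

/-- `w`, with derivative `w'`, is a solution on `[0, T]` of the Levi-Civita regularised inner problem
`w'' = Ω² w`, `|w'|² / 2 - Ω² |w|² / 2 = μ`, where `Ω² = 2 (E + h)`. The inner arc that it represents
is run through with physical time `s` such that `ds = 2 |w|² dτ`; see `levi_civita_position` and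
`levi_civita_velocity` below. -/
structure IsRegularisedInnerArc (E h μ : ℝ) (T : ℝ) (w w' : ℝ → ℂ) : Prop where
  deriv_pos : ∀ τ ∈ Icc 0 T, HasDerivWithinAt w (w' τ) (Icc 0 T) τ
  deriv_vel : ∀ τ ∈ Icc 0 T, HasDerivWithinAt w' ((2 * (E + h) : ℝ) • w τ) (Icc 0 T) τ
  energy : ∀ τ ∈ Icc 0 T, ‖w' τ‖ ^ 2 / 2 - (E + h) * ‖w τ‖ ^ 2 = μ

/-- Physical position `z = w²` in Levi-Civita coordinates. -/
def physicalPosition (w : ℂ) : ℂ := w ^ 2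

/-- Physical velocity `dz/ds = w' / conj w` in Levi-Civita coordinates (away from collision). -/
def physicalVelocity (w w' : ℂ) : ℂ := w' / (starRingEnd ℂ) w

/-- Along a regularised inner arc, away from collision, `dz/dτ = (ds/dτ) * velocity`, where
`ds/dτ = 2 |z|`. -/
theorem levi_civita_position {E h μ T : ℝ} {w w' : ℝ → ℂ}
    (H : IsRegularisedInnerArc E h μ T w w') {τ : ℝ} (hτ : τ ∈ Icc 0 T) (hw : w τ ≠ 0) :
    HasDerivWithinAt (fun x => physicalPosition (w x))
      ((2 * ‖physicalPosition (w τ)‖ : ℝ) • physicalVelocity (w τ) (w' τ)) (Icc 0 T) τ := by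
  have h1 := (H.deriv_pos τ hτ).pow 2
  refine h1.congr_deriv ?_
  have hc : (starRingEnd ℂ) (w τ) ≠ 0 := by simpa using hw
  have hn : ((‖w τ‖ : ℂ)) ^ 2 = w τ * (starRingEnd ℂ) (w τ) := by
    rw [Complex.mul_conj, Complex.normSq_eq_norm_sq]; push_cast; ring
  simp only [physicalPosition, physicalVelocity, norm_pow, Complex.real_smul]
  push_cast
  rw [hn]
  field_simp
  try ring

/-- Along a regularised inner arc, away from collision, the physical velocity satisfies Newton's
equation `d²z/ds² = ∇ V_I(z) = -μ z / |z|³`, where `ds/dτ = 2 |z|`. -/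
theorem levi_civita_velocity {E h μ T : ℝ} {w w' : ℝ → ℂ}
    (H : IsRegularisedInnerArc E h μ T w w') {τ : ℝ} (hτ : τ ∈ Icc 0 T) (hw : w τ ≠ 0) :
    HasDerivWithinAt (fun x => physicalVelocity (w x) (w' x))
      ((2 * ‖physicalPosition (w τ)‖ : ℝ) •
        ((-μ / ‖physicalPosition (w τ)‖ ^ 3 : ℝ) • physicalPosition (w τ))) (Icc 0 T) τ := by
  have hc : (starRingEnd ℂ) (w τ) ≠ 0 := by simpa using hw
  have h2 : HasDerivWithinAt (fun x => (starRingEnd ℂ) (w x)) ((starRingEnd ℂ) (w' τ))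
      (Icc 0 T) τ := by
    simpa using (H.deriv_pos τ hτ).star
  refine ((H.deriv_vel τ hτ).div h2 hc).congr_deriv ?_
  have hn : ((‖w τ‖ : ℂ)) ^ 2 = w τ * (starRingEnd ℂ) (w τ) := by
    rw [Complex.mul_conj, Complex.normSq_eq_norm_sq]; push_cast; ring
  have hn' : ((‖w' τ‖ : ℂ)) ^ 2 = w' τ * (starRingEnd ℂ) (w' τ) := by
    rw [Complex.mul_conj, Complex.normSq_eq_norm_sq]; push_cast; ring
  have he : (‖w' τ‖ : ℂ) ^ 2 / 2 - (E + h) * (‖w τ‖ : ℂ) ^ 2 = μ := by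
    exact_mod_cast H.energy τ hτ
  rw [hn, hn'] at he
  simp only [physicalPosition, norm_pow, Complex.real_smul]
  push_cast
  rw [hn, ← he]
  field_simp
  ring

/-- Along a regularised inner arc, away from collision, the physical energy is zero. -/
theorem levi_civita_energy {E h μ T : ℝ} {w w' : ℝ → ℂ}
    (H : IsRegularisedInnerArc E h μ T w w') {τ : ℝ} (hτ : τ ∈ Icc 0 T) (hw : w τ ≠ 0) :
    ‖physicalVelocity (w τ) (w' τ)‖ ^ 2 / 2 = innerPotential E h μ (physicalPosition (w τ)) := by
  have hn : ‖w τ‖ ≠ 0 := by simpa using hw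
  have he := H.energy τ hτ
  simp only [physicalPosition, physicalVelocity, innerPotential, norm_pow, norm_div,
    RCLike.norm_conj]
  rw [← he]
  field_simp
  ring

/-- Generalised Snell's law at a boundary point with unit tangent `t`: a velocity `u` on a side with
potential value `V` and a velocity `u'` on a side with potential value `V'` satisfy
`√V (u / |u|) · t = √V' (u' / |u'|) · t`. -/
def SnellLaw (V V' : ℝ) (t u u' : ℂ) : Prop :=
  √V * inner ℝ ((‖u‖⁻¹ : ℝ) • u) t = √V' * inner ℝ ((‖u'‖⁻¹ : ℝ) • u') t

/-- Data of one exterior-interior cycle: an outer arc `z` with velocity `v`, of duration `TE`; the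
parameter `ξm` of the junction point on the boundary; an inner arc in Levi-Civita coordinates `w` with
derivative `w'`, of duration `TI` in Levi-Civita time. -/
structure Cycle where
  z : ℝ → ℂ
  v : ℝ → ℂ
  TE : ℝ
  ξm : ℝ
  w : ℝ → ℂ
  w' : ℝ → ℂ
  TI : ℝ

/-- `c` is an exterior-interior cycle from `q = (ξ₀, α₀)` to `q' = (ξ₁, α₁)`: the outer arc starts at
`γ(ξ₀)` with velocity at angle `α₀` with the outward normal, and is followed until it first meets the
boundary, at `γ(ξm)`; it is refracted there into an inner arc, which is followed until it first meets
the boundary, at `γ(ξ₁)`; there it is refracted into the outgoing direction with angle `α₁`. -/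
structure IsCycle (E h μ ω : ℝ) (D : Set ℂ) (γ : ℝ → ℂ) (q q' : ℝ × ℝ) (c : Cycle) : Prop where
  angle_mem : q.2 ∈ Icc (-(π / 2)) (π / 2)
  TE_pos : 0 < c.TE
  outer : IsOuterArc E ω c.TE c.z c.v
  outer_start : c.z 0 = γ q.1
  outer_start_vel : c.v 0 = √(2 * outerPotential E ω (γ q.1)) • direction D γ q.1 q.2
  outer_mem : ∀ s ∈ Ioo 0 c.TE, c.z s ∉ closure D
  outer_end : c.z c.TE = γ c.ξm
  TI_pos : 0 < c.TI
  inner_arc : IsRegularisedInnerArc E h μ c.TI c.w c.w'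
  inner_start : physicalPosition (c.w 0) = γ c.ξm
  refraction_in : SnellLaw (outerPotential E ω (γ c.ξm)) (innerPotential E h μ (γ c.ξm))
    (unitTangent γ c.ξm) (c.v c.TE) (physicalVelocity (c.w 0) (c.w' 0))
  inner_mem : ∀ τ ∈ Ioo 0 c.TI, physicalPosition (c.w τ) ∈ D
  inner_end : physicalPosition (c.w c.TI) = γ q'.1
  refraction_out : SnellLaw (innerPotential E h μ (γ q'.1)) (outerPotential E ω (γ q'.1))
    (unitTangent γ q'.1) (physicalVelocity (c.w c.TI) (c.w' c.TI)) (direction D γ q'.1 q'.2)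
  angle_mem' : q'.2 ∈ Icc (-(π / 2)) (π / 2)

/-- The first return relation on pairs (boundary parameter, angle). -/
def FirstReturn (E h μ ω : ℝ) (D : Set ℂ) (γ : ℝ → ℂ) (q q' : ℝ × ℝ) : Prop :=
  ∃ c : Cycle, IsCycle E h μ ω D γ q q' c

/-- `F` is the local first return map near `(ξ, 0)`: for every `q` in a neighbourhood of `(ξ, 0)` the
first return of `q` exists and is unique, and it is `F q`. (The boundary parameter is an angle; it is
represented by its value in `(ξ - π, ξ + π)`.) -/
def IsLocalFirstReturnMap (E h μ ω : ℝ) (D : Set ℂ) (γ : ℝ → ℂ) (ξ : ℝ) (F : ℝ × ℝ → ℝ × ℝ) : Prop :=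
  ∀ᶠ q in 𝓝 ((ξ, 0) : ℝ × ℝ), |(F q).1 - ξ| < π ∧
    ∀ q' : ℝ × ℝ, |q'.1 - ξ| < π → (FirstReturn E h μ ω D γ q q' ↔ q' = F q)

/-- `c` is the homothetic collision-ejection orbit in the direction of `γ(ξ)`: it starts at `γ(ξ)` with
velocity in the direction of `γ(ξ)`, stays on the ray through `γ(ξ)`, collides with the origin, and
closes up after one cycle. -/
structure IsHomotheticOrbit (E h μ ω : ℝ) (D : Set ℂ) (γ : ℝ → ℂ) (ξ : ℝ) (c : Cycle) : Prop where
  isCycle : IsCycle E h μ ω D γ (ξ, 0) (ξ, 0) c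
  initial_velocity : c.v 0 = (√(2 * outerPotential E ω (γ ξ)) / ‖γ ξ‖) • γ ξ
  outer_on_ray : ∀ s ∈ Icc 0 c.TE, ∃ r : ℝ, 0 ≤ r ∧ c.z s = r • γ ξ
  inner_on_ray : ∀ τ ∈ Icc 0 c.TI, ∃ r : ℝ, 0 ≤ r ∧ physicalPosition (c.w τ) = r • γ ξ
  collision : ∃ τ ∈ Ioo 0 c.TI, c.w τ = 0

/-- Linear stability of `q` for `F`: `q` is a fixed point, `F` is differentiable at `q`, and the
iterates of the linearised map `DF(q)` are bounded. -/
def IsLinearlyStable (F : ℝ × ℝ → ℝ × ℝ) (q : ℝ × ℝ) : Prop :=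
  F q = q ∧ DifferentiableAt ℝ F q ∧
    ∃ C : ℝ, ∀ (n : ℕ) (u : ℝ × ℝ), ‖((fderiv ℝ F q) ^ n) u‖ ≤ C * ‖u‖

/-- Linear instability of `q` for `F`: `q` is a fixed point, `F` is differentiable at `q`, and some
orbit of the linearised map `DF(q)` escapes to infinity. -/
def IsLinearlyUnstable (F : ℝ × ℝ → ℝ × ℝ) (q : ℝ × ℝ) : Prop :=
  F q = q ∧ DifferentiableAt ℝ F q ∧
    ∃ u : ℝ × ℝ, Tendsto (fun n : ℕ => ‖((fderiv ℝ F q) ^ n) u‖) atTop atTop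

/-- `q` is a saddle of `F`: `DF(q)` has real eigenvalues `l` and `1 / l` with `|l| > 1`. -/
def IsSaddle (F : ℝ × ℝ → ℝ × ℝ) (q : ℝ × ℝ) : Prop :=
  F q = q ∧ DifferentiableAt ℝ F q ∧ ∃ l : ℝ, 1 < |l| ∧
    Module.End.HasEigenvalue (fderiv ℝ F q).toLinearMap l ∧
    Module.End.HasEigenvalue (fderiv ℝ F q).toLinearMap l⁻¹

/-- `q` is a (linear) center of `F`: the eigenvalues of `DF(q)` are two distinct complex conjugate
numbers on the unit circle. -/
def IsCenter (F : ℝ × ℝ → ℝ × ℝ) (q : ℝ × ℝ) : Prop :=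
  F q = q ∧ DifferentiableAt ℝ F q ∧ ∃ l : ℂ, ‖l‖ = 1 ∧ l.im ≠ 0 ∧
    ((fderiv ℝ F q).toLinearMap.charpoly.map (algebraMap ℝ ℂ)).roots = {l, (starRingEnd ℂ) l}

/-- The first factor `A`, in terms of `r = |p|`, the curvature `k`, and `a = √V_I(p)`,
`b = √V_E(p)`. -/
def factorA (E μ r k a b : ℝ) : ℝ := 16 / (E ^ 2 * μ ^ 2) * (a - b) * (r * k - 1)

/-- The second factor `B`. -/
def factorB (E r k a b : ℝ) : ℝ := E - (r * k - 1) * (a - b) * b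

/-- The third factor `C`. -/
def factorC (E μ r k a b : ℝ) : ℝ := -μ * b + 2 * r * factorB E r k a b * a

/-- The fourth factor `D`. -/
def factorD (μ r k a b : ℝ) : ℝ := μ + 2 * r * (r * k - 1) * a * (a - b)

/-- The stability discriminant `Δ(ξ) = A B C D`. -/
def discriminant (E h μ ω : ℝ) (D : Set ℂ) (γ : ℝ → ℂ) (ξ : ℝ) : ℝ :=
  let r := ‖γ ξ‖
  let k := curvature D γ ξ
  let a := √(innerPotential E h μ (γ ξ))
  let b := √(outerPotential E ω (γ ξ))
  factorA E μ r k a b * factorB E r k a b * factorC E μ r k a b * factorD μ r k a b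

end GalacticRefraction

end

open GalacticRefraction

/-! The angle `α` is replaced by `σ = √V_E sin α`, the tangential velocity divided by `√2`. At zero
energy the speed is `√(2V)` on either side, so Snell's law says exactly that `σ` is continuous
across the boundary (`snellLaw_iff`, `snellLaw_unit_iff`). Near `(ξ, 0)` the return map is therefore
`ofSigma ∘ PI ∘ PE ∘ toSigma`, where `PE` and `PI` follow an outer and an inner arc in the
coordinates `(ξ, σ)`.

Both arcs solve linear equations with constant coefficients: `z'' = -ω² z` outside, and `w'' = Ω² w`
inside after Levi-Civita regularisation, for which collision is an ordinary zero of `w`. The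
homothetic orbit is a real multiple of a fixed vector, meets the boundary orthogonally and hence
transversally, and has explicit return times. The implicit function theorem makes nearby hitting
times `C¹`, while monotonicity at the two ends and compactness in between show that these are first
hits (`exists_firstHit`).

Let `ν` be the unit vector along `p`. Since `p` is orthogonal to the boundary, `|γ|` and both
potentials are stationary there, and all initial variations are tangential, along `iν`. The change
of the hitting time displaces the end point and end velocity only along `ν`, which neither section
coordinate sees to first order. The linearised arcs are thus obtained at fixed time, with a
curvature term from the rotation of the tangent (`BoundaryChart.fderiv_sectionMap`). In arc length
and `σ` both matrices have determinant 1; the square of the trace of their product, minus 4, is the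
discriminant (`det_trace_return`). For determinant 1 the sign of this quantity separates real
reciprocal eigenvalues from a conjugate pair on the unit circle.

The return relation is single-valued (`IsReturnData.eq_of_isCycle`): the initial value problems have
unique solutions, the first hitting times must agree, energy and tangential component leave two
candidates for the refracted velocity, and the one pointing outwards is excluded. All local return
maps therefore have the same germ. -/

noncomputable section

namespace GalacticRefraction

/-! ### Linear algebra: plane endomorphisms of determinant 1 -/

/-- The matrix of an endomorphism of `ℝ × ℝ` in the standard basis determines its characteristic
polynomial. -/
theorem charpoly_prod_endomorphism (L : ℝ × ℝ →L[ℝ] ℝ × ℝ) {m₁₁ m₁₂ m₂₁ m₂₂ : ℝ}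
    (hL : ∀ u, L u = (m₁₁ * u.1 + m₁₂ * u.2, m₂₁ * u.1 + m₂₂ * u.2)) :
    L.toLinearMap.charpoly =
      Polynomial.X ^ 2 - Polynomial.C (m₁₁ + m₂₂) * Polynomial.X
        + Polynomial.C (m₁₁ * m₂₂ - m₁₂ * m₂₁) := by
  have hM : LinearMap.toMatrix (Module.Basis.finTwoProd ℝ) (Module.Basis.finTwoProd ℝ) L.toLinearMap
      = !![m₁₁, m₁₂; m₂₁, m₂₂] := by
    ext i j
    fin_cases i <;> fin_cases j <;> simp [LinearMap.toMatrix_apply, hL]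
  rw [← LinearMap.charpoly_toMatrix L.toLinearMap (Module.Basis.finTwoProd ℝ), hM,
    Matrix.charpoly_fin_two, Matrix.trace_fin_two, Matrix.det_fin_two]
  simp

/-- The two roots have product 1; the larger one in absolute value takes the square root with the
sign of `t`. -/
theorem exists_one_lt_abs_of_four_lt_sq {t : ℝ} (ht : 4 < t ^ 2) :
    ∃ l : ℝ, 1 < |l| ∧ l ^ 2 - t * l + 1 = 0 := by
  have hs : √(t ^ 2 - 4) ^ 2 = t ^ 2 - 4 := Real.sq_sqrt (by linarith)
  have hs0 : 0 < √(t ^ 2 - 4) := Real.sqrt_pos.2 (by linarith)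
  rcases le_total 0 t with h | h
  · refine ⟨(t + √(t ^ 2 - 4)) / 2, ?_, by linear_combination hs / 4⟩
    have : 2 < t := by nlinarith
    rw [lt_abs]; left; linarith
  · refine ⟨(t - √(t ^ 2 - 4)) / 2, ?_, by linear_combination hs / 4⟩
    have : t < -2 := by nlinarith
    rw [lt_abs]; right; linarith

theorem eigenvalues_of_four_lt_trace_sq (L : ℝ × ℝ →L[ℝ] ℝ × ℝ) {m₁₁ m₁₂ m₂₁ m₂₂ : ℝ}
    (hL : ∀ u, L u = (m₁₁ * u.1 + m₁₂ * u.2, m₂₁ * u.1 + m₂₂ * u.2))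
    (hdet : m₁₁ * m₂₂ - m₁₂ * m₂₁ = 1) (htr : 4 < (m₁₁ + m₂₂) ^ 2) :
    ∃ l : ℝ, 1 < |l| ∧ Module.End.HasEigenvalue L.toLinearMap l ∧
      Module.End.HasEigenvalue L.toLinearMap l⁻¹ := by
  obtain ⟨l, hl, hroot⟩ := exists_one_lt_abs_of_four_lt_sq htr
  have hl0 : l ≠ 0 := by rintro rfl; simp at hl; linarith
  refine ⟨l, hl, ?_, ?_⟩
  · rw [Module.End.hasEigenvalue_iff_isRoot_charpoly, charpoly_prod_endomorphism L hL, hdet]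
    simp only [Polynomial.IsRoot.def, Polynomial.eval_add, Polynomial.eval_sub, Polynomial.eval_pow,
      Polynomial.eval_X, Polynomial.eval_mul, Polynomial.eval_C]
    exact hroot
  · rw [Module.End.hasEigenvalue_iff_isRoot_charpoly, charpoly_prod_endomorphism L hL, hdet]
    simp only [Polynomial.IsRoot.def, Polynomial.eval_add, Polynomial.eval_sub, Polynomial.eval_pow,
      Polynomial.eval_X, Polynomial.eval_mul, Polynomial.eval_C]
    field_simp
    linear_combination hroot

theorem tendsto_norm_pow_atTop_of_hasEigenvalue (L : ℝ × ℝ →L[ℝ] ℝ × ℝ) {l : ℝ} (hl : 1 < |l|)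
    (h : Module.End.HasEigenvalue L.toLinearMap l) :
    ∃ u : ℝ × ℝ, Tendsto (fun n : ℕ => ‖(L ^ n) u‖) atTop atTop := by
  obtain ⟨u, hu⟩ := h.exists_hasEigenvector
  refine ⟨u, ?_⟩
  have hu1 : L u = l • u := hu.apply_eq_smul
  have hpow : ∀ n : ℕ, (L ^ n) u = l ^ n • u := by
    intro n
    induction n with
    | zero => simp
    | succ n ih => rw [pow_succ', mul_apply_eq_comp, ih, map_smul, hu1, smul_smul, pow_succ]
  simp only [hpow, norm_smul, norm_pow, Real.norm_eq_abs]
  exact (tendsto_pow_atTop_atTop_of_one_lt hl).atTop_mul_const (norm_pos_iff.2 hu.2)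

theorem charpoly_roots_of_trace_sq_lt_four (L : ℝ × ℝ →L[ℝ] ℝ × ℝ) {m₁₁ m₁₂ m₂₁ m₂₂ : ℝ}
    (hL : ∀ u, L u = (m₁₁ * u.1 + m₁₂ * u.2, m₂₁ * u.1 + m₂₂ * u.2))
    (hdet : m₁₁ * m₂₂ - m₁₂ * m₂₁ = 1) (htr : (m₁₁ + m₂₂) ^ 2 < 4) :
    ∃ l : ℂ, ‖l‖ = 1 ∧ l.im ≠ 0 ∧
      (L.toLinearMap.charpoly.map (algebraMap ℝ ℂ)).roots = {l, (starRingEnd ℂ) l} := by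
  set t := m₁₁ + m₂₂ with ht
  have hs : √(1 - t ^ 2 / 4) ^ 2 = 1 - t ^ 2 / 4 := Real.sq_sqrt (by linarith)
  have hs0 : 0 < √(1 - t ^ 2 / 4) := Real.sqrt_pos.2 (by linarith)
  set s := √(1 - t ^ 2 / 4) with hsdef
  refine ⟨⟨t / 2, s⟩, ?_, hs0.ne', ?_⟩
  · rw [← sq_eq_sq₀ (norm_nonneg _) zero_le_one, ← Complex.normSq_eq_norm_sq, Complex.normSq_mk]
    linear_combination hs
  · have hfac : L.toLinearMap.charpoly.map (algebraMap ℝ ℂ) =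
        (Polynomial.X - Polynomial.C (⟨t / 2, s⟩ : ℂ)) *
          (Polynomial.X - Polynomial.C ((starRingEnd ℂ) (⟨t / 2, s⟩ : ℂ))) := by
      have h1 : (⟨t / 2, s⟩ : ℂ) + (starRingEnd ℂ) (⟨t / 2, s⟩ : ℂ) = (t : ℂ) := by
        apply Complex.ext <;> simp
      have h2 : (⟨t / 2, s⟩ : ℂ) * (starRingEnd ℂ) (⟨t / 2, s⟩ : ℂ) = 1 := by
        apply Complex.ext
        · simp; linear_combination hs
        · simp; ring
      have h3 : ((Polynomial.X : Polynomial ℂ) - Polynomial.C (⟨t / 2, s⟩ : ℂ)) *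
          (Polynomial.X - Polynomial.C ((starRingEnd ℂ) (⟨t / 2, s⟩ : ℂ))) =
          Polynomial.X ^ 2 - Polynomial.C ((⟨t / 2, s⟩ : ℂ) + (starRingEnd ℂ) (⟨t / 2, s⟩ : ℂ))
            * Polynomial.X + Polynomial.C ((⟨t / 2, s⟩ : ℂ) * (starRingEnd ℂ) (⟨t / 2, s⟩ : ℂ)) := by
        simp only [Polynomial.C_add, Polynomial.C_mul]; ring
      rw [h3, h1, h2, charpoly_prod_endomorphism L hL, hdet]
      simp [← ht]
    rw [hfac, Polynomial.roots_mul (mul_ne_zero (Polynomial.X_sub_C_ne_zero _)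
      (Polynomial.X_sub_C_ne_zero _)), Polynomial.roots_X_sub_C, Polynomial.roots_X_sub_C]
    rfl

/-- With trace `2 cos θ`, Cayley–Hamilton is the Chebyshev recurrence, whence `sin θ • L ^ n = sin
(nθ) • L - sin ((n - 1)θ) • 1`. This bounds all powers without diagonalising over `ℂ`. -/
theorem norm_pow_le_of_trace_sq_lt_four (L : ℝ × ℝ →L[ℝ] ℝ × ℝ) {m₁₁ m₁₂ m₂₁ m₂₂ : ℝ}
    (hL : ∀ u, L u = (m₁₁ * u.1 + m₁₂ * u.2, m₂₁ * u.1 + m₂₂ * u.2))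
    (hdet : m₁₁ * m₂₂ - m₁₂ * m₂₁ = 1) (htr : (m₁₁ + m₂₂) ^ 2 < 4) :
    ∃ C : ℝ, ∀ (n : ℕ) (u : ℝ × ℝ), ‖(L ^ n) u‖ ≤ C * ‖u‖ := by
  set t := m₁₁ + m₂₂ with ht
  have hlt : |t / 2| < 1 := by
    rw [abs_lt]; constructor <;> nlinarith
  obtain ⟨hlt1, hlt2⟩ := abs_lt.1 hlt
  set θ := Real.arccos (t / 2)
  have hcos : Real.cos θ = t / 2 := Real.cos_arccos hlt1.le hlt2.le
  have hsin : 0 < Real.sin θ :=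
    Real.sin_pos_of_pos_of_lt_pi (Real.arccos_pos.2 hlt2) (Real.arccos_lt_pi.2 hlt1)
  have hCH : ∀ u, L (L u) = t • L u - u := by
    intro u
    ext
    · simp only [hL, Prod.smul_fst, Prod.fst_sub, smul_eq_mul, ht]; linear_combination (-u.1) * hdet
    · simp only [hL, Prod.smul_snd, Prod.snd_sub, smul_eq_mul, ht]; linear_combination (-u.2) * hdet
  have hpow : ∀ (n : ℕ) (u : ℝ × ℝ),
      Real.sin θ • (L ^ n) u = Real.sin (n * θ) • L u - Real.sin (n * θ - θ) • u := by
    intro n u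
    induction n with
    | zero => simp
    | succ n ih =>
      rw [pow_succ', mul_apply_eq_comp, ← map_smul, ih, map_sub, map_smul, map_smul, hCH]
      have e1 : ((n + 1 : ℕ) : ℝ) * θ = n * θ + θ := by push_cast; ring
      have e2 : Real.sin (n * θ + θ) = t * Real.sin (n * θ) - Real.sin (n * θ - θ) := by
        rw [Real.sin_add, Real.sin_sub, hcos]; ring
      rw [e1, e2, add_sub_cancel_right]
      module
  refine ⟨(‖L‖ + 1) / Real.sin θ, fun n u => ?_⟩
  have hn : Real.sin θ * ‖(L ^ n) u‖ ≤ (‖L‖ + 1) * ‖u‖ := by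
    have h1 : Real.sin θ * ‖(L ^ n) u‖ = ‖Real.sin θ • (L ^ n) u‖ := by
      rw [norm_smul, Real.norm_of_nonneg hsin.le]
    rw [h1, hpow]
    calc _ ≤ ‖Real.sin (n * θ) • L u‖ + ‖Real.sin (n * θ - θ) • u‖ := norm_sub_le _ _
      _ ≤ 1 * (‖L‖ * ‖u‖) + 1 * ‖u‖ := by
        rw [norm_smul, norm_smul, Real.norm_eq_abs, Real.norm_eq_abs]
        gcongr
        · exact Real.abs_sin_le_one _
        · exact L.le_opNorm u
        · exact Real.abs_sin_le_one _
      _ = _ := by ring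
  rw [div_mul_eq_mul_div, le_div_iff₀ hsin]
  linarith

/-! ### The scalar equation `x'' = c x` and uniqueness for its vector version -/

section

/-- `C, S` is the fundamental system of the scalar equation `x'' = c x` with `C(0) = S'(0) = 1` and
`C'(0) = S(0) = 0`. -/
structure IsFundamentalSystem (c : ℝ) (C S : ℝ → ℝ) : Prop where
  deriv_C : ∀ s, HasDerivAt C (c * S s) s
  deriv_S : ∀ s, HasDerivAt S (C s) s
  sq_sub : ∀ s, C s ^ 2 - c * S s ^ 2 = 1
  C_zero : C 0 = 1
  S_zero : S 0 = 0
  contDiff_C : ContDiff ℝ 1 C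
  contDiff_S : ContDiff ℝ 1 S

theorem isFundamentalSystem_cos {ω : ℝ} (hω : ω ≠ 0) :
    IsFundamentalSystem (-ω ^ 2) (fun s => Real.cos (ω * s)) (fun s => Real.sin (ω * s) / ω) where
  deriv_C s := by
    have := ((hasDerivAt_id s).const_mul ω).cos
    refine this.congr_deriv ?_
    simp; field_simp
  deriv_S s := by
    have := (((hasDerivAt_id s).const_mul ω).sin).div_const ω
    refine this.congr_deriv ?_
    simp; field_simp
  sq_sub s := by
    field_simp
    linear_combination Real.sin_sq_add_cos_sq (ω * s)
  C_zero := by simp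
  S_zero := by simp
  contDiff_C := by fun_prop
  contDiff_S := by fun_prop

theorem isFundamentalSystem_cosh {ω : ℝ} (hω : ω ≠ 0) :
    IsFundamentalSystem (ω ^ 2) (fun s => Real.cosh (ω * s)) (fun s => Real.sinh (ω * s) / ω) where
  deriv_C s := by
    have := ((hasDerivAt_id s).const_mul ω).cosh
    refine this.congr_deriv ?_
    simp; field_simp
  deriv_S s := by
    have := (((hasDerivAt_id s).const_mul ω).sinh).div_const ω
    refine this.congr_deriv ?_
    simp; field_simp
  sq_sub s := by
    field_simp
    linear_combination Real.cosh_sq_sub_sinh_sq (ω * s)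
  C_zero := by simp
  S_zero := by simp
  contDiff_C := by fun_prop
  contDiff_S := by fun_prop

namespace IsFundamentalSystem

variable {c : ℝ} {C S : ℝ → ℝ}

theorem hasDerivAt_position (H : IsFundamentalSystem c C S) (z₀ v₀ : ℂ) (s : ℝ) :
    HasDerivAt (fun s => C s • z₀ + S s • v₀) ((c * S s) • z₀ + C s • v₀) s :=
  ((H.deriv_C s).smul_const z₀).add ((H.deriv_S s).smul_const v₀)

theorem hasDerivAt_velocity (H : IsFundamentalSystem c C S) (z₀ v₀ : ℂ) (s : ℝ) :
    HasDerivAt (fun s => (c * S s) • z₀ + C s • v₀) (c • (C s • z₀ + S s • v₀)) s := by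
  refine ((((H.deriv_S s).const_mul c).smul_const z₀).add
    ((H.deriv_C s).smul_const v₀)).congr_deriv ?_
  module

/-- Conservation of energy. -/
theorem norm_velocity_sq (H : IsFundamentalSystem c C S) (z₀ v₀ : ℂ) (s : ℝ) :
    ‖(c * S s) • z₀ + C s • v₀‖ ^ 2 - c * ‖C s • z₀ + S s • v₀‖ ^ 2 = ‖v₀‖ ^ 2 - c * ‖z₀‖ ^ 2 := by
  simp only [← Complex.normSq_eq_norm_sq, Complex.normSq_apply, Complex.add_re, Complex.add_im,
    Complex.smul_re, Complex.smul_im, smul_eq_mul]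
  linear_combination (v₀.re ^ 2 + v₀.im ^ 2 - c * (z₀.re ^ 2 + z₀.im ^ 2)) * H.sq_sub s

theorem eq_zero_of_deriv {T : ℝ} {A : ℝ → ℂ}
    (hA : ∀ s ∈ Icc 0 T, HasDerivWithinAt A 0 (Icc 0 T) s) {s : ℝ} (hs : s ∈ Icc 0 T) :
    A s = A 0 := by
  have hT : 0 ≤ T := hs.1.trans hs.2
  -- A one-point interval lacks unique differentiability, but there is nothing to prove on it.
  rcases hT.eq_or_lt with rfl | hT
  · rw [le_antisymm hs.2 hs.1]
  · refine constant_of_derivWithin_zero (fun x hx => (hA x hx).differentiableWithinAt)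
      (fun x hx => ?_) s hs
    exact (hA x (Ico_subset_Icc_self hx)).derivWithin
      ((uniqueDiffOn_Icc hT) x (Ico_subset_Icc_self hx))

/-- Uniqueness for the vector equation `z'' = c z` on a compact interval. -/
theorem unique (H : IsFundamentalSystem c C S) {T : ℝ} {z v : ℝ → ℂ}
    (hz : ∀ s ∈ Icc 0 T, HasDerivWithinAt z (v s) (Icc 0 T) s)
    (hv : ∀ s ∈ Icc 0 T, HasDerivWithinAt v (c • z s) (Icc 0 T) s) {s : ℝ} (hs : s ∈ Icc 0 T) :
    z s = C s • z 0 + S s • v 0 ∧ v s = (c * S s) • z 0 + C s • v 0 := by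
  -- Running the flow backwards gives two first integrals of any solution. Since `C ^ 2 - c * S ^ 2
  -- = 1`, the pair can be solved for `z s` and `v s`.
  have hA : C s • z s - S s • v s = z 0 := by
    have := eq_zero_of_deriv (A := fun s => C s • z s - S s • v s) (T := T) (fun s hs => by
      refine (((H.deriv_C s).hasDerivWithinAt.smul (hz s hs)).sub
        ((H.deriv_S s).hasDerivWithinAt.smul (hv s hs))).congr_deriv ?_
      module) hs
    simpa [H.C_zero, H.S_zero] using this
  have hB : C s • v s - (c * S s) • z s = v 0 := by
    have := eq_zero_of_deriv (A := fun s => C s • v s - (c * S s) • z s) (T := T) (fun s hs => by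
      refine (((H.deriv_C s).hasDerivWithinAt.smul (hv s hs)).sub
        (((H.deriv_S s).const_mul c).hasDerivWithinAt.smul (hz s hs))).congr_deriv ?_
      module) hs
    simpa [H.C_zero, H.S_zero] using this
  have h1 := H.sq_sub s
  rw [← hA, ← hB]
  constructor
  · have : z s = (C s ^ 2 - c * S s ^ 2) • z s := by rw [h1, one_smul]
    nth_rewrite 1 [this]
    module
  · have : v s = (C s ^ 2 - c * S s ^ 2) • v s := by rw [h1, one_smul]
    nth_rewrite 1 [this]
    module

end IsFundamentalSystem

end

/-! ### Topology of the domain and curvilinear coordinates at the boundary -/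

section

namespace IsRegularDomain

variable {D : Set ℂ} {γ : ℝ → ℂ}

theorem frontier_eq_Icc (hD : IsRegularDomain D γ) (ξ : ℝ) :
    frontier D = γ '' Icc (ξ - π) (ξ + π) := by
  have h1 := hD.periodic.image_Icc two_pi_pos 0
  have h2 := hD.periodic.image_Icc two_pi_pos (ξ - π)
  rw [zero_add] at h1
  rw [hD.frontier_eq, h1, ← h2]
  congr 2
  ring

theorem mem_frontier (hD : IsRegularDomain D γ) (x : ℝ) : γ x ∈ frontier D := by
  have h1 := hD.periodic.image_Icc two_pi_pos 0
  rw [zero_add] at h1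
  rw [hD.frontier_eq, h1]
  exact mem_range_self x

theorem exists_int_mul_of_eq (hD : IsRegularDomain D γ) {a b : ℝ} (hab : γ a = γ b) :
    ∃ n : ℤ, b = a + n * (2 * π) := by
  have hp := two_pi_pos
  have ha : γ (toIcoMod hp 0 a) = γ a := by
    rw [toIcoMod]; exact hD.periodic.sub_zsmul_eq _
  have hb : γ (toIcoMod hp 0 b) = γ b := by
    rw [toIcoMod]; exact hD.periodic.sub_zsmul_eq _
  have hma : toIcoMod hp 0 a ∈ Ico 0 (2 * π) := by simpa using toIcoMod_mem_Ico hp 0 a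
  have hmb : toIcoMod hp 0 b ∈ Ico 0 (2 * π) := by simpa using toIcoMod_mem_Ico hp 0 b
  have := hD.injOn hma hmb (by rw [ha, hb, hab])
  refine ⟨toIcoDiv hp 0 b - toIcoDiv hp 0 a, ?_⟩
  simp only [toIcoMod, zsmul_eq_mul] at this
  push_cast
  linarith

/-- One strict and one weak bound already keep the parameters less than a period apart. The weak one
admits the end points of the compact window around `ξ`. -/
theorem eq_of_abs_sub_lt (hD : IsRegularDomain D γ) {ξ x y : ℝ} (hx : |x - ξ| < π)
    (hy : |y - ξ| ≤ π) (h : γ x = γ y) : x = y := by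
  obtain ⟨n, hn⟩ := hD.exists_int_mul_of_eq h
  rw [abs_lt] at hx
  rw [abs_le] at hy
  have hpi := pi_pos
  have h1 : (n : ℝ) < 1 := by nlinarith
  have h2 : (-1 : ℝ) < n := by nlinarith
  have h3 : n < 1 := by exact_mod_cast h1
  have h4 : -1 < n := by exact_mod_cast h2
  have : n = 0 := by omega
  simp [this] at hn
  exact hn.symm

/-- Needed because a cycle fixes the parameter of its junction point only up to multiples of `2π`.
-/
theorem unitTangent_eq (hD : IsRegularDomain D γ) {x y : ℝ} (h : γ x = γ y) :
    unitTangent γ x = unitTangent γ y := by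
  obtain ⟨n, hn⟩ := hD.exists_int_mul_of_eq h
  have hd : deriv γ y = deriv γ x := by
    rw [hn]
    have : (fun t => γ (t + n * (2 * π))) = γ := by
      funext t
      have := hD.periodic.int_mul n t
      simpa using this
    conv_rhs => rw [← this]
    rw [deriv_comp_add_const]
  simp [unitTangent, hd]

theorem norm_unitTangent (hD : IsRegularDomain D γ) (x : ℝ) : ‖unitTangent γ x‖ = 1 := by
  have : ‖deriv γ x‖ ≠ 0 := norm_ne_zero_iff.2 (hD.deriv_ne_zero x)
  rw [unitTangent, norm_smul, norm_inv, norm_norm, inv_mul_cancel₀ this]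

theorem deriv_eq_norm_smul (hD : IsRegularDomain D γ) (x : ℝ) :
    deriv γ x = ‖deriv γ x‖ • unitTangent γ x := by
  have : ‖deriv γ x‖ ≠ 0 := norm_ne_zero_iff.2 (hD.deriv_ne_zero x)
  rw [unitTangent, smul_smul, mul_inv_cancel₀ this, one_smul]

theorem contDiff_unitTangent (hD : IsRegularDomain D γ) : ContDiff ℝ 1 (unitTangent γ) := by
  have h1 : ContDiff ℝ 1 (deriv γ) := by
    have := hD.contDiff
    rw [show (2 : WithTop ℕ∞) = 1 + 1 by norm_num, contDiff_succ_iff_deriv] at this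
    exact this.2.2
  exact ((h1.norm ℝ hD.deriv_ne_zero).inv fun x => norm_ne_zero_iff.2 (hD.deriv_ne_zero x)).smul h1

/-- A connected set that does not meet the boundary lies on one side of it. -/
theorem subset_or_disjoint_closure (hD : IsRegularDomain D γ) {s : Set ℂ} (hs : IsPreconnected s)
    (hf : ∀ z ∈ s, z ∉ frontier D) : s ⊆ D ∨ s ⊆ (closure D)ᶜ := by
  refine hs.subset_or_subset hD.isOpen isClosed_closure.isOpen_compl ?_ ?_
  · exact disjoint_compl_right.mono_left subset_closure
  · intro z hz
    by_cases h : z ∈ D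
    · exact Or.inl h
    · refine Or.inr fun hc => hf z hz ?_
      rw [frontier, hD.isOpen.interior_eq]
      exact ⟨hc, h⟩

variable {ξ : ℝ}

theorem point_ne_zero (hD : IsRegularDomain D γ) (x : ℝ) : γ x ≠ 0 := by
  intro h
  have h1 := hD.mem_frontier x
  rw [h, frontier, hD.isOpen.interior_eq] at h1
  exact h1.2 hD.zero_mem

/-- The segment from `0` towards `γ ξ`, without its end point, is connected, avoids the boundary and
contains `0 ∈ D`. -/
theorem smul_mem_of_lt_one (hD : IsRegularDomain D γ)
    (hray : {z : ℂ | ∃ t : ℝ, 0 ≤ t ∧ z = t • γ ξ} ∩ frontier D = {γ ξ}) {t : ℝ} (h0 : 0 ≤ t)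
    (h1 : t < 1) : t • γ ξ ∈ D := by
  have hs : IsPreconnected ((fun t : ℝ => t • γ ξ) '' Ico 0 1) :=
    isPreconnected_Ico.image _ (by fun_prop)
  have hf : ∀ z ∈ (fun t : ℝ => t • γ ξ) '' Ico 0 1, z ∉ frontier D := by
    rintro _ ⟨u, hu, rfl⟩ hf
    have : u • γ ξ ∈ ({γ ξ} : Set ℂ) := hray ▸ ⟨⟨u, hu.1, rfl⟩, hf⟩
    have h2 : (u - 1) • γ ξ = 0 := by
      rw [sub_smul, one_smul, mem_singleton_iff.1 this, sub_self]
    rcases smul_eq_zero.1 h2 with h | h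
    · linarith [hu.2]
    · exact hD.point_ne_zero ξ h
  rcases hD.subset_or_disjoint_closure hs hf with h | h
  · exact h ⟨t, ⟨h0, h1⟩, rfl⟩
  · exact absurd (subset_closure hD.zero_mem) (h ⟨0, ⟨le_rfl, one_pos⟩, by simp⟩)

/-- The ray beyond `γ ξ` is connected, avoids the boundary and is unbounded, so it cannot lie in
`D`. -/
theorem smul_notMem_closure_of_one_lt (hD : IsRegularDomain D γ)
    (hray : {z : ℂ | ∃ t : ℝ, 0 ≤ t ∧ z = t • γ ξ} ∩ frontier D = {γ ξ}) {t : ℝ} (h1 : 1 < t) :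
    t • γ ξ ∉ closure D := by
  have hs : IsPreconnected ((fun t : ℝ => t • γ ξ) '' Ioi 1) :=
    isPreconnected_Ioi.image _ (by fun_prop)
  have hp : 0 < ‖γ ξ‖ := norm_pos_iff.2 (hD.point_ne_zero ξ)
  have hf : ∀ z ∈ (fun t : ℝ => t • γ ξ) '' Ioi 1, z ∉ frontier D := by
    rintro _ ⟨u, hu, rfl⟩ hf
    have hu' : (1 : ℝ) < u := hu
    have : u • γ ξ ∈ ({γ ξ} : Set ℂ) := hray ▸ ⟨⟨u, by linarith, rfl⟩, hf⟩
    have h2 : (u - 1) • γ ξ = 0 := by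
      rw [sub_smul, one_smul, mem_singleton_iff.1 this, sub_self]
    rcases smul_eq_zero.1 h2 with h | h
    · linarith
    · exact hD.point_ne_zero ξ h
  rcases hD.subset_or_disjoint_closure hs hf with h | h
  · obtain ⟨R, hR⟩ := hD.isBounded.exists_norm_le
    have h2 : (max 1 (R / ‖γ ξ‖) + 1) • γ ξ ∈ D :=
      h ⟨_, mem_Ioi.2 (lt_of_le_of_lt (le_max_left _ _) (lt_add_one _)), rfl⟩
    have h3 := hR _ h2
    have h4 : R / ‖γ ξ‖ < max 1 (R / ‖γ ξ‖) + 1 := (le_max_right _ _).trans_lt (lt_add_one _)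
    rw [norm_smul, Real.norm_of_nonneg (by positivity)] at h3
    rw [div_lt_iff₀ hp] at h4
    linarith
  · exact h ⟨t, h1, rfl⟩

end IsRegularDomain

/-- The sign `κ` records the orientation of the parametrisation, which is not prescribed; it is
carried through all later formulas and drops out by `κ ^ 2 = 1`. -/
theorem exists_eq_smul_I_mul {ν t : ℂ} (hν : ‖ν‖ = 1) (ht : ‖t‖ = 1) (h : inner ℝ ν t = 0) :
    ∃ κ : ℝ, κ ^ 2 = 1 ∧ t = κ • (Complex.I * ν) := by
  have h1 : ν.re * ν.re + ν.im * ν.im = 1 := by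
    rw [← Complex.normSq_apply, Complex.normSq_eq_norm_sq, hν]; norm_num
  have h2 : t.re * t.re + t.im * t.im = 1 := by
    rw [← Complex.normSq_apply, Complex.normSq_eq_norm_sq, ht]; norm_num
  have h3 : t.re * ν.re + t.im * ν.im = 0 := by
    simpa [Complex.inner, Complex.mul_re] using h
  refine ⟨ν.re * t.im - ν.im * t.re, ?_, ?_⟩
  · linear_combination (t.re * t.re + t.im * t.im) * h1 + h2 - (t.re * ν.re + t.im * ν.im) * h3
  · apply Complex.ext
    · simp
      linear_combination (-t.re) * h1 + ν.re * h3
    · simp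
      linear_combination (-t.im) * h1 + ν.im * h3

/-- Curvilinear coordinates near the boundary point `γ ξ`, where the boundary is orthogonal to the
unit vector `ν`: a point `z` near `γ ξ` is `γ (X z) + Y z ν`, and the sign of `Y` tells on which side
of the boundary it is. -/
structure BoundaryChart (D : Set ℂ) (γ : ℝ → ℂ) (ξ : ℝ) (ν : ℂ) (κ : ℝ) (X Y : ℂ → ℝ) : Prop where
  norm_ν : ‖ν‖ = 1
  point_eq : γ ξ = ‖γ ξ‖ • ν
  κ_sq : κ ^ 2 = 1
  tangent_eq : unitTangent γ ξ = κ • (Complex.I * ν)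
  contDiffAt_X : ContDiffAt ℝ 2 X (γ ξ)
  contDiffAt_Y : ContDiffAt ℝ 2 Y (γ ξ)
  coord_eq : ∀ᶠ z in 𝓝 (γ ξ), γ (X z) + Y z • ν = z
  coord_boundary : ∀ᶠ x in 𝓝 ξ, X (γ x) = x ∧ Y (γ x) = 0
  inside : ∀ᶠ z in 𝓝 (γ ξ), Y z < 0 → z ∈ D
  outside : ∀ᶠ z in 𝓝 (γ ξ), 0 < Y z → z ∉ closure D

/-- The map `(x, y) ↦ γ x + y • ν` is a local diffeomorphism because `γ' ξ` and `ν` are orthogonal.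
No remote part of the curve comes near `γ ξ`, so each half of a small box misses the boundary and
lies on one side, which is identified by a test point on the ray. -/
theorem exists_boundaryChart {D : Set ℂ} {γ : ℝ → ℂ} {ξ : ℝ} (hD : IsRegularDomain D γ)
    (hperp : inner ℝ (γ ξ) (deriv γ ξ) = 0)
    (hray : {z : ℂ | ∃ t : ℝ, 0 ≤ t ∧ z = t • γ ξ} ∩ frontier D = {γ ξ}) :
    ∃ (ν : ℂ) (κ : ℝ) (X Y : ℂ → ℝ), BoundaryChart D γ ξ ν κ X Y := by
  have hp : γ ξ ≠ 0 := hD.point_ne_zero ξ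
  have hr : ‖γ ξ‖ ≠ 0 := norm_ne_zero_iff.2 hp
  set ν : ℂ := ‖γ ξ‖⁻¹ • γ ξ with hνdef
  have hν : ‖ν‖ = 1 := by rw [hνdef, norm_smul, norm_inv, norm_norm, inv_mul_cancel₀ hr]
  have hpν : γ ξ = ‖γ ξ‖ • ν := by rw [hνdef, smul_smul, mul_inv_cancel₀ hr, one_smul]
  have hνd : inner ℝ ν (deriv γ ξ) = 0 := by rw [hνdef, real_inner_smul_left, hperp, mul_zero]
  obtain ⟨κ, hκ, htκ⟩ := exists_eq_smul_I_mul hν (hD.norm_unitTangent ξ)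
    (by rw [unitTangent, real_inner_smul_right, hνd, mul_zero])
  have hνν : inner ℝ ν ν = 1 := by rw [real_inner_self_eq_norm_sq, hν, one_pow]
  have hℓ : ‖deriv γ ξ‖ ≠ 0 := norm_ne_zero_iff.2 (hD.deriv_ne_zero ξ)
  let Φ : ℝ × ℝ → ℂ := fun q => γ q.1 + q.2 • ν
  have hΦ : ContDiff ℝ 2 Φ := by
    have := hD.contDiff
    fun_prop
  let f' : (ℝ × ℝ) ≃L[ℝ] ℂ := ContinuousLinearEquiv.equivOfInverse
    ((ContinuousLinearMap.fst ℝ ℝ ℝ).smulRight (deriv γ ξ) +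
      (ContinuousLinearMap.snd ℝ ℝ ℝ).smulRight ν)
    (((‖deriv γ ξ‖ ^ 2)⁻¹ • innerSL ℝ (deriv γ ξ)).prod (innerSL ℝ ν))
    (by
      rintro ⟨a, b⟩
      have hdν : inner ℝ (deriv γ ξ) ν = 0 := by rw [real_inner_comm, hνd]
      ext
      · simp only [ContinuousLinearMap.prod_apply, smul_apply, innerSL_apply_apply, add_apply,
          ContinuousLinearMap.smulRight_apply, ContinuousLinearMap.coe_fst',
          ContinuousLinearMap.coe_snd', smul_eq_mul, inner_add_right, real_inner_smul_right, hdν,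
          real_inner_self_eq_norm_sq]
        field_simp
        ring
      · simp only [ContinuousLinearMap.prod_apply, innerSL_apply_apply, add_apply,
          ContinuousLinearMap.smulRight_apply, ContinuousLinearMap.coe_fst',
          ContinuousLinearMap.coe_snd', inner_add_right, real_inner_smul_right, hνd, hνν]
        ring)
    (by
      intro z
      have h1 : ν.re * ν.re + ν.im * ν.im = 1 := by
        rw [← Complex.normSq_apply, Complex.normSq_eq_norm_sq, hν]; norm_num
      have hd : deriv γ ξ = (‖deriv γ ξ‖ * κ) • (Complex.I * ν) := by
        rw [mul_smul, ← htκ, ← hD.deriv_eq_norm_smul]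
      have : ((‖deriv γ ξ‖ ^ 2)⁻¹ * inner ℝ (deriv γ ξ) z) • deriv γ ξ =
          inner ℝ (Complex.I * ν) z • (Complex.I * ν) := by
        conv_lhs => rw [hd]
        have h5 : ‖(‖deriv γ ξ‖ * κ) • (Complex.I * ν)‖ = ‖deriv γ ξ‖ := by rw [← hd]
        rw [h5, real_inner_smul_left, smul_smul]
        congr 1
        field_simp
        rw [hκ, one_mul]
      simp only [ContinuousLinearMap.prod_apply, smul_apply, innerSL_apply_apply,
        add_apply, ContinuousLinearMap.smulRight_apply,
        ContinuousLinearMap.coe_fst', ContinuousLinearMap.coe_snd', smul_eq_mul, this]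
      apply Complex.ext
      · simp [Complex.inner]
        linear_combination z.re * h1
      · simp [Complex.inner]
        linear_combination z.im * h1)
  have hγd : HasDerivAt γ (deriv γ ξ) ξ :=
    (hD.contDiff.differentiable (by norm_num) ξ).hasDerivAt
  have hf' : HasFDerivAt Φ (f' : ℝ × ℝ →L[ℝ] ℂ) (ξ, 0) := by
    have h1 : HasFDerivAt (fun q : ℝ × ℝ => γ q.1)
        ((ContinuousLinearMap.fst ℝ ℝ ℝ).smulRight (deriv γ ξ)) (ξ, 0) := by
      refine (hγd.hasFDerivAt.comp ((ξ, 0) : ℝ × ℝ) (hasFDerivAt_fst (𝕜 := ℝ))).congr_fderiv ?_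
      ext <;> simp
    have h2 : HasFDerivAt (fun q : ℝ × ℝ => q.2 • ν)
        ((ContinuousLinearMap.snd ℝ ℝ ℝ).smulRight ν) (ξ, 0) :=
      (hasFDerivAt_snd (𝕜 := ℝ)).smul_const ν
    exact h1.add h2
  set e := hΦ.contDiffAt.toOpenPartialHomeomorph Φ hf' (by norm_num) with he
  have heΦ : ⇑e = Φ := rfl
  have hsrc : ((ξ, 0) : ℝ × ℝ) ∈ e.source :=
    hΦ.contDiffAt.mem_toOpenPartialHomeomorph_source hf' (by norm_num)
  have hΦ0 : Φ (ξ, 0) = γ ξ := by simp [Φ]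
  have htgt : γ ξ ∈ e.target := by rw [← hΦ0, ← heΦ]; exact e.map_source hsrc
  have hinv : ContDiffAt ℝ 2 e.symm (γ ξ) := by
    rw [← hΦ0]
    exact hΦ.contDiffAt.to_localInverse hf' (by norm_num)
  have hinv0 : e.symm (γ ξ) = (ξ, 0) := by rw [← hΦ0, ← heΦ]; exact e.left_inv hsrc
  have hcoord : ∀ᶠ z in 𝓝 (γ ξ), γ (e.symm z).1 + (e.symm z).2 • ν = z := by
    filter_upwards [e.open_target.mem_nhds htgt] with z hz using e.right_inv hz
  have hbdry : ∀ᶠ x in 𝓝 ξ, (e.symm (γ x)).1 = x ∧ (e.symm (γ x)).2 = 0 := by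
    have hc : ContinuousAt (fun x : ℝ => ((x, 0) : ℝ × ℝ)) ξ := by fun_prop
    filter_upwards [hc.eventually (e.open_source.mem_nhds hsrc)] with x hx
    have : e.symm (γ x) = (x, 0) := by
      have h1 : γ x = e (x, 0) := by rw [heΦ]; simp [Φ]
      rw [h1, e.left_inv hx]
    simp [this]
  -- The rest of the curve is the image of a compact parameter set, which misses `γ ξ` by
  -- injectivity; its complement is a neighbourhood of `γ ξ`.
  have hfront : ∀ᶠ z in 𝓝 (γ ξ), z ∈ frontier D → (e.symm z).2 = 0 := by
    obtain ⟨N, hN, hNo, hξN⟩ := eventually_nhds_iff.1 hbdry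
    have hK : IsCompact (γ '' (Icc (ξ - π) (ξ + π) \ N)) :=
      (isCompact_Icc.diff hNo).image hD.contDiff.continuous
    have hpK : γ ξ ∉ γ '' (Icc (ξ - π) (ξ + π) \ N) := by
      rintro ⟨x, ⟨hx, hxN⟩, hxe⟩
      have := hD.eq_of_abs_sub_lt (ξ := ξ) (x := ξ) (y := x) (by simpa using pi_pos)
        (by rw [abs_le]; constructor <;> linarith [hx.1, hx.2]) hxe.symm
      exact hxN (this ▸ hξN)
    filter_upwards [hK.isClosed.isOpen_compl.mem_nhds hpK] with z hz hzf
    rw [hD.frontier_eq_Icc ξ] at hzf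
    obtain ⟨x, hx, rfl⟩ := hzf
    by_cases hxN : x ∈ N
    · exact (hN x hxN).2
    · exact absurd ⟨x, ⟨hx, hxN⟩, rfl⟩ hz
  have hΦc : Tendsto Φ (𝓝 (ξ, 0)) (𝓝 (γ ξ)) := by
    rw [← hΦ0]; exact hΦ.continuous.continuousAt
  have hbox : ∀ᶠ q in 𝓝 ((ξ, 0) : ℝ × ℝ), q ∈ e.source ∧ (Φ q ∈ frontier D → q.2 = 0) := by
    filter_upwards [e.open_source.mem_nhds hsrc, hΦc.eventually hfront] with q hq hq2
    refine ⟨hq, fun h => ?_⟩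
    have := hq2 h
    rwa [← heΦ, e.left_inv hq] at this
  obtain ⟨δ, hδ, hball⟩ := Metric.eventually_nhds_iff_ball.1 hbox
  have hboxmem : ∀ q : ℝ × ℝ, q ∈ Ioo (ξ - δ) (ξ + δ) ×ˢ Ioo (-δ) δ → q ∈ Metric.ball (ξ, (0:ℝ)) δ := by
    rintro ⟨x, y⟩ ⟨hx, hy⟩
    rw [Metric.mem_ball, Prod.dist_eq, max_lt_iff, Real.dist_eq, Real.dist_eq, abs_lt, abs_lt]
    simp only [mem_Ioo] at hx hy
    refine ⟨⟨?_, ?_⟩, ⟨?_, ?_⟩⟩ <;> simp <;> linarith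
  have hupper : ∀ q ∈ Ioo (ξ - δ) (ξ + δ) ×ˢ Ioo 0 δ, Φ q ∉ closure D := by
    have hs : IsPreconnected (Φ '' (Ioo (ξ - δ) (ξ + δ) ×ˢ Ioo 0 δ)) :=
      (isPreconnected_Ioo.prod isPreconnected_Ioo).image _ hΦ.continuous.continuousOn
    have hf : ∀ z ∈ Φ '' (Ioo (ξ - δ) (ξ + δ) ×ˢ Ioo 0 δ), z ∉ frontier D := by
      rintro _ ⟨q, hq, rfl⟩ hf
      have := (hball q (hboxmem q ⟨hq.1, by linarith [hq.2.1], hq.2.2⟩)).2 hf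
      exact hq.2.1.ne' this
    rcases hD.subset_or_disjoint_closure hs hf with h | h
    · have h1 : Φ (ξ, δ / 2) ∈ D :=
        h ⟨(ξ, δ / 2), ⟨⟨by simp; linarith, by simp; linarith⟩, by simp; linarith, by simp; linarith⟩, rfl⟩
      have h2 : Φ (ξ, δ / 2) = (1 + δ / 2 * ‖γ ξ‖⁻¹) • γ ξ := by
        simp only [Φ, hνdef]; module
      rw [h2] at h1
      refine absurd (subset_closure h1) (hD.smul_notMem_closure_of_one_lt hray ?_)
      have : 0 < ‖γ ξ‖ := norm_pos_iff.2 hp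
      have : 0 < δ / 2 * ‖γ ξ‖⁻¹ := by positivity
      linarith
    · exact fun q hq => h ⟨q, hq, rfl⟩
  have hlower : ∀ q ∈ Ioo (ξ - δ) (ξ + δ) ×ˢ Ioo (-δ) 0, Φ q ∈ D := by
    have hs : IsPreconnected (Φ '' (Ioo (ξ - δ) (ξ + δ) ×ˢ Ioo (-δ) 0)) :=
      (isPreconnected_Ioo.prod isPreconnected_Ioo).image _ hΦ.continuous.continuousOn
    have hf : ∀ z ∈ Φ '' (Ioo (ξ - δ) (ξ + δ) ×ˢ Ioo (-δ) 0), z ∉ frontier D := by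
      rintro _ ⟨q, hq, rfl⟩ hf
      have := (hball q (hboxmem q ⟨hq.1, hq.2.1, by linarith [hq.2.2]⟩)).2 hf
      exact hq.2.2.ne this
    rcases hD.subset_or_disjoint_closure hs hf with h | h
    · exact fun q hq => h ⟨q, hq, rfl⟩
    · have hrp : 0 < ‖γ ξ‖ := norm_pos_iff.2 hp
      -- The second bound keeps the test point on the segment between `0` and `γ ξ`, known to lie in
      -- `D`.
      set ε := min (δ / 2) (‖γ ξ‖ / 2)
      have hε0 : 0 < ε := lt_min (by linarith) (by linarith)
      have hε1 : ε ≤ δ / 2 := min_le_left _ _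
      have hε2 : ε ≤ ‖γ ξ‖ / 2 := min_le_right _ _
      have h1 : Φ (ξ, -ε) ∈ (closure D)ᶜ :=
        h ⟨(ξ, -ε), ⟨⟨by simp; linarith, by simp; linarith⟩, by simp; linarith, by simp; linarith⟩, rfl⟩
      have h2 : Φ (ξ, -ε) = (1 - ε * ‖γ ξ‖⁻¹) • γ ξ := by
        simp only [Φ, hνdef]; module
      rw [h2] at h1
      have h3 : ε * ‖γ ξ‖⁻¹ ≤ 1 / 2 := by
        rw [← div_eq_mul_inv, div_le_iff₀ hrp]; linarith
      have h4 : 0 < ε * ‖γ ξ‖⁻¹ := by positivity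
      exact absurd (subset_closure (hD.smul_mem_of_lt_one hray (by linarith) (by linarith))) h1
  have hnear : ∀ᶠ z in 𝓝 (γ ξ), e.symm z ∈ Ioo (ξ - δ) (ξ + δ) ×ˢ Ioo (-δ) δ := by
    have h1 : Tendsto e.symm (𝓝 (γ ξ)) (𝓝 (ξ, 0)) := by
      rw [← hinv0]; exact hinv.continuousAt
    refine h1.eventually (((isOpen_Ioo.prod isOpen_Ioo)).mem_nhds ?_)
    exact ⟨⟨by simp [hδ], by simp [hδ]⟩, by simp [hδ], by simp [hδ]⟩
  refine ⟨ν, κ, fun z => (e.symm z).1, fun z => (e.symm z).2, ?_⟩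
  refine ⟨hν, hpν, hκ, htκ, hinv.fst, hinv.snd, hcoord, hbdry, ?_, ?_⟩
  · filter_upwards [hnear, hcoord] with z hz hz2 hneg
    rw [← hz2]
    exact hlower (e.symm z) ⟨hz.1, hz.2.1, hneg⟩
  · filter_upwards [hnear, hcoord] with z hz hz2 hpos
    rw [← hz2]
    exact hupper (e.symm z) ⟨hz.1, hpos, hz.2.2⟩

end

/-! ### First-order geometry of the chart: sides, outward normal, curvature -/

section

theorem eventually_pos_of_hasDerivWithinAt {f : ℝ → ℝ} {f' : ℝ} (hf : HasDerivWithinAt f f' (Ici 0) 0)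
    (h0 : f 0 = 0) (hf' : 0 < f') : ∀ᶠ s in 𝓝[>] 0, 0 < f s := by
  have h1 := (hasDerivWithinAt_iff_tendsto_slope' (s := Ioi (0 : ℝ)) (by simp)).1
    (hasDerivWithinAt_Ioi_iff_Ici.2 hf)
  filter_upwards [h1.eventually (lt_mem_nhds hf'), self_mem_nhdsWithin] with s hs hs0
  have hs0' : (0 : ℝ) < s := hs0
  rw [slope_def_field, h0, sub_zero, sub_zero] at hs
  exact (div_pos_iff_of_pos_right hs0').1 hs

theorem eq_inner_smul_add {ν : ℂ} (hν : ‖ν‖ = 1) (z : ℂ) :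
    z = inner ℝ ν z • ν + inner ℝ (Complex.I * ν) z • (Complex.I * ν) := by
  have h1 : ν.re * ν.re + ν.im * ν.im = 1 := by
    rw [← Complex.normSq_apply, Complex.normSq_eq_norm_sq, hν]; norm_num
  apply Complex.ext
  · simp [Complex.inner]
    linear_combination (-z.re) * h1
  · simp [Complex.inner]
    linear_combination (-z.im) * h1

theorem inner_I_mul_self (ν : ℂ) : inner ℝ (Complex.I * ν) ν = 0 := by
  simp [Complex.inner]; ring

theorem inner_self_I_mul (ν : ℂ) : inner ℝ ν (Complex.I * ν) = 0 := by
  simp [Complex.inner]; ring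

namespace BoundaryChart

variable {D : Set ℂ} {γ : ℝ → ℂ} {ξ : ℝ} {ν : ℂ} {κ : ℝ} {X Y : ℂ → ℝ}

theorem inner_ν_ν (hc : BoundaryChart D γ ξ ν κ X Y) : inner ℝ ν ν = 1 := by
  rw [real_inner_self_eq_norm_sq, hc.norm_ν, one_pow]

theorem inner_Iν_Iν (hc : BoundaryChart D γ ξ ν κ X Y) :
    inner ℝ (Complex.I * ν) (Complex.I * ν) = 1 := by
  rw [real_inner_self_eq_norm_sq, norm_mul, Complex.norm_I, hc.norm_ν]; norm_num

theorem X_point (hc : BoundaryChart D γ ξ ν κ X Y) : X (γ ξ) = ξ := hc.coord_boundary.self_of_nhds.1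

theorem Y_point (hc : BoundaryChart D γ ξ ν κ X Y) : Y (γ ξ) = 0 := hc.coord_boundary.self_of_nhds.2

theorem deriv_eq (hD : IsRegularDomain D γ) (hc : BoundaryChart D γ ξ ν κ X Y) :
    deriv γ ξ = (‖deriv γ ξ‖ * κ) • (Complex.I * ν) := by
  rw [mul_smul, ← hc.tangent_eq, ← hD.deriv_eq_norm_smul]

theorem norm_deriv_pos (hD : IsRegularDomain D γ) : 0 < ‖deriv γ ξ‖ :=
  norm_pos_iff.2 (hD.deriv_ne_zero ξ)

theorem hasDerivAt_γ (hD : IsRegularDomain D γ) (x : ℝ) : HasDerivAt γ (deriv γ x) x :=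
  (hD.contDiff.differentiable (by norm_num) x).hasDerivAt

theorem differentiableAt_X (hc : BoundaryChart D γ ξ ν κ X Y) : DifferentiableAt ℝ X (γ ξ) :=
  hc.contDiffAt_X.differentiableAt (by norm_num)

theorem differentiableAt_Y (hc : BoundaryChart D γ ξ ν κ X Y) : DifferentiableAt ℝ Y (γ ξ) :=
  hc.contDiffAt_Y.differentiableAt (by norm_num)

/-- The chart identity `γ (X z) + Y z • ν = z`, differentiated. Pairing with `ν` and `iν` then
yields the gradients of `Y` and `X`. -/
theorem fderiv_coord (hD : IsRegularDomain D γ) (hc : BoundaryChart D γ ξ ν κ X Y) (v : ℂ) :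
    fderiv ℝ X (γ ξ) v • deriv γ ξ + fderiv ℝ Y (γ ξ) v • ν = v := by
  have h1 : HasFDerivAt (fun z => γ (X z) + Y z • ν)
      ((ContinuousLinearMap.toSpanSingleton ℝ (deriv γ ξ)).comp (fderiv ℝ X (γ ξ)) +
        (fderiv ℝ Y (γ ξ)).smulRight ν) (γ ξ) := by
    refine HasFDerivAt.add ?_ (hc.differentiableAt_Y.hasFDerivAt.smul_const ν)
    have h2 : HasDerivAt γ (deriv γ ξ) (X (γ ξ)) := by
      rw [hc.X_point]; exact hasDerivAt_γ hD ξ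
    exact h2.hasFDerivAt.comp (γ ξ) hc.differentiableAt_X.hasFDerivAt
  have h3 := h1.unique ((hasFDerivAt_id (γ ξ)).congr_of_eventuallyEq hc.coord_eq)
  have h4 := congrArg (fun L : ℂ →L[ℝ] ℂ => L v) h3
  simpa using h4

theorem fderiv_Y (hD : IsRegularDomain D γ) (hc : BoundaryChart D γ ξ ν κ X Y) (v : ℂ) :
    fderiv ℝ Y (γ ξ) v = inner ℝ ν v := by
  have h := congrArg (fun z => inner ℝ ν z) (hc.fderiv_coord hD v)
  simp only [inner_add_right, real_inner_smul_right, hc.inner_ν_ν] at h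
  rw [hc.deriv_eq hD, real_inner_smul_right, inner_self_I_mul] at h
  linarith

theorem fderiv_X (hD : IsRegularDomain D γ) (hc : BoundaryChart D γ ξ ν κ X Y) (v : ℂ) :
    fderiv ℝ X (γ ξ) v = κ * inner ℝ (Complex.I * ν) v / ‖deriv γ ξ‖ := by
  have h := congrArg (fun z => inner ℝ (Complex.I * ν) z) (hc.fderiv_coord hD v)
  have hℓ := norm_deriv_pos (ξ := ξ) hD
  simp only [inner_add_right, real_inner_smul_right, inner_I_mul_self] at h
  rw [hc.deriv_eq hD, real_inner_smul_right, hc.inner_Iν_Iν] at h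
  rw [← h]
  field_simp
  linear_combination (-(fderiv ℝ X (γ ξ) v) * ‖deriv γ ξ‖) * hc.κ_sq

/-- A curve that starts at a boundary point near `γ ξ` with non-tangential velocity enters the side
of the boundary to which its velocity points. -/
theorem eventually_side (hD : IsRegularDomain D γ) (hc : BoundaryChart D γ ξ ν κ X Y) :
    ∀ᶠ x in 𝓝 ξ, ∀ (z : ℝ → ℂ) (a b : ℝ), z 0 = γ x →
      HasDerivWithinAt z (a • (-(κ * Complex.I) * unitTangent γ x) + b • unitTangent γ x) (Ici 0) 0 →
      (0 < a → ∀ᶠ s in 𝓝[>] 0, z s ∉ closure D) ∧ (a < 0 → ∀ᶠ s in 𝓝[>] 0, z s ∈ D) := by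
  have hγc : Tendsto γ (𝓝 ξ) (𝓝 (γ ξ)) := hD.contDiff.continuous.continuousAt
  -- At `ξ` the vector is `ν` and the value is 1; positivity persists by continuity.
  have hpos : ∀ᶠ x in 𝓝 ξ, 0 < fderiv ℝ Y (γ x) (-(κ * Complex.I) * unitTangent γ x) := by
    have h1 : ContinuousAt (fderiv ℝ Y) (γ ξ) :=
      (hc.contDiffAt_Y.fderiv_right (m := 1) (by norm_num)).continuousAt
    have h2 : ContinuousAt (fun x => fderiv ℝ Y (γ x) (-(κ * Complex.I) * unitTangent γ x)) ξ :=
      (ContinuousAt.comp (f := γ) h1 hγc).clm_apply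
        (continuousAt_const.mul hD.contDiff_unitTangent.continuous.continuousAt)
    refine h2.eventually (lt_mem_nhds ?_)
    beta_reduce
    rw [hc.fderiv_Y hD, hc.tangent_eq]
    have h3 : -(κ * Complex.I) * κ • (Complex.I * ν) = (κ ^ 2) • ν := by
      simp only [Complex.real_smul]; push_cast
      linear_combination (-(κ : ℂ) ^ 2 * ν) * Complex.I_sq
    rw [h3, hc.κ_sq, one_smul, hc.inner_ν_ν]
    exact one_pos
  have hdiff : ∀ᶠ x in 𝓝 ξ, DifferentiableAt ℝ Y (γ x) := by
    refine hγc.eventually ?_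
    filter_upwards [hc.contDiffAt_Y.eventually (by simp)] with z hz
    exact hz.differentiableAt (by norm_num)
  filter_upwards [hpos, hdiff, hc.coord_boundary.eventually_nhds,
    hγc.eventually hc.inside.eventually_nhds, hγc.eventually hc.outside.eventually_nhds]
    with x hx hdx hbx hin hout z a b hz0 hz
  -- `Y` vanishes along the curve, so only the normal component `a` decides the sign of `Y` after
  -- departure.
  have htan : fderiv ℝ Y (γ x) (unitTangent γ x) = 0 := by
    have h1 := hdx.hasFDerivAt.comp_hasDerivAt x (hasDerivAt_γ hD x)
    have h2 : HasDerivAt (Y ∘ γ) 0 x := by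
      refine (hasDerivAt_const x (0 : ℝ)).congr_of_eventuallyEq ?_
      filter_upwards [hbx] with y hy using hy.2
    rw [unitTangent, map_smul, h1.unique h2, smul_zero]
  have hzc : Tendsto z (𝓝[>] 0) (𝓝 (γ x)) := by
    rw [← hz0]
    exact hz.continuousWithinAt.mono_left (nhdsWithin_mono _ Ioi_subset_Ici_self)
  have hdY : HasDerivWithinAt (Y ∘ z) (a * fderiv ℝ Y (γ x) (-(κ * Complex.I) * unitTangent γ x))
      (Ici 0) 0 := by
    have hdx' : HasFDerivAt Y (fderiv ℝ Y (γ x)) (z 0) := by rw [hz0]; exact hdx.hasFDerivAt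
    refine (hdx'.comp_hasDerivWithinAt 0 hz).congr_deriv ?_
    rw [map_add, map_smul, map_smul, htan, smul_zero, add_zero, smul_eq_mul]
  have hY0 : (Y ∘ z) 0 = 0 := by simp only [Function.comp, hz0]; exact hbx.self_of_nhds.2
  constructor
  · intro ha
    filter_upwards [eventually_pos_of_hasDerivWithinAt hdY hY0 (mul_pos ha hx),
      hzc.eventually hout] with s hs1 hs2 using hs2 hs1
  · intro ha
    have := eventually_pos_of_hasDerivWithinAt hdY.neg (by simpa using hY0)
      (by nlinarith [mul_pos (neg_pos.2 ha) hx])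
    filter_upwards [this, hzc.eventually hin] with s hs1 hs2 using hs2 (by simpa using hs1)

/-- The normal is defined by a pointwise test with no evident regularity. Applying the side
criterion to straight segments shows that the test has the same outcome at all nearby points, so the
normal is a `C¹` field there. -/
theorem outwardNormal_eventuallyEq (hD : IsRegularDomain D γ) (hc : BoundaryChart D γ ξ ν κ X Y) :
    ∀ᶠ x in 𝓝 ξ, outwardNormal D γ x = -(κ * Complex.I) * unitTangent γ x := by
  filter_upwards [hc.eventually_side hD] with x hx
  have hline : ∀ a : ℝ, HasDerivWithinAt
      (fun ε : ℝ => γ x + ε • (a • (-(κ * Complex.I) * unitTangent γ x)))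
      (a • (-(κ * Complex.I) * unitTangent γ x) + (0 : ℝ) • unitTangent γ x) (Ici 0) 0 := by
    intro a
    have := ((hasDerivAt_id (0 : ℝ)).smul_const
      (a • (-(κ * Complex.I) * unitTangent γ x))).const_add (γ x)
    refine this.hasDerivWithinAt.congr_deriv ?_
    simp
  rcases sq_eq_one_iff.1 hc.κ_sq with h | h
  · have := (hx _ 1 0 (by simp) (hline 1)).1 one_pos
    rw [outwardNormal, if_pos]
    · simp [h]
    · simpa [h] using this
  · have := (hx _ (-1) 0 (by simp) (hline (-1))).2 (by norm_num)
    rw [outwardNormal, if_neg]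
    · simp [h]
    · intro hcon
      obtain ⟨s, hs1, hs2⟩ := (hcon.and this).exists
      apply hs1
      apply subset_closure
      simpa [h] using hs2

theorem normal_point (hD : IsRegularDomain D γ) (hc : BoundaryChart D γ ξ ν κ X Y) :
    outwardNormal D γ ξ = ν := by
  rw [(hc.outwardNormal_eventuallyEq hD).self_of_nhds, hc.tangent_eq]
  have h3 : -(κ * Complex.I) * κ • (Complex.I * ν) = (κ ^ 2) • ν := by
    simp only [Complex.real_smul]; push_cast
    linear_combination (-(κ : ℂ) ^ 2 * ν) * Complex.I_sq
  rw [h3, hc.κ_sq, one_smul]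

/-- Frenet's formula: the tangent has constant length, so its derivative has no component along
`iν`. The component along `ν` is read off by differentiating `γ' = |γ'| t`. -/
theorem hasDerivAt_unitTangent (hD : IsRegularDomain D γ) (hc : BoundaryChart D γ ξ ν κ X Y) :
    HasDerivAt (unitTangent γ) (-(curvature D γ ξ * ‖deriv γ ξ‖) • ν) ξ := by
  have ht : HasDerivAt (unitTangent γ) (deriv (unitTangent γ) ξ) ξ :=
    (hD.contDiff_unitTangent.differentiable (by norm_num) ξ).hasDerivAt
  set t' := deriv (unitTangent γ) ξ
  have hℓ := norm_deriv_pos (ξ := ξ) hD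
  have h1 : inner ℝ (Complex.I * ν) t' = 0 := by
    have h2 : HasDerivAt (fun x => inner ℝ (unitTangent γ x) (unitTangent γ x)) 0 ξ := by
      refine (hasDerivAt_const ξ (1 : ℝ)).congr_of_eventuallyEq (Eventually.of_forall fun x => ?_)
      simp only [real_inner_self_eq_norm_sq, hD.norm_unitTangent, one_pow]
    have h3 := (ht.inner ℝ ht).unique h2
    rw [real_inner_comm (unitTangent γ ξ) t', hc.tangent_eq, real_inner_smul_left] at h3
    have hκ : κ ≠ 0 := by
      intro h; have := hc.κ_sq; rw [h] at this; norm_num at this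
    have h4 : κ * inner ℝ (Complex.I * ν) t' = 0 := by linarith
    exact (mul_eq_zero.1 h4).resolve_left hκ
  have h5 : curvature D γ ξ * ‖deriv γ ξ‖ = - inner ℝ ν t' := by
    have hdd : DifferentiableAt ℝ (fun x => ‖deriv γ x‖) ξ := by
      have h1 : ContDiff ℝ 1 (deriv γ) := by
        have := hD.contDiff
        rw [show (2 : WithTop ℕ∞) = 1 + 1 by norm_num, contDiff_succ_iff_deriv] at this
        exact this.2.2
      exact (h1.differentiable (by norm_num) ξ).norm ℝ (hD.deriv_ne_zero ξ)
    have h6 : HasDerivAt (deriv γ) (‖deriv γ ξ‖ • t' +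
        deriv (fun x => ‖deriv γ x‖) ξ • unitTangent γ ξ) ξ := by
      refine (hdd.hasDerivAt.smul ht).congr_of_eventuallyEq (Eventually.of_forall fun x => ?_)
      exact hD.deriv_eq_norm_smul x
    rw [curvature, h6.deriv, hc.normal_point hD, hc.tangent_eq, inner_add_left,
      real_inner_smul_left, real_inner_smul_left, real_inner_smul_left, inner_I_mul_self,
      real_inner_comm ν t']
    field_simp
    ring
  refine ht.congr_deriv ?_
  rw [eq_inner_smul_add hc.norm_ν t', h1, zero_smul, add_zero, h5, neg_neg]

end BoundaryChart

end

/-! ### First hitting times and the linearised section map -/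

section

/-- A function that is strictly differentiable at `(q₀, s₀)` with positive derivative in the last
variable is strictly increasing in that variable near `(q₀, s₀)`, uniformly in `q`. -/
theorem eventually_strictMono_slice {f : (ℝ × ℝ) × ℝ → ℝ} {f' : (ℝ × ℝ) × ℝ →L[ℝ] ℝ} {q₀ : ℝ × ℝ}
    {s₀ : ℝ} (hf : HasStrictFDerivAt f f' (q₀, s₀)) (hpos : 0 < f' (0, 1)) :
    ∃ δ > 0, ∀ᶠ q in 𝓝 q₀, ∀ s₁ s₂, |s₁ - s₀| < δ → |s₂ - s₀| < δ → s₁ < s₂ →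
      f (q, s₁) < f (q, s₂) := by
  have h1 := hf.isLittleO.def (half_pos hpos)
  obtain ⟨δ, hδ, hball⟩ := Metric.eventually_nhds_iff_ball.1 h1
  refine ⟨δ, hδ, ?_⟩
  filter_upwards [Metric.ball_mem_nhds q₀ hδ] with q hq s₁ s₂ h₁ h₂ hlt
  have h2 := hball ((q, s₂), (q, s₁)) (by
    simp only [Metric.mem_ball, Prod.dist_eq, max_lt_iff, Real.dist_eq] at hq ⊢
    exact ⟨⟨hq, h₂⟩, hq, h₁⟩)
  have h3 : ((q, s₂) : (ℝ × ℝ) × ℝ) - (q, s₁) = (s₂ - s₁) • ((0, 1) : (ℝ × ℝ) × ℝ) := by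
    ext <;> simp
  simp only [h3, map_smul, smul_eq_mul, norm_smul, Real.norm_eq_abs, Prod.norm_mk, norm_zero,
    norm_one, abs_of_pos (sub_pos.2 hlt)] at h2
  have h4 := (abs_le.1 h2).1
  have h5 : max (0 : ℝ) 1 = 1 := by norm_num
  rw [h5] at h4
  nlinarith [mul_pos hpos (sub_pos.2 hlt)]

/-- The time of first return to the level set `G = 0` of a family of curves that leave it
transversally, into the open set `W`, and come back to it transversally. -/
theorem exists_firstHit {W : Set ℂ} (hWo : IsOpen W) {p : ℂ} {G : ℂ → ℝ} (hG : ContDiffAt ℝ 1 G p)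
    (hGp : G p = 0) (hGW : ∀ᶠ z in 𝓝 p, 0 < G z → z ∈ W) {Z : (ℝ × ℝ) × ℝ → ℂ} {q₀ : ℝ × ℝ} {T : ℝ}
    (hT : 0 < T) (hZ : ∀ s, ContDiffAt ℝ 1 Z (q₀, s)) (h0 : Z (q₀, 0) = p) (h1 : Z (q₀, T) = p)
    (hmid : ∀ s ∈ Ioo 0 T, Z (q₀, s) ∈ W) (hstart : ∀ᶠ q in 𝓝 q₀, G (Z (q, 0)) = 0)
    (hd0 : 0 < fderiv ℝ G p (fderiv ℝ Z (q₀, 0) (0, 1)))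
    (hdT : fderiv ℝ G p (fderiv ℝ Z (q₀, T) (0, 1)) < 0) :
    ∃ τ : ℝ × ℝ → ℝ, ContDiffAt ℝ 1 τ q₀ ∧ τ q₀ = T ∧
      ∀ᶠ q in 𝓝 q₀, 0 < τ q ∧ G (Z (q, τ q)) = 0 ∧ ∀ s ∈ Ioo 0 (τ q), Z (q, s) ∈ W := by
  set f : (ℝ × ℝ) × ℝ → ℝ := fun x => G (Z x) with hf
  have hfc : ∀ s, Z (q₀, s) = p → ContDiffAt ℝ 1 f (q₀, s) := fun s hs =>
    ContDiffAt.comp (q₀, s) (by rw [hs]; exact hG) (hZ s)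
  have hfd : ∀ s, Z (q₀, s) = p → ∀ v, fderiv ℝ f (q₀, s) v =
      fderiv ℝ G p (fderiv ℝ Z (q₀, s) v) := by
    intro s hs v
    have hG' : HasFDerivAt G (fderiv ℝ G p) (Z (q₀, s)) := by
      rw [hs]; exact (hG.differentiableAt (by norm_num)).hasFDerivAt
    have h2 : HasFDerivAt f ((fderiv ℝ G p).comp (fderiv ℝ Z (q₀, s))) (q₀, s) :=
      hG'.comp (q₀, s) ((hZ s).differentiableAt (by norm_num)).hasFDerivAt
    rw [h2.fderiv]
    rfl
  have hst0 := (hfc 0 h0).hasStrictFDerivAt (by norm_num)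
  have hstT := (hfc T h1).hasStrictFDerivAt (by norm_num)
  have hdT' : fderiv ℝ f (q₀, T) (0, 1) < 0 := by rw [hfd T h1]; exact hdT
  -- The partial derivative in time is a nonzero number: this is transversality at the return.
  have hinv : (fderiv ℝ f (q₀, T) ∘L .inr ℝ (ℝ × ℝ) ℝ).IsInvertible := by
    refine ⟨ContinuousLinearEquiv.unitsEquivAut ℝ (Units.mk0 _ hdT'.ne), ?_⟩
    ext
    simp
  set τ : ℝ × ℝ → ℝ := (hfc T h1).implicitFunction (by norm_num) hinv with hτ
  have hτc : ContDiffAt ℝ 1 τ q₀ := (hfc T h1).contDiffAt_implicitFunction (by norm_num) hinv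
  have hτ0 : τ q₀ = T := (hfc T h1).implicitFunction_apply_self (by norm_num) hinv
  have hτe : ∀ᶠ q in 𝓝 q₀, f (q, τ q) = 0 := by
    filter_upwards [(hfc T h1).eventually_apply_implicitFunction (by norm_num) hinv] with q hq
    rw [hq]
    simp [hf, h1, hGp]
  have hτt : Tendsto τ (𝓝 q₀) (𝓝 T) := by rw [← hτ0]; exact hτc.continuousAt
  refine ⟨τ, hτc, hτ0, ?_⟩
  -- Near time `0` the function `f` increases from `0`, near `T` it decreases to `0`, uniformly in
  -- `q`; so it is positive at both ends of the arc. The times in between form a compact set on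
  -- which openness of `W` suffices.
  obtain ⟨δ₁, hδ₁, hmono⟩ := eventually_strictMono_slice hst0 (by rw [hfd 0 h0]; exact hd0)
  obtain ⟨δ₂, hδ₂, hanti⟩ := eventually_strictMono_slice hstT.fun_neg (by simpa using hdT')
  have hnear : ∀ s, Z (q₀, s) = p → ∃ δ > 0, ∀ᶠ q in 𝓝 q₀, ∀ s', |s' - s| < δ → 0 < f (q, s') →
      Z (q, s') ∈ W := by
    intro s hs
    have h3 : ∀ᶠ z in 𝓝 (Z (q₀, s)), 0 < G z → z ∈ W := by rw [hs]; exact hGW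
    have h2 : ∀ᶠ x in 𝓝 (q₀, s), 0 < f x → Z x ∈ W := (hZ s).continuousAt.eventually h3
    obtain ⟨δ, hδ, hball⟩ := Metric.eventually_nhds_iff_ball.1 h2
    refine ⟨δ, hδ, ?_⟩
    filter_upwards [Metric.ball_mem_nhds q₀ hδ] with q hq s' hs'
    refine hball (q, s') ?_
    simp only [Metric.mem_ball, Prod.dist_eq, max_lt_iff, Real.dist_eq] at hq ⊢
    exact ⟨hq, hs'⟩
  obtain ⟨δ₃, hδ₃, hn0⟩ := hnear 0 h0
  obtain ⟨δ₄, hδ₄, hnT⟩ := hnear T h1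
  have hmin : 0 < min (min δ₁ δ₂) (min δ₃ δ₄) := lt_min (lt_min hδ₁ hδ₂) (lt_min hδ₃ hδ₄)
  set δ := min (min δ₁ δ₂) (min δ₃ δ₄) with hδdef
  have e1 : δ ≤ δ₁ := (min_le_left _ _).trans (min_le_left _ _)
  have e2 : δ ≤ δ₂ := (min_le_left _ _).trans (min_le_right _ _)
  have e3 : δ ≤ δ₃ := (min_le_right _ _).trans (min_le_left _ _)
  have e4 : δ ≤ δ₄ := (min_le_right _ _).trans (min_le_right _ _)
  have hK : ∀ᶠ q in 𝓝 q₀, ∀ s ∈ Icc (δ / 2) (T - δ / 2), Z (q, s) ∈ W := by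
    refine isCompact_Icc.eventually_forall_of_forall_eventually (P := fun q s => Z (q, s) ∈ W) ?_
    intro s hs
    exact (hZ s).continuousAt.eventually
      (hWo.mem_nhds (hmid s ⟨by linarith [hs.1], by linarith [hs.2]⟩))
  filter_upwards [hτe, hτt.eventually (lt_mem_nhds hT), hτt.eventually (gt_mem_nhds (show T < T + δ by
    linarith)), hτt.eventually (lt_mem_nhds (show T - δ < T by linarith)), hmono, hanti, hn0, hnT, hK,
    hstart] with q hq0 hqpos hqlt hqgt hqm hqa hqn0 hqnT hqK hqs
  refine ⟨hqpos, hq0, fun s hs => ?_⟩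
  rcases lt_or_ge s (δ / 2) with h | h
  · refine hqn0 s (by rw [abs_lt]; constructor <;> linarith [hs.1]) ?_
    have := hqm 0 s (by simpa using hδ₁) (by rw [abs_lt]; constructor <;> linarith [hs.1]) hs.1
    have h2 : f (q, 0) = 0 := hqs
    rwa [h2] at this
  rcases le_or_gt s (T - δ / 2) with h' | h'
  · exact hqK s ⟨h, h'⟩
  · refine hqnT s (by rw [abs_lt]; constructor <;> linarith [hs.2]) ?_
    have := hqa s (τ q) (by rw [abs_lt]; constructor <;> linarith [hs.2])
      (by rw [abs_lt]; constructor <;> linarith [hs.2]) hs.2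
    rw [hq0] at this
    simpa using this

/-- Position on the boundary and tangential velocity (divided by `√2`) at the time `τ`. -/
def sectionMap (γ : ℝ → ℂ) (X : ℂ → ℝ) (Z V : (ℝ × ℝ) × ℝ → ℂ) (τ : ℝ × ℝ → ℝ) (q : ℝ × ℝ) : ℝ × ℝ :=
  (X (Z (q, τ q)), inner ℝ (V (q, τ q)) (unitTangent γ (X (Z (q, τ q)))) / √2)

namespace BoundaryChart

variable {D : Set ℂ} {γ : ℝ → ℂ} {ξ : ℝ} {ν : ℂ} {κ : ℝ} {X Y : ℂ → ℝ}

variable {Z V : (ℝ × ℝ) × ℝ → ℂ} {τ : ℝ × ℝ → ℝ} {q₀ : ℝ × ℝ} {T : ℝ}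

theorem contDiffAt_sectionMap (hD : IsRegularDomain D γ) (hc : BoundaryChart D γ ξ ν κ X Y)
    (hZ : ContDiffAt ℝ 1 Z (q₀, T)) (hV : ContDiffAt ℝ 1 V (q₀, T)) (hτ : ContDiffAt ℝ 1 τ q₀)
    (hτ0 : τ q₀ = T) (hZp : Z (q₀, T) = γ ξ) : ContDiffAt ℝ 1 (sectionMap γ X Z V τ) q₀ := by
  have h1 : ContDiffAt ℝ 1 (fun q => (q, τ q)) q₀ := contDiffAt_id.prodMk hτ
  have h2 : ContDiffAt ℝ 1 (fun q => Z (q, τ q)) q₀ :=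
    ContDiffAt.comp q₀ (by rw [hτ0]; exact hZ) h1
  have h3 : ContDiffAt ℝ 1 (fun q => V (q, τ q)) q₀ :=
    ContDiffAt.comp q₀ (by rw [hτ0]; exact hV) h1
  have h4 : ContDiffAt ℝ 1 (fun q => X (Z (q, τ q))) q₀ :=
    ContDiffAt.comp q₀ (by rw [hτ0, hZp]; exact hc.contDiffAt_X.of_le (by norm_num)) h2
  have h5 : ContDiffAt ℝ 1 (fun q => unitTangent γ (X (Z (q, τ q)))) q₀ :=
    ContDiffAt.comp q₀ hD.contDiff_unitTangent.contDiffAt h4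
  exact h4.prodMk ((h3.inner ℝ h5).div_const _)

theorem sectionMap_base (hc : BoundaryChart D γ ξ ν κ X Y) {c : ℝ} (hτ0 : τ q₀ = T)
    (hZp : Z (q₀, T) = γ ξ) (hVp : V (q₀, T) = c • ν) : sectionMap γ X Z V τ q₀ = (ξ, 0) := by
  rw [sectionMap, hτ0, hZp, hc.X_point, hVp, hc.tangent_eq, real_inner_smul_left,
    real_inner_smul_right, inner_self_I_mul]
  simp

/-- The variation of `τ` contributes multiples of `ν` to both position and velocity, which the
derivative of `X` and the tangential component annihilate; hence `fderiv ℝ τ`, `lz` and `lv` are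
absent from the result. The curvature term is the base velocity `c • ν` paired with the rotation of
the tangent. -/
theorem fderiv_sectionMap (hD : IsRegularDomain D γ) (hc : BoundaryChart D γ ξ ν κ X Y)
    (hZ : ContDiffAt ℝ 1 Z (q₀, T)) (hV : ContDiffAt ℝ 1 V (q₀, T)) (hτ : ContDiffAt ℝ 1 τ q₀)
    (hτ0 : τ q₀ = T) (hZp : Z (q₀, T) = γ ξ) {c : ℝ} (hVp : V (q₀, T) = c • ν)
    {lz lv : ℝ} (hZs : HasDerivAt (fun s => Z (q₀, s)) (lz • ν) T)
    (hVs : HasDerivAt (fun s => V (q₀, s)) (lv • ν) T) {u : ℝ × ℝ} {A B : ℝ}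
    (hZu : HasDerivAt (fun ε : ℝ => Z (q₀ + ε • u, T)) ((κ * A) • (Complex.I * ν)) 0)
    (hVu : HasDerivAt (fun ε : ℝ => V (q₀ + ε • u, T)) ((κ * B) • (Complex.I * ν)) 0) :
    fderiv ℝ (sectionMap γ X Z V τ) q₀ u =
      (A / ‖deriv γ ξ‖, (B - c * curvature D γ ξ * A) / √2) := by
  have hline : HasDerivAt (fun ε : ℝ => q₀ + ε • u) u 0 := by
    have := ((hasDerivAt_id (0 : ℝ)).smul_const u).const_add q₀
    simpa using this
  have total : ∀ {Z : (ℝ × ℝ) × ℝ → ℂ} {zu zs : ℂ}, ContDiffAt ℝ 1 Z (q₀, T) →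
      HasDerivAt (fun s => Z (q₀, s)) zs T → HasDerivAt (fun ε : ℝ => Z (q₀ + ε • u, T)) zu 0 →
      HasDerivAt (fun ε : ℝ => Z (q₀ + ε • u, τ (q₀ + ε • u))) (zu + fderiv ℝ τ q₀ u • zs) 0 := by
    intro Z zu zs hZ hs hu
    have hZd : HasFDerivAt Z (fderiv ℝ Z (q₀, T)) (q₀, T) :=
      (hZ.differentiableAt (by norm_num)).hasFDerivAt
    have h1 : fderiv ℝ Z (q₀, T) (0, 1) = zs := by
      have : HasDerivAt (fun s : ℝ => (q₀, s)) ((0, 1) : (ℝ × ℝ) × ℝ) T :=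
        (hasDerivAt_const T q₀).prodMk (hasDerivAt_id T)
      exact (hZd.comp_hasDerivAt T this).unique hs
    have h2 : fderiv ℝ Z (q₀, T) (u, 0) = zu := by
      have h3 : HasDerivAt (fun ε : ℝ => (q₀ + ε • u, T)) ((u, 0) : (ℝ × ℝ) × ℝ) 0 :=
        hline.prodMk (hasDerivAt_const 0 T)
      have hZd' : HasFDerivAt Z (fderiv ℝ Z (q₀, T)) (q₀ + (0 : ℝ) • u, T) := by simpa using hZd
      exact (hZd'.comp_hasDerivAt (0 : ℝ) h3).unique hu
    have h4 : HasDerivAt (fun ε : ℝ => τ (q₀ + ε • u)) (fderiv ℝ τ q₀ u) 0 := by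
      have : HasFDerivAt τ (fderiv ℝ τ q₀) (q₀ + (0 : ℝ) • u) := by
        simpa using (hτ.differentiableAt (by norm_num)).hasFDerivAt
      exact this.comp_hasDerivAt (0 : ℝ) hline
    have hZd' : HasFDerivAt Z (fderiv ℝ Z (q₀, T)) (q₀ + (0 : ℝ) • u, τ (q₀ + (0 : ℝ) • u)) := by
      simpa [hτ0] using hZd
    refine (hZd'.comp_hasDerivAt (0 : ℝ) (hline.prodMk h4)).congr_deriv ?_
    have : (u, fderiv ℝ τ q₀ u) = ((u, 0) : (ℝ × ℝ) × ℝ) + fderiv ℝ τ q₀ u • ((0, 1) : (ℝ × ℝ) × ℝ) := by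
      ext <;> simp
    rw [this, map_add, map_smul, h1, h2]
  have hz := total hZ hZs hZu
  have hv := total hV hVs hVu
  have hκ := hc.κ_sq
  have hℓ := norm_deriv_pos (ξ := ξ) hD
  have hX : HasDerivAt (fun ε : ℝ => X (Z (q₀ + ε • u, τ (q₀ + ε • u)))) (A / ‖deriv γ ξ‖) 0 := by
    have h1 : HasFDerivAt X (fderiv ℝ X (γ ξ)) (Z (q₀ + (0 : ℝ) • u, τ (q₀ + (0 : ℝ) • u))) := by
      simpa [hτ0, hZp] using hc.differentiableAt_X.hasFDerivAt
    refine (h1.comp_hasDerivAt (0 : ℝ) hz).congr_deriv ?_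
    rw [hc.fderiv_X hD]
    simp only [inner_add_right, real_inner_smul_right, inner_I_mul_self, hc.inner_Iν_Iν]
    linear_combination (A / ‖deriv γ ξ‖) * hκ
  have ht : HasDerivAt (fun ε : ℝ => unitTangent γ (X (Z (q₀ + ε • u, τ (q₀ + ε • u)))))
      ((A / ‖deriv γ ξ‖) • (-(curvature D γ ξ * ‖deriv γ ξ‖) • ν)) 0 := by
    have h1 : HasDerivAt (unitTangent γ) (-(curvature D γ ξ * ‖deriv γ ξ‖) • ν)
        (X (Z (q₀ + (0 : ℝ) • u, τ (q₀ + (0 : ℝ) • u)))) := by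
      simpa [hτ0, hZp, hc.X_point] using hc.hasDerivAt_unitTangent hD
    exact h1.scomp 0 hX
  have hS := hX.prodMk ((hv.inner ℝ ht).div_const √2)
  have hP : HasFDerivAt (sectionMap γ X Z V τ) (fderiv ℝ (sectionMap γ X Z V τ) q₀)
      (q₀ + (0 : ℝ) • u) := by
    simpa using ((hc.contDiffAt_sectionMap hD hZ hV hτ hτ0 hZp).differentiableAt
      (by norm_num)).hasFDerivAt
  rw [(hP.comp_hasDerivAt (0 : ℝ) hline).unique hS]
  congr 2
  simp only [zero_smul, add_zero, hτ0, hZp, hVp, hc.X_point, hc.tangent_eq, inner_add_left,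
    real_inner_smul_left, real_inner_smul_right, hc.inner_Iν_Iν, hc.inner_ν_ν, inner_self_I_mul]
  field_simp
  linear_combination B * hκ

end BoundaryChart

end

/-! ### Velocities of prescribed energy and tangential component -/

section

/-- The velocity of energy level `U` at `γ q.1` whose tangential component is `√2 q.2` and whose
normal component has the sign of `ς`. -/
def launch (U : ℂ → ℝ) (D : Set ℂ) (γ : ℝ → ℂ) (ς : ℝ) (q : ℝ × ℝ) : ℂ :=
  √2 • ((ς * √(U (γ q.1) - q.2 ^ 2)) • outwardNormal D γ q.1 + q.2 • unitTangent γ q.1)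

theorem norm_smul_normal_add_sq {t : ℂ} (ht : ‖t‖ = 1) {κ : ℝ} (hκ : κ ^ 2 = 1) (a b : ℝ) :
    ‖a • (-(κ * Complex.I) * t) + b • t‖ ^ 2 = a ^ 2 + b ^ 2 := by
  have h2 : t.re * t.re + t.im * t.im = 1 := by
    rw [← Complex.normSq_apply, Complex.normSq_eq_norm_sq, ht]; norm_num
  rw [← Complex.normSq_eq_norm_sq, Complex.normSq_apply]
  simp
  linear_combination (a ^ 2 * κ ^ 2 + b ^ 2) * h2 + a ^ 2 * hκ

theorem inner_smul_normal_add {t : ℂ} (ht : ‖t‖ = 1) (κ a b : ℝ) :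
    inner ℝ (a • (-(κ * Complex.I) * t) + b • t) t = b := by
  have h2 : t.re * t.re + t.im * t.im = 1 := by
    rw [← Complex.normSq_apply, Complex.normSq_eq_norm_sq, ht]; norm_num
  simp [Complex.inner]
  linear_combination b * h2

theorem exists_eq_smul_normal_add {t : ℂ} (ht : ‖t‖ = 1) {κ : ℝ} (hκ : κ ^ 2 = 1) (u : ℂ) :
    ∃ a : ℝ, u = a • (-(κ * Complex.I) * t) + (inner ℝ u t : ℝ) • t := by
  have h2 : t.re * t.re + t.im * t.im = 1 := by
    rw [← Complex.normSq_apply, Complex.normSq_eq_norm_sq, ht]; norm_num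
  refine ⟨κ * (u.re * t.im - u.im * t.re), ?_⟩
  apply Complex.ext
  · simp [Complex.inner]
    linear_combination (-u.re) * h2 - (u.re * t.im - u.im * t.re) * t.im * hκ
  · simp [Complex.inner]
    linear_combination (-u.im) * h2 + (u.re * t.im - u.im * t.re) * t.re * hκ

namespace BoundaryChart

variable {D : Set ℂ} {γ : ℝ → ℂ} {ξ : ℝ} {ν : ℂ} {κ : ℝ} {X Y : ℂ → ℝ} {U : ℂ → ℝ}

theorem launch_base (hD : IsRegularDomain D γ) (hc : BoundaryChart D γ ξ ν κ X Y) (ς : ℝ) :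
    launch U D γ ς (ξ, 0) = (√2 * (ς * √(U (γ ξ)))) • ν := by
  simp [launch, hc.normal_point hD]
  ring

theorem contDiffAt_launch (hD : IsRegularDomain D γ) (hc : BoundaryChart D γ ξ ν κ X Y)
    (hU : ContDiffAt ℝ 1 U (γ ξ)) (hpos : 0 < U (γ ξ)) (ς : ℝ) :
    ContDiffAt ℝ 1 (launch U D γ ς) (ξ, 0) := by
  have hγ1 : ContDiffAt ℝ 1 (fun q : ℝ × ℝ => γ q.1) (ξ, 0) :=
    ContDiffAt.comp (ξ, (0 : ℝ)) (hD.contDiff.contDiffAt.of_le (by norm_num)) contDiffAt_fst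
  have ht : ContDiffAt ℝ 1 (fun q : ℝ × ℝ => unitTangent γ q.1) (ξ, 0) :=
    ContDiffAt.comp (ξ, (0 : ℝ)) hD.contDiff_unitTangent.contDiffAt contDiffAt_fst
  have hU1 : ContDiffAt ℝ 1 (fun q : ℝ × ℝ => U (γ q.1)) (ξ, 0) := ContDiffAt.comp (ξ, (0 : ℝ)) hU hγ1
  have h2 : ContDiffAt ℝ 1 (fun q : ℝ × ℝ => √(U (γ q.1) - q.2 ^ 2)) (ξ, 0) :=
    (hU1.sub (contDiffAt_snd.pow 2)).sqrt (by simp [hpos.ne'])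
  have h3 : ContDiffAt ℝ 1 (fun q : ℝ × ℝ => √2 • ((ς * √(U (γ q.1) - q.2 ^ 2)) •
      (-(κ * Complex.I) * unitTangent γ q.1) + q.2 • unitTangent γ q.1)) (ξ, 0) :=
    by fun_prop
  refine h3.congr_of_eventuallyEq ?_
  have hfst : Tendsto (fun q : ℝ × ℝ => q.1) (𝓝 (ξ, 0)) (𝓝 ξ) := continuousAt_fst
  filter_upwards [hfst.eventually (hc.outwardNormal_eventuallyEq hD)] with q hq
  rw [launch, hq]

/-- The normal speed is stationary: `U ∘ γ` is critical at `ξ`, and `σ` enters it quadratically.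
Only the rotation of the normal and the term `σ t` vary to first order, and both are tangential. -/
theorem hasDerivAt_launch (hD : IsRegularDomain D γ) (hc : BoundaryChart D γ ξ ν κ X Y)
    (hU : HasDerivAt (fun x => U (γ x)) 0 ξ) (hpos : 0 < U (γ ξ)) (ς : ℝ) (u : ℝ × ℝ) :
    HasDerivAt (fun ε : ℝ => launch U D γ ς ((ξ, 0) + ε • u))
      ((κ * (√2 * (ς * √(U (γ ξ)) * curvature D γ ξ * (‖deriv γ ξ‖ * u.1) + u.2))) •
        (Complex.I * ν)) 0 := by
  have hx : HasDerivAt (fun ε : ℝ => ξ + ε * u.1) u.1 0 := by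
    simpa using ((hasDerivAt_id (0 : ℝ)).mul_const u.1).const_add ξ
  have hσ : HasDerivAt (fun ε : ℝ => ε * u.2) u.2 0 := by
    simpa using (hasDerivAt_id (0 : ℝ)).mul_const u.2
  have ht : HasDerivAt (fun ε : ℝ => unitTangent γ (ξ + ε * u.1))
      (u.1 • (-(curvature D γ ξ * ‖deriv γ ξ‖) • ν)) 0 := by
    have h1 : HasDerivAt (unitTangent γ) (-(curvature D γ ξ * ‖deriv γ ξ‖) • ν) (ξ + 0 * u.1) := by
      simpa using hc.hasDerivAt_unitTangent hD
    exact h1.scomp 0 hx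
  have hU1 : HasDerivAt (fun ε : ℝ => U (γ (ξ + ε * u.1))) 0 0 := by
    have h1 : HasDerivAt (fun x => U (γ x)) 0 (ξ + 0 * u.1) := by simpa using hU
    have h2 := h1.comp (0 : ℝ) hx
    rw [zero_mul] at h2
    exact h2
  have hs : HasDerivAt (fun ε : ℝ => √(U (γ (ξ + ε * u.1)) - (ε * u.2) ^ 2)) 0 0 := by
    have := (hU1.sub (hσ.pow 2)).sqrt (by simp [hpos.ne'])
    simpa using this
  have h3 := (((hs.const_mul ς).smul (ht.const_mul (-(κ * Complex.I)))).add
    (hσ.smul ht)).const_smul √2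
  have heq : (fun ε : ℝ => launch U D γ ς ((ξ, 0) + ε • u)) =ᶠ[𝓝 0] fun ε : ℝ =>
      √2 • ((ς * √(U (γ (ξ + ε * u.1)) - (ε * u.2) ^ 2)) •
        (-(κ * Complex.I) * unitTangent γ (ξ + ε * u.1)) +
          (ε * u.2) • unitTangent γ (ξ + ε * u.1)) := by
    have hcont : Tendsto (fun ε : ℝ => ξ + ε * u.1) (𝓝 0) (𝓝 ξ) := by
      simpa using hx.continuousAt.tendsto
    filter_upwards [hcont.eventually (hc.outwardNormal_eventuallyEq hD)] with ε hε
    simp [launch, hε]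
  refine (h3.congr_of_eventuallyEq heq).congr_deriv ?_
  have hκ : (κ : ℂ) ^ 2 = 1 := by exact_mod_cast hc.κ_sq
  simp only [zero_mul, add_zero, hc.tangent_eq, Complex.real_smul, mul_zero, ne_eq,
    OfNat.ofNat_ne_zero, not_false_eq_true, zero_pow, sub_zero]
  push_cast
  ring_nf

end BoundaryChart

variable {D : Set ℂ} {γ : ℝ → ℂ} {U : ℂ → ℝ} {κ x : ℝ}

theorem norm_launch_sq (hD : IsRegularDomain D γ) (hκ : κ ^ 2 = 1)
    (hn : outwardNormal D γ x = -(κ * Complex.I) * unitTangent γ x) {ς σ : ℝ} (hς : ς ^ 2 = 1)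
    (hσ : σ ^ 2 ≤ U (γ x)) : ‖launch U D γ ς (x, σ)‖ ^ 2 = 2 * U (γ x) := by
  have h2 : √2 ^ 2 = 2 := Real.sq_sqrt (by norm_num)
  have hs := Real.sq_sqrt (sub_nonneg.2 hσ)
  rw [launch, hn, norm_smul, mul_pow, Real.norm_eq_abs, sq_abs, h2,
    norm_smul_normal_add_sq (hD.norm_unitTangent x) hκ, mul_pow, hς, hs]
  ring

theorem inner_launch (hD : IsRegularDomain D γ)
    (hn : outwardNormal D γ x = -(κ * Complex.I) * unitTangent γ x) (ς σ : ℝ) :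
    inner ℝ (launch U D γ ς (x, σ)) (unitTangent γ x) = √2 * σ := by
  rw [launch, hn, real_inner_smul_left, inner_smul_normal_add (hD.norm_unitTangent x)]

/-- A velocity with given energy and tangential component is one of the two launch velocities. -/
theorem eq_launch_or (hD : IsRegularDomain D γ) (hκ : κ ^ 2 = 1)
    (hn : outwardNormal D γ x = -(κ * Complex.I) * unitTangent γ x) {σ : ℝ} {u : ℂ}
    (hu : ‖u‖ ^ 2 = 2 * U (γ x)) (hut : inner ℝ u (unitTangent γ x) = √2 * σ) :
    u = launch U D γ 1 (x, σ) ∨ u = launch U D γ (-1) (x, σ) := by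
  have h2 : √2 ^ 2 = 2 := Real.sq_sqrt (by norm_num)
  have h20 : √2 ≠ 0 := by positivity
  obtain ⟨a, ha⟩ := exists_eq_smul_normal_add (hD.norm_unitTangent x) hκ u
  rw [hut] at ha
  have h3 : a ^ 2 + (√2 * σ) ^ 2 = 2 * U (γ x) := by
    rw [← hu, ha, norm_smul_normal_add_sq (hD.norm_unitTangent x) hκ]
  have h4 : (a / √2) ^ 2 = U (γ x) - σ ^ 2 := by
    rw [div_pow, h2]; rw [mul_pow, h2] at h3; linarith
  have h5 : √(U (γ x) - σ ^ 2) = |a / √2| := by rw [← h4, Real.sqrt_sq_eq_abs]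
  have h6 : u = √2 • ((a / √2) • (-(κ * Complex.I) * unitTangent γ x) + σ • unitTangent γ x) := by
    rw [ha, smul_add, smul_smul, smul_smul, mul_div_cancel₀ _ h20]
  rcases abs_choice (a / √2) with h | h
  · left
    rw [launch, hn, h5, h, one_mul]; exact h6
  · right
    rw [launch, hn, h5, h, neg_one_mul, neg_neg]; exact h6


/-- This is where orthogonality of `p` to the boundary enters the variational formulas: both
potentials are functions of `|z|`, hence stationary along the curve at `p`. -/
theorem hasDerivAt_norm_of_perp {γ : ℝ → ℂ} {ξ : ℝ} (hd : DifferentiableAt ℝ γ ξ) (h0 : γ ξ ≠ 0)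
    (hperp : inner ℝ (γ ξ) (deriv γ ξ) = 0) : HasDerivAt (fun x => ‖γ x‖) 0 ξ := by
  have h1 : DifferentiableAt ℝ (fun x => ‖γ x‖) ξ := hd.norm ℝ h0
  have h2 := h1.hasDerivAt.pow 2
  have h3 := (hd.hasDerivAt.norm_sq)
  have h4 := h2.unique h3
  rw [hperp] at h4
  have h5 : ‖γ ξ‖ ≠ 0 := norm_ne_zero_iff.2 h0
  have h6 : deriv (fun x => ‖γ x‖) ξ = 0 := by
    simpa [h5] using h4
  rw [← h6]
  exact h1.hasDerivAt

variable {E h μ ω : ℝ}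

theorem contDiffAt_outerPotential (z : ℂ) : ContDiffAt ℝ 1 (outerPotential E ω) z :=
  contDiffAt_const.sub (contDiffAt_const.mul (contDiff_norm_sq ℝ).contDiffAt)

theorem contDiffAt_innerPotential {z : ℂ} (hz : z ≠ 0) : ContDiffAt ℝ 1 (innerPotential E h μ) z :=
  contDiffAt_const.add (contDiffAt_const.div (contDiffAt_norm ℝ hz) (norm_ne_zero_iff.2 hz))

theorem hasDerivAt_outerPotential {γ : ℝ → ℂ} {ξ : ℝ} (H : HasDerivAt (fun x => ‖γ x‖) 0 ξ) :
    HasDerivAt (fun x => outerPotential E ω (γ x)) 0 ξ := by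
  have := ((H.pow 2).const_mul (ω ^ 2 / 2)).const_sub E
  simpa [outerPotential] using this

theorem hasDerivAt_innerPotential {γ : ℝ → ℂ} {ξ : ℝ} (H : HasDerivAt (fun x => ‖γ x‖) 0 ξ)
    (h0 : γ ξ ≠ 0) : HasDerivAt (fun x => innerPotential E h μ (γ x)) 0 ξ := by
  have := ((hasDerivAt_const ξ μ).div H (norm_ne_zero_iff.2 h0)).const_add (E + h)
  simpa [innerPotential] using this

end

/-! ### Flows depending on boundary data, and the outer arc -/

section

/-- Position at time `x.2` of the solution of the linear equation with fundamental system `C, S`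
whose initial position and velocity depend on the parameter `x.1`. -/
def flowPos (C S : ℝ → ℝ) (z₀ v₀ : ℝ × ℝ → ℂ) (x : (ℝ × ℝ) × ℝ) : ℂ :=
  C x.2 • z₀ x.1 + S x.2 • v₀ x.1

/-- Velocity of the solution described by `flowPos`. -/
def flowVel (c : ℝ) (C S : ℝ → ℝ) (z₀ v₀ : ℝ × ℝ → ℂ) (x : (ℝ × ℝ) × ℝ) : ℂ :=
  (c * S x.2) • z₀ x.1 + C x.2 • v₀ x.1

namespace IsFundamentalSystem

variable {c : ℝ} {C S : ℝ → ℝ} {z₀ v₀ : ℝ × ℝ → ℂ} {q₀ : ℝ × ℝ}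

theorem contDiffAt_flowPos (H : IsFundamentalSystem c C S) (hz : ContDiffAt ℝ 1 z₀ q₀)
    (hv : ContDiffAt ℝ 1 v₀ q₀) (s : ℝ) : ContDiffAt ℝ 1 (flowPos C S z₀ v₀) (q₀, s) := by
  have h1 : ContDiffAt ℝ 1 (fun x : (ℝ × ℝ) × ℝ => z₀ x.1) (q₀, s) :=
    ContDiffAt.comp (q₀, s) hz contDiffAt_fst
  have h2 : ContDiffAt ℝ 1 (fun x : (ℝ × ℝ) × ℝ => v₀ x.1) (q₀, s) :=
    ContDiffAt.comp (q₀, s) hv contDiffAt_fst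
  have hC := H.contDiff_C
  have hS := H.contDiff_S
  unfold flowPos
  fun_prop

theorem contDiffAt_flowVel (H : IsFundamentalSystem c C S) (hz : ContDiffAt ℝ 1 z₀ q₀)
    (hv : ContDiffAt ℝ 1 v₀ q₀) (s : ℝ) : ContDiffAt ℝ 1 (flowVel c C S z₀ v₀) (q₀, s) := by
  have h1 : ContDiffAt ℝ 1 (fun x : (ℝ × ℝ) × ℝ => z₀ x.1) (q₀, s) :=
    ContDiffAt.comp (q₀, s) hz contDiffAt_fst
  have h2 : ContDiffAt ℝ 1 (fun x : (ℝ × ℝ) × ℝ => v₀ x.1) (q₀, s) :=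
    ContDiffAt.comp (q₀, s) hv contDiffAt_fst
  have hC := H.contDiff_C
  have hS := H.contDiff_S
  unfold flowVel
  fun_prop

theorem hasDerivAt_flowPos (H : IsFundamentalSystem c C S) (q : ℝ × ℝ) (s : ℝ) :
    HasDerivAt (fun s => flowPos C S z₀ v₀ (q, s)) (flowVel c C S z₀ v₀ (q, s)) s :=
  H.hasDerivAt_position (z₀ q) (v₀ q) s

theorem hasDerivAt_flowVel (H : IsFundamentalSystem c C S) (q : ℝ × ℝ) (s : ℝ) :
    HasDerivAt (fun s => flowVel c C S z₀ v₀ (q, s)) (c • flowPos C S z₀ v₀ (q, s)) s :=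
  H.hasDerivAt_velocity (z₀ q) (v₀ q) s

theorem flowPos_zero (H : IsFundamentalSystem c C S) (q : ℝ × ℝ) :
    flowPos C S z₀ v₀ (q, 0) = z₀ q := by
  simp [flowPos, H.C_zero, H.S_zero]

theorem flowVel_zero (H : IsFundamentalSystem c C S) (q : ℝ × ℝ) :
    flowVel c C S z₀ v₀ (q, 0) = v₀ q := by
  simp [flowVel, H.C_zero, H.S_zero]

theorem norm_flowVel_sq (H : IsFundamentalSystem c C S) (q : ℝ × ℝ) (s : ℝ) :
    ‖flowVel c C S z₀ v₀ (q, s)‖ ^ 2 - c * ‖flowPos C S z₀ v₀ (q, s)‖ ^ 2 =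
      ‖v₀ q‖ ^ 2 - c * ‖z₀ q‖ ^ 2 :=
  H.norm_velocity_sq (z₀ q) (v₀ q) s

end IsFundamentalSystem

theorem fderiv_apply_zero_one {Z : (ℝ × ℝ) × ℝ → ℂ} {q₀ : ℝ × ℝ} {s : ℝ} {zs : ℂ}
    (hZ : ContDiffAt ℝ 1 Z (q₀, s)) (hs : HasDerivAt (fun s => Z (q₀, s)) zs s) :
    fderiv ℝ Z (q₀, s) (0, 1) = zs := by
  have h1 : HasDerivAt (fun s : ℝ => (q₀, s)) ((0, 1) : (ℝ × ℝ) × ℝ) s :=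
    (hasDerivAt_const s q₀).prodMk (hasDerivAt_id s)
  exact ((hZ.differentiableAt (by norm_num)).hasFDerivAt.comp_hasDerivAt s h1).unique hs

/-- Return time of the radial outer motion. -/
theorem exists_outer_time {E ω r b : ℝ} (hω : 0 < ω) (hr : 0 < r) (hb : 0 < b)
    (hE : 2 * E = 2 * b ^ 2 + ω ^ 2 * r ^ 2) :
    ∃ T > 0, Real.cos (ω * T) = 1 - 2 * b ^ 2 / E ∧ Real.sin (ω * T) / ω = √2 * b * r / E ∧
      ∀ s ∈ Ioo 0 T, r < Real.cos (ω * s) * r + Real.sin (ω * s) / ω * (√2 * b) := by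
  have h2 : √2 ^ 2 = 2 := Real.sq_sqrt (by norm_num)
  have h20 : 0 < √2 := by positivity
  have hE0 : 0 < E := by nlinarith [mul_pos (pow_pos hω 2) (pow_pos hr 2), pow_pos hb 2]
  -- The radial coordinate is `r (cos ωs + g sin ωs)`, a multiple of `cos (ωs - φ)` with `tan φ =
  -- g`; it takes the value `r` again at `ωs = 2φ`.
  set g := √2 * b / (ω * r) with hg
  have hg0 : 0 < g := by positivity
  set φ := Real.arctan g with hφ
  have hφ0 : 0 < φ := Real.arctan_pos.2 hg0
  have hφ1 : φ < π / 2 := Real.arctan_lt_pi_div_two g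
  have hcos : 0 < Real.cos φ := Real.cos_pos_of_mem_Ioo ⟨by linarith, hφ1⟩
  have hsin : Real.sin φ = g * Real.cos φ := by
    rw [← Real.tan_arctan g, ← hφ, Real.tan_mul_cos hcos.ne']
  have hcs : Real.cos φ ^ 2 = ω ^ 2 * r ^ 2 / (2 * E) := by
    rw [hφ, Real.cos_sq_arctan, hE, hg, div_pow, mul_pow, h2, mul_pow]
    field_simp
    ring
  have hT : ω * (2 * φ / ω) = 2 * φ := by field_simp
  refine ⟨2 * φ / ω, by positivity, ?_, ?_, ?_⟩
  · rw [hT, Real.cos_two_mul, hcs]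
    field_simp
    linarith
  · rw [hT, Real.sin_two_mul, hsin]
    have : 2 * (g * Real.cos φ) * Real.cos φ = 2 * g * Real.cos φ ^ 2 := by ring
    rw [this, hcs, hg]
    field_simp
  · rintro s ⟨hs0, hs1⟩
    set x := ω * s / 2 with hx
    have hx0 : 0 < x := by positivity
    have hx1 : x < φ := by
      rw [lt_div_iff₀ hω] at hs1
      rw [hx]; linarith
    have h3 : 0 < Real.sin (φ - x) := Real.sin_pos_of_pos_of_lt_pi (by linarith) (by linarith)
    rw [Real.sin_sub, hsin] at h3
    have h4 : 0 < Real.cos φ * (g * Real.cos x - Real.sin x) := by linarith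
    have h5 := (mul_pos_iff_of_pos_left hcos).1 h4
    have h6 : 0 < Real.sin x := Real.sin_pos_of_pos_of_lt_pi hx0 (by linarith)
    have h7 : ω * s = 2 * x := by rw [hx]; ring
    have h8 : √2 * b / ω = g * r := by rw [hg]; field_simp
    have h9 : Real.sin (2 * x) / ω * (√2 * b) = Real.sin (2 * x) * (g * r) := by rw [← h8]; ring
    rw [h7, h9, Real.cos_two_mul, Real.sin_two_mul]
    have h10 := Real.sin_sq_add_cos_sq x
    nlinarith [mul_pos (mul_pos hr h6) h5]

/-- Position on the outer arc that is launched from the boundary with data `x.1`. -/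
def outerPos (E ω : ℝ) (D : Set ℂ) (γ : ℝ → ℂ) : (ℝ × ℝ) × ℝ → ℂ :=
  flowPos (fun s => Real.cos (ω * s)) (fun s => Real.sin (ω * s) / ω) (fun q => γ q.1)
    (launch (outerPotential E ω) D γ 1)

/-- Velocity on the outer arc that is launched from the boundary with data `x.1`. -/
def outerVel (E ω : ℝ) (D : Set ℂ) (γ : ℝ → ℂ) : (ℝ × ℝ) × ℝ → ℂ :=
  flowVel (-ω ^ 2) (fun s => Real.cos (ω * s)) (fun s => Real.sin (ω * s) / ω) (fun q => γ q.1)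
    (launch (outerPotential E ω) D γ 1)

/-- At the fixed time `T` the flow combines initial position and velocity with constant
coefficients, so it acts in the same way on their tangential variations `ℓ u.1` and `b k ℓ u.1 +
u.2` (the latter up to `√2`). `A` is the resulting displacement in arc length; the final `b k A`
comes from the tangent at the end point, where the velocity is `-√2 b ν`. -/
theorem exists_outerSection {E ω : ℝ} {D : Set ℂ} {γ : ℝ → ℂ} {ξ : ℝ} {ν : ℂ} {κ : ℝ} {X Y : ℂ → ℝ}
    (hω : 0 < ω) (hD : IsRegularDomain D γ) (hc : BoundaryChart D γ ξ ν κ X Y)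
    (hHill : 0 < outerPotential E ω (γ ξ)) (hperp : inner ℝ (γ ξ) (deriv γ ξ) = 0)
    (hout : ∀ t : ℝ, 1 < t → t • γ ξ ∉ closure D) {r b k ℓ : ℝ} (hr : r = ‖γ ξ‖)
    (hb : b = √(outerPotential E ω (γ ξ))) (hk : k = curvature D γ ξ) (hℓ : ℓ = ‖deriv γ ξ‖) :
    ∃ (τ : ℝ × ℝ → ℝ) (P : ℝ × ℝ → ℝ × ℝ), ContDiffAt ℝ 1 P (ξ, 0) ∧ P (ξ, 0) = (ξ, 0) ∧
      (∀ u : ℝ × ℝ, ∃ A : ℝ,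
        A = (1 - 2 * b ^ 2 / E) * (ℓ * u.1) + 2 * b * r / E * (b * k * (ℓ * u.1) + u.2) ∧
        fderiv ℝ P (ξ, 0) u = (A / ℓ, -(ω ^ 2 * b * r / E) * (ℓ * u.1) +
          (1 - 2 * b ^ 2 / E) * (b * k * (ℓ * u.1) + u.2) + b * k * A)) ∧
      (∀ s ∈ Icc 0 (τ (ξ, 0)), ∃ t : ℝ, 0 ≤ t ∧ outerPos E ω D γ ((ξ, 0), s) = t • γ ξ) ∧
      ∀ᶠ q in 𝓝 ((ξ, 0) : ℝ × ℝ), 0 < τ q ∧ outerPos E ω D γ (q, τ q) = γ (P q).1 ∧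
        inner ℝ (outerVel E ω D γ (q, τ q)) (unitTangent γ (P q).1) = √2 * (P q).2 ∧
        ∀ s ∈ Ioo 0 (τ q), outerPos E ω D γ (q, s) ∉ closure D := by
  have h2 : √2 ^ 2 = 2 := Real.sq_sqrt (by norm_num)
  have h20 : 0 < √2 := by positivity
  have hp : γ ξ ≠ 0 := hD.point_ne_zero ξ
  have hr0 : 0 < r := hr ▸ norm_pos_iff.2 hp
  have hb0 : 0 < b := hb ▸ Real.sqrt_pos.2 hHill
  have hbsq : b ^ 2 = E - ω ^ 2 / 2 * r ^ 2 := by rw [hb, Real.sq_sqrt hHill.le, hr]; rfl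
  have hE0 : 0 < E := by nlinarith [mul_pos (pow_pos hω 2) (pow_pos hr0 2), pow_pos hb0 2]
  have hpν : γ ξ = r • ν := hr ▸ hc.point_eq
  have H := isFundamentalSystem_cos hω.ne'
  have hUd : HasDerivAt (fun x => outerPotential E ω (γ x)) 0 ξ :=
    hasDerivAt_outerPotential (hasDerivAt_norm_of_perp (BoundaryChart.hasDerivAt_γ hD ξ).differentiableAt
      hp hperp)
  have hγc : ContDiffAt ℝ 1 (fun q : ℝ × ℝ => γ q.1) (ξ, 0) :=
    ContDiffAt.comp (ξ, (0 : ℝ)) (hD.contDiff.contDiffAt.of_le (by norm_num)) contDiffAt_fst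
  have hlc := hc.contDiffAt_launch hD (contDiffAt_outerPotential (γ ξ)) hHill 1
  have hZ : ∀ s, ContDiffAt ℝ 1 (outerPos E ω D γ) ((ξ, 0), s) := H.contDiffAt_flowPos hγc hlc
  have hV : ∀ s, ContDiffAt ℝ 1 (outerVel E ω D γ) ((ξ, 0), s) := H.contDiffAt_flowVel hγc hlc
  obtain ⟨T, hT, hC, hS, hmid⟩ := exists_outer_time hω hr0 hb0 (E := E) (by linarith)
  have hZb : ∀ s, outerPos E ω D γ ((ξ, 0), s) =
      (Real.cos (ω * s) * r + Real.sin (ω * s) / ω * (√2 * b)) • ν := by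
    intro s
    simp only [outerPos, flowPos, hc.launch_base hD]
    rw [← hb, hpν]
    module
  have hVb : ∀ s, outerVel E ω D γ ((ξ, 0), s) =
      (-ω ^ 2 * (Real.sin (ω * s) / ω) * r + Real.cos (ω * s) * (√2 * b)) • ν := by
    intro s
    simp only [outerVel, flowVel, hc.launch_base hD]
    rw [← hb, hpν]
    module
  have hZ0 : outerPos E ω D γ ((ξ, 0), 0) = γ ξ := H.flowPos_zero _
  have hV0 : outerVel E ω D γ ((ξ, 0), 0) = (√2 * b) • ν := by
    rw [hVb]; simp
  have hZT : outerPos E ω D γ ((ξ, 0), T) = γ ξ := by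
    rw [hZb, hC, hS, hpν]
    congr 1
    field_simp
    linear_combination b ^ 2 * h2
  have hVT : outerVel E ω D γ ((ξ, 0), T) = (-(√2 * b)) • ν := by
    rw [hVb, hC, hS]
    congr 1
    field_simp
    linear_combination (-2) * hbsq
  have hZs : ∀ s, HasDerivAt (fun s => outerPos E ω D γ ((ξ, 0), s)) (outerVel E ω D γ ((ξ, 0), s)) s :=
    fun s => H.hasDerivAt_flowPos _ s
  have hray : ∀ s, outerPos E ω D γ ((ξ, 0), s) =
      ((Real.cos (ω * s) * r + Real.sin (ω * s) / ω * (√2 * b)) / r) • γ ξ := by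
    intro s
    rw [hZb, hpν, smul_smul, div_mul_cancel₀ _ hr0.ne']
  obtain ⟨τ, hτc, hτ0, hτ⟩ := exists_firstHit (W := (closure D)ᶜ) isClosed_closure.isOpen_compl
    (hc.contDiffAt_Y.of_le (by norm_num)) hc.Y_point hc.outside hT hZ hZ0 hZT
    (by
      intro s hs
      rw [hray]
      refine hout _ ?_
      rw [lt_div_iff₀ hr0, one_mul]
      exact hmid s hs)
    (by
      have hfst : Tendsto (fun q : ℝ × ℝ => q.1) (𝓝 (ξ, 0)) (𝓝 ξ) := continuousAt_fst
      filter_upwards [hfst.eventually hc.coord_boundary] with q hq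
      rw [show outerPos E ω D γ (q, 0) = γ q.1 from H.flowPos_zero _]
      exact hq.2)
    (by
      rw [fderiv_apply_zero_one (hZ 0) (hZs 0), hc.fderiv_Y hD, hV0, real_inner_smul_right,
        hc.inner_ν_ν, mul_one]
      positivity)
    (by
      rw [fderiv_apply_zero_one (hZ T) (hZs T), hc.fderiv_Y hD, hVT, real_inner_smul_right,
        hc.inner_ν_ν, mul_one]
      linarith [mul_pos h20 hb0])
  refine ⟨τ, sectionMap γ X (outerPos E ω D γ) (outerVel E ω D γ) τ,
    hc.contDiffAt_sectionMap hD (hZ T) (hV T) hτc hτ0 hZT, hc.sectionMap_base hτ0 hZT hVT, ?_, ?_, ?_⟩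
  · intro u
    refine ⟨_, rfl, ?_⟩
    have hγu : HasDerivAt (fun ε : ℝ => γ (ξ + ε * u.1)) ((κ * (ℓ * u.1)) • (Complex.I * ν)) 0 := by
      have h3 : HasDerivAt (fun ε : ℝ => ξ + ε * u.1) u.1 0 := by
        simpa using ((hasDerivAt_id (0 : ℝ)).mul_const u.1).const_add ξ
      have h4 : HasDerivAt γ (deriv γ ξ) (ξ + 0 * u.1) := by
        simpa using BoundaryChart.hasDerivAt_γ hD ξ
      refine (h4.scomp (0 : ℝ) h3).congr_deriv ?_
      rw [hc.deriv_eq hD, ← hℓ]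
      module
    have hl := hc.hasDerivAt_launch hD hUd hHill 1 u
    rw [← hb, ← hk, ← hℓ] at hl
    have hZu : HasDerivAt (fun ε : ℝ => outerPos E ω D γ ((ξ, 0) + ε • u, T))
        ((κ * ((1 - 2 * b ^ 2 / E) * (ℓ * u.1) + 2 * b * r / E * (b * k * (ℓ * u.1) + u.2))) •
          (Complex.I * ν)) 0 := by
      have h3 := (hγu.const_smul (1 - 2 * b ^ 2 / E)).add (hl.const_smul (√2 * b * r / E))
      refine (h3.congr_deriv ?_).congr_of_eventuallyEq (Eventually.of_forall fun ε => ?_)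
      · rw [smul_smul, smul_smul, ← add_smul]
        congr 1
        linear_combination (b * r / E * κ * (b * k * (ℓ * u.1) + u.2)) * h2
      · simp [outerPos, flowPos, ← hC, ← hS]
    have hVu : HasDerivAt (fun ε : ℝ => outerVel E ω D γ ((ξ, 0) + ε • u, T))
        ((κ * (√2 * (-(ω ^ 2 * b * r / E) * (ℓ * u.1) +
          (1 - 2 * b ^ 2 / E) * (b * k * (ℓ * u.1) + u.2)))) • (Complex.I * ν)) 0 := by
      have h3 := (hγu.const_smul (-ω ^ 2 * (√2 * b * r / E))).add (hl.const_smul (1 - 2 * b ^ 2 / E))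
      refine (h3.congr_deriv ?_).congr_of_eventuallyEq (Eventually.of_forall fun ε => ?_)
      · rw [smul_smul, smul_smul, ← add_smul]
        congr 1
        ring
      · simp [outerVel, flowVel, ← hC, ← hS]
    have hVs : HasDerivAt (fun s => outerVel E ω D γ ((ξ, 0), s)) ((-ω ^ 2 * r) • ν) T := by
      refine (H.hasDerivAt_flowVel ((ξ, 0) : ℝ × ℝ) T).congr_deriv ?_
      rw [show flowPos _ _ _ _ ((ξ, 0), T) = γ ξ from hZT, hpν, smul_smul]
    rw [hc.fderiv_sectionMap hD (hZ T) (hV T) hτc hτ0 hZT hVT (hVT ▸ hZs T) hVs hZu hVu, ← hℓ, ← hk]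
    congr 1
    field_simp
    ring
  · intro s hs
    rw [hτ0] at hs
    refine ⟨_, ?_, hray s⟩
    refine div_nonneg ?_ hr0.le
    rcases hs.1.eq_or_lt with h | h
    · rw [← h]; simp [hr0.le]
    rcases hs.2.eq_or_lt with h' | h'
    · rw [h', hC, hS]
      have : (1 - 2 * b ^ 2 / E) * r + √2 * b * r / E * (√2 * b) = r := by
        field_simp
        linear_combination b ^ 2 * h2
      rw [this]; exact hr0.le
    · exact (hr0.trans (hmid s ⟨h, h'⟩)).le
  · have hZt : Tendsto (fun q => outerPos E ω D γ (q, τ q)) (𝓝 (ξ, 0)) (𝓝 (γ ξ)) := by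
      have h1 : ContinuousAt (fun q => (q, τ q)) ((ξ, 0) : ℝ × ℝ) :=
        continuousAt_id.prodMk hτc.continuousAt
      have h3 : ContinuousAt (outerPos E ω D γ) ((ξ, 0), τ (ξ, 0)) := by
        rw [hτ0]; exact (hZ T).continuousAt
      have := ContinuousAt.comp (f := fun q => (q, τ q)) h3 h1
      rw [ContinuousAt, Function.comp_apply, hτ0, hZT] at this
      exact this
    filter_upwards [hτ, hZt.eventually hc.coord_eq] with q hq hq2
    refine ⟨hq.1, ?_, ?_, hq.2.2⟩
    · rw [hq.2.1, zero_smul, add_zero] at hq2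
      exact hq2.symm
    · simp only [sectionMap]
      field_simp

end

/-! ### The inner arc in Levi-Civita coordinates -/

/-- Return time of the radial inner motion. -/
theorem exists_inner_time {Ω r a μ : ℝ} (hΩ : 0 < Ω) (hr : 0 < r) (ha : 0 < a) (hμ : 0 < μ)
    (hE : 2 * a ^ 2 * r = Ω ^ 2 * r + 2 * μ) :
    ∃ T > 0, Real.cosh (Ω * T) = 2 * a ^ 2 * r / μ - 1 ∧ Real.sinh (Ω * T) / Ω = √2 * a * r / μ ∧
      ∀ s ∈ Ioo 0 T, |Real.cosh (Ω * s) - Real.sinh (Ω * s) / Ω * (√2 * a)| < 1 := by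
  have h2 : √2 ^ 2 = 2 := Real.sq_sqrt (by norm_num)
  have h20 : 0 < √2 := by positivity
  -- The Levi-Civita position is `w` times `cosh Ωs - g sinh Ωs = sinh (φ - Ωs) / sinh φ`, where
  -- `tanh φ = 1 / g`; here `g > 1` because `μ > 0`. The factor vanishes at `Ωs = φ`, the collision,
  -- and equals `-1` at `2φ`, the return.
  set g := √2 * a / Ω with hg
  have hg0 : 0 < g := by positivity
  have hgsq : g ^ 2 = 2 * a ^ 2 / Ω ^ 2 := by rw [hg, div_pow, mul_pow, h2]
  have hg1' : g ^ 2 - 1 = 2 * μ / (Ω ^ 2 * r) := by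
    rw [hgsq]
    field_simp
    linarith
  have hg2 : 0 < g ^ 2 - 1 := by rw [hg1']; positivity
  have hg1 : 1 < g := by nlinarith
  set σ := √(g ^ 2 - 1) with hσ
  have hσ0 : 0 < σ := Real.sqrt_pos.2 hg2
  have hσsq : σ ^ 2 = g ^ 2 - 1 := Real.sq_sqrt hg2.le
  set φ := Real.arsinh (1 / σ) with hφ
  have hφ0 : 0 < φ := Real.arsinh_pos_iff.2 (by positivity)
  have hsinh : Real.sinh φ = 1 / σ := Real.sinh_arsinh _
  have hcosh : Real.cosh φ = g / σ := by
    rw [← sq_eq_sq₀ (Real.cosh_pos _).le (by positivity), Real.cosh_sq, hsinh]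
    field_simp
    linarith
  have hT : Ω * (2 * φ / Ω) = 2 * φ := by field_simp
  refine ⟨2 * φ / Ω, by positivity, ?_, ?_, ?_⟩
  · have : (g / σ) ^ 2 + (1 / σ) ^ 2 = (g ^ 2 + 1) / σ ^ 2 := by ring
    rw [hT, Real.cosh_two_mul, hcosh, hsinh, this, hσsq, hg1', hgsq]
    field_simp
    linear_combination (-1) * hE
  · rw [hT, Real.sinh_two_mul, hcosh, hsinh]
    have : 2 * (1 / σ) * (g / σ) = 2 * g / σ ^ 2 := by field_simp
    rw [this, hσsq, hg1', hg]
    field_simp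
  · rintro s ⟨hs0, hs1⟩
    set x := Ω * s / 2 with hx
    have hx0 : 0 < x := by positivity
    have hx1 : x < φ := by
      rw [lt_div_iff₀ hΩ] at hs1
      rw [hx]; linarith
    have h3 : 0 < Real.sinh (φ - x) := Real.sinh_pos_iff.2 (by linarith)
    rw [Real.sinh_sub, hcosh, hsinh] at h3
    have h4 : 0 < (1 / σ) * (Real.cosh x - g * Real.sinh x) := by
      have : (1 / σ) * (Real.cosh x - g * Real.sinh x) =
        1 / σ * Real.cosh x - g / σ * Real.sinh x := by ring
      rw [this]; exact h3
    have h5 := (mul_pos_iff_of_pos_left (show 0 < 1 / σ by positivity)).1 h4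
    have h6 : 0 < Real.sinh x := Real.sinh_pos_iff.2 hx0
    have h7 : Ω * s = 2 * x := by rw [hx]; ring
    have h9 : Real.sinh (2 * x) / Ω * (√2 * a) = Real.sinh (2 * x) * g := by rw [hg]; ring
    have h10 := Real.cosh_sq x
    have h11 := Real.sinh_lt_cosh x
    have h12 := Real.cosh_pos x
    -- With `x = Ωs / 2`, the distances of the factor from `-1` and `1` are `2 cosh x (cosh x - g
    -- sinh x)` and `2 sinh x (g cosh x - sinh x)`.
    rw [h7, h9, Real.cosh_two_mul, Real.sinh_two_mul, abs_lt]
    constructor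
    · nlinarith [mul_pos h12 h5]
    · nlinarith [mul_pos h6 (sub_pos.2 h11), mul_pos (mul_pos h6 h12) (sub_pos.2 hg1)]

/-- The branch near `p` of the square root that takes the value `w` at `p = w ^ 2`. -/
def rootNear (w z : ℂ) : ℂ := w * Complex.exp (Complex.log (z / w ^ 2) / 2)

/-- The identity `exp ∘ log = id` ignores the branch cut, so no closeness of `z` to `w ^ 2` is
required; only differentiability is local. -/
theorem rootNear_sq {w z : ℂ} (hw : w ≠ 0) (hz : z ≠ 0) : rootNear w z ^ 2 = z := by
  rw [rootNear, mul_pow, ← Complex.exp_nat_mul]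
  have : ((2 : ℕ) : ℂ) * (Complex.log (z / w ^ 2) / 2) = Complex.log (z / w ^ 2) := by
    push_cast; ring
  rw [this, Complex.exp_log (div_ne_zero hz (pow_ne_zero 2 hw)), mul_div_cancel₀ _ (pow_ne_zero 2 hw)]

theorem rootNear_self {w : ℂ} (hw : w ≠ 0) : rootNear w (w ^ 2) = w := by
  rw [rootNear, div_self (pow_ne_zero 2 hw)]; simp

theorem hasDerivAt_rootNear {w : ℂ} (hw : w ≠ 0) : HasDerivAt (rootNear w) (1 / (2 * w)) (w ^ 2) := by
  have h0 : w ^ 2 / w ^ 2 = 1 := div_self (pow_ne_zero 2 hw)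
  have h1 := ((hasDerivAt_id (w ^ 2)).div_const (w ^ 2)).clog (by simp [h0])
  refine (((h1.div_const 2).cexp).const_mul w).congr_deriv ?_
  simp [h0]
  field_simp

theorem contDiffAt_rootNear {w : ℂ} (hw : w ≠ 0) : ContDiffAt ℝ 1 (rootNear w) (w ^ 2) := by
  have h0 : w ^ 2 / w ^ 2 = 1 := div_self (pow_ne_zero 2 hw)
  have h3 : ContDiffAt ℂ 1 (fun z : ℂ => z / w ^ 2) (w ^ 2) := contDiffAt_id.div_const _
  have h1 : ContDiffAt ℂ 1 (fun z : ℂ => Complex.log (z / w ^ 2)) (w ^ 2) :=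
    ContDiffAt.comp (w ^ 2) (Complex.contDiffAt_log (by simp [h0])) h3
  have h2 : ContDiffAt ℂ 1 (rootNear w) (w ^ 2) :=
    contDiffAt_const.mul ((h1.div_const 2).cexp)
  exact h2.restrict_scalars ℝ

/-- Levi-Civita initial position of the inner arc entering at `γ q.1`. -/
def leviStart (γ : ℝ → ℂ) (w : ℂ) (q : ℝ × ℝ) : ℂ := rootNear w (γ q.1)

/-- Levi-Civita initial velocity of the inner arc entering at `γ q.1`. -/
def leviStartVel (E h μ : ℝ) (D : Set ℂ) (γ : ℝ → ℂ) (w : ℂ) (q : ℝ × ℝ) : ℂ :=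
  (starRingEnd ℂ) (leviStart γ w q) * launch (innerPotential E h μ) D γ (-1) q

/-- Levi-Civita position on the inner arc entering with data `x.1`. -/
def leviPos (E h μ : ℝ) (D : Set ℂ) (γ : ℝ → ℂ) (w : ℂ) : (ℝ × ℝ) × ℝ → ℂ :=
  flowPos (fun s => Real.cosh (√(2 * (E + h)) * s))
    (fun s => Real.sinh (√(2 * (E + h)) * s) / √(2 * (E + h)))
    (leviStart γ w) (leviStartVel E h μ D γ w)

/-- Levi-Civita velocity on the inner arc entering with data `x.1`. -/
def leviVel (E h μ : ℝ) (D : Set ℂ) (γ : ℝ → ℂ) (w : ℂ) : (ℝ × ℝ) × ℝ → ℂ :=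
  flowVel (√(2 * (E + h)) ^ 2) (fun s => Real.cosh (√(2 * (E + h)) * s))
    (fun s => Real.sinh (√(2 * (E + h)) * s) / √(2 * (E + h)))
    (leviStart γ w) (leviStartVel E h μ D γ w)

/-- Physical position on the inner arc entering with data `x.1`. -/
def innerPos (E h μ : ℝ) (D : Set ℂ) (γ : ℝ → ℂ) (w : ℂ) (x : (ℝ × ℝ) × ℝ) : ℂ :=
  physicalPosition (leviPos E h μ D γ w x)

/-- Physical velocity on the inner arc entering with data `x.1`. -/
def innerVel (E h μ : ℝ) (D : Set ℂ) (γ : ℝ → ℂ) (w : ℂ) (x : (ℝ × ℝ) × ℝ) : ℂ :=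
  physicalVelocity (leviPos E h μ D γ w x) (leviVel E h μ D γ w x)

/-- In Levi-Civita coordinates the variations are multiples of `iw`: initially `ℓ u.1 / (2r)` for
the position and `√2 N` for the velocity, and `η` for the position at time `T` (all up to `κ`). The
base orbit ends at `-w`, so squaring gives the displacement `-2rη` in physical space; the velocity
is varied as a quotient. -/
theorem exists_innerSection {E h μ : ℝ} {D : Set ℂ} {γ : ℝ → ℂ} {ξ : ℝ} {ν : ℂ} {κ : ℝ} {X Y : ℂ → ℝ}
    (hEh : 0 < E + h) (hμ : 0 < μ) (hD : IsRegularDomain D γ) (hc : BoundaryChart D γ ξ ν κ X Y)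
    (hperp : inner ℝ (γ ξ) (deriv γ ξ) = 0)
    (hin : ∀ t : ℝ, 0 ≤ t → t < 1 → t • γ ξ ∈ D) {w : ℂ} (hw : w ^ 2 = γ ξ) {r a k ℓ : ℝ}
    (hr : r = ‖γ ξ‖) (ha : a = √(innerPotential E h μ (γ ξ))) (hk : k = curvature D γ ξ)
    (hℓ : ℓ = ‖deriv γ ξ‖) :
    ∃ (τ : ℝ × ℝ → ℝ) (P : ℝ × ℝ → ℝ × ℝ), ContDiffAt ℝ 1 P (ξ, 0) ∧ P (ξ, 0) = (ξ, 0) ∧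
      (∀ u : ℝ × ℝ, ∃ N η : ℝ, N = a * (ℓ * u.1) / (2 * r) - a * k * (ℓ * u.1) + u.2 ∧
        η = (2 * a ^ 2 * r / μ - 1) * (ℓ * u.1 / (2 * r)) + 2 * a * r / μ * N ∧
        fderiv ℝ P (ξ, 0) u = (-(2 * r * η) / ℓ,
          -(a * (2 * a ^ 2 * r / μ - 2) * (ℓ * u.1 / (2 * r)) + (2 * a ^ 2 * r / μ - 1) * N + a * η)
            + 2 * r * a * k * η)) ∧
      (∀ s, ∃ t : ℝ, 0 ≤ t ∧ innerPos E h μ D γ w ((ξ, 0), s) = t • γ ξ) ∧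
      (∃ s ∈ Ioo 0 (τ (ξ, 0)), leviPos E h μ D γ w ((ξ, 0), s) = 0) ∧
      ∀ᶠ q in 𝓝 ((ξ, 0) : ℝ × ℝ), 0 < τ q ∧ innerPos E h μ D γ w (q, τ q) = γ (P q).1 ∧
        inner ℝ (innerVel E h μ D γ w (q, τ q)) (unitTangent γ (P q).1) = √2 * (P q).2 ∧
        ∀ s ∈ Ioo 0 (τ q), innerPos E h μ D γ w (q, s) ∈ D := by
  have h2 : √2 ^ 2 = 2 := Real.sq_sqrt (by norm_num)
  have h20 : 0 < √2 := by positivity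
  have hp : γ ξ ≠ 0 := hD.point_ne_zero ξ
  have hr0 : 0 < r := hr ▸ norm_pos_iff.2 hp
  have hVpos : 0 < innerPotential E h μ (γ ξ) := by
    rw [innerPotential, ← hr]; positivity
  have ha0 : 0 < a := ha ▸ Real.sqrt_pos.2 hVpos
  have hasq : a ^ 2 = E + h + μ / r := by rw [ha, Real.sq_sqrt hVpos.le, hr]; rfl
  have hw0 : w ≠ 0 := by rintro rfl; simp at hw; exact hp hw.symm
  have hpν : γ ξ = r • ν := hr ▸ hc.point_eq
  have hwν : w ^ 2 = r * ν := by rw [hw, hpν, Complex.real_smul]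
  have hrC : (r : ℂ) ≠ 0 := by exact_mod_cast hr0.ne'
  have hww : (starRingEnd ℂ) w * w = r := by
    rw [mul_comm, Complex.mul_conj, Complex.normSq_eq_norm_sq, ← norm_pow, hw, hr]
  have hcw0 : (starRingEnd ℂ) w ≠ 0 := by simpa using hw0
  have hcν : (starRingEnd ℂ) w * ν = w := by
    have : (r : ℂ) * ((starRingEnd ℂ) w * ν) = r * w := by
      linear_combination (-(starRingEnd ℂ) w) * hwν + w * hww
    exact mul_left_cancel₀ hrC this
  have hwcw : w / (starRingEnd ℂ) w = ν := by rw [div_eq_iff hcw0, mul_comm, hcν]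
  obtain ⟨Ω, hΩdef⟩ : ∃ Ω, Ω = √(2 * (E + h)) := ⟨_, rfl⟩
  have hΩ : 0 < Ω := hΩdef ▸ Real.sqrt_pos.2 (by linarith)
  have hΩsq : Ω ^ 2 = 2 * (E + h) := by rw [hΩdef, Real.sq_sqrt (by linarith)]
  have hE : 2 * a ^ 2 * r = Ω ^ 2 * r + 2 * μ := by
    rw [hasq, hΩsq]; field_simp
  have H := isFundamentalSystem_cosh hΩ.ne'
  have hnorm := hasDerivAt_norm_of_perp (BoundaryChart.hasDerivAt_γ hD ξ).differentiableAt hp hperp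
  have hUd : HasDerivAt (fun x => innerPotential E h μ (γ x)) 0 ξ := hasDerivAt_innerPotential hnorm hp
  have hγc : ContDiffAt ℝ 1 (fun q : ℝ × ℝ => γ q.1) (ξ, 0) :=
    ContDiffAt.comp (ξ, (0 : ℝ)) (hD.contDiff.contDiffAt.of_le (by norm_num)) contDiffAt_fst
  have hlc := hc.contDiffAt_launch hD (contDiffAt_innerPotential (E := E) (h := h) (μ := μ) hp) hVpos (-1)
  have hw1 : ContDiffAt ℝ 1 (leviStart γ w) (ξ, 0) :=
    ContDiffAt.comp (ξ, (0 : ℝ)) (by rw [← hw]; exact contDiffAt_rootNear hw0) hγc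
  have hw2 : ContDiffAt ℝ 1 (leviStartVel E h μ D γ w) (ξ, 0) :=
    (Complex.conjCLE.contDiff.contDiffAt.comp (ξ, (0 : ℝ)) hw1).mul hlc
  have hLeq : leviPos E h μ D γ w = flowPos (fun s => Real.cosh (Ω * s))
      (fun s => Real.sinh (Ω * s) / Ω) (leviStart γ w) (leviStartVel E h μ D γ w) := by
    rw [leviPos, hΩdef]
  have hMeq : leviVel E h μ D γ w = flowVel (Ω ^ 2) (fun s => Real.cosh (Ω * s))
      (fun s => Real.sinh (Ω * s) / Ω) (leviStart γ w) (leviStartVel E h μ D γ w) := by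
    rw [leviVel, hΩdef]
  have hL : ∀ s, ContDiffAt ℝ 1 (leviPos E h μ D γ w) ((ξ, 0), s) := by
    rw [hLeq]; exact H.contDiffAt_flowPos hw1 hw2
  have hM : ∀ s, ContDiffAt ℝ 1 (leviVel E h μ D γ w) ((ξ, 0), s) := by
    rw [hMeq]; exact H.contDiffAt_flowVel hw1 hw2
  have hZ : ∀ s, ContDiffAt ℝ 1 (innerPos E h μ D γ w) ((ξ, 0), s) := fun s => (hL s).pow 2
  obtain ⟨T, hT, hC, hS, hmid⟩ := exists_inner_time hΩ hr0 ha0 hμ hE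
  have hstart : leviStart γ w (ξ, 0) = w := by rw [leviStart, ← hw, rootNear_self hw0]
  have hlaunch : launch (innerPotential E h μ) D γ (-1) (ξ, 0) = (-(√2 * a)) • ν := by
    rw [hc.launch_base hD, ← ha]; congr 1; ring
  have hstartV : leviStartVel E h μ D γ w (ξ, 0) = (-(√2 * a)) • w := by
    rw [leviStartVel, hstart, hlaunch, mul_smul_comm, hcν]
  have hLb : ∀ s, leviPos E h μ D γ w ((ξ, 0), s) =
      (Real.cosh (Ω * s) - Real.sinh (Ω * s) / Ω * (√2 * a)) • w := by
    intro s
    rw [hLeq]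
    simp only [flowPos, hstart, hstartV]
    module
  have hMb : ∀ s, leviVel E h μ D γ w ((ξ, 0), s) =
      (Ω ^ 2 * (Real.sinh (Ω * s) / Ω) - Real.cosh (Ω * s) * (√2 * a)) • w := by
    intro s
    rw [hMeq]
    simp only [flowVel, hstart, hstartV]
    module
  have hLT : leviPos E h μ D γ w ((ξ, 0), T) = -w := by
    rw [hLb, hC, hS, ← neg_one_smul ℝ]
    congr 1
    field_simp
    linear_combination (-(a ^ 2 * r)) * h2
  have hMT : leviVel E h μ D γ w ((ξ, 0), T) = (-(√2 * a)) • w := by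
    rw [hMb, hC, hS]
    congr 1
    field_simp
    linear_combination (-1) * hE
  have hLs : ∀ s, HasDerivAt (fun s => leviPos E h μ D γ w ((ξ, 0), s))
      (leviVel E h μ D γ w ((ξ, 0), s)) s := by
    intro s; rw [hLeq, hMeq]; exact H.hasDerivAt_flowPos _ s
  have hray : ∀ s, innerPos E h μ D γ w ((ξ, 0), s) =
      ((Real.cosh (Ω * s) - Real.sinh (Ω * s) / Ω * (√2 * a)) ^ 2) • γ ξ := by
    intro s
    rw [innerPos, physicalPosition, hLb, smul_pow, hw]
  have hZ0 : innerPos E h μ D γ w ((ξ, 0), 0) = γ ξ := by rw [hray]; simp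
  have hZT : innerPos E h μ D γ w ((ξ, 0), T) = γ ξ := by
    rw [innerPos, physicalPosition, hLT, neg_sq, hw]
  have hVT : innerVel E h μ D γ w ((ξ, 0), T) = (√2 * a) • ν := by
    rw [innerVel, physicalVelocity, hLT, hMT, map_neg, neg_smul, neg_div_neg_eq, ← hwcw,
      smul_div_assoc]
  have hZs0 : HasDerivAt (fun s => innerPos E h μ D γ w ((ξ, 0), s)) ((-(2 * √2 * a * r)) • ν) 0 := by
    refine ((hLs 0).pow 2).congr_deriv ?_
    rw [hLb, hMb]
    simp
    linear_combination (2 * (√2 : ℂ) * a) * hwν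
  have hZsT : HasDerivAt (fun s => innerPos E h μ D γ w ((ξ, 0), s)) ((2 * √2 * a * r) • ν) T := by
    refine ((hLs T).pow 2).congr_deriv ?_
    rw [hLT, hMT]
    simp
    linear_combination (2 * (√2 : ℂ) * a) * hwν
  have hYc : ContDiffAt ℝ 1 Y (γ ξ) := hc.contDiffAt_Y.of_le (by norm_num)
  -- The interior is the side `Y < 0`, hence the sign of `G`.
  obtain ⟨τ, hτc, hτ0, hτ⟩ := exists_firstHit (W := D) (G := fun z => -Y z) hD.isOpen hYc.neg (by simp [hc.Y_point])
    (by filter_upwards [hc.inside] with z hz hneg using hz (by linarith)) hT hZ hZ0 hZT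
    (by
      intro s hs
      rw [hray]
      exact hin _ (sq_nonneg _) (by rw [sq_lt_one_iff_abs_lt_one]; exact hmid s hs))
    (by
      have hfst : Tendsto (fun q : ℝ × ℝ => q.1) (𝓝 (ξ, 0)) (𝓝 ξ) := continuousAt_fst
      filter_upwards [hfst.eventually hc.coord_boundary] with q hq
      have : innerPos E h μ D γ w (q, 0) = γ q.1 := by
        rw [innerPos, hLeq, H.flowPos_zero, physicalPosition, leviStart,
          rootNear_sq hw0 (hD.point_ne_zero _)]
      rw [this, hq.2, neg_zero])
    (by
      rw [fderiv_apply_zero_one (hZ 0) hZs0, fderiv_fun_neg, neg_apply, hc.fderiv_Y hD,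
        real_inner_smul_right, hc.inner_ν_ν, mul_one, neg_neg]
      positivity)
    (by
      rw [fderiv_apply_zero_one (hZ T) hZsT, fderiv_fun_neg, neg_apply, hc.fderiv_Y hD,
        real_inner_smul_right, hc.inner_ν_ν, mul_one, neg_lt_zero]
      positivity)
  have hV : ContDiffAt ℝ 1 (innerVel E h μ D γ w) ((ξ, 0), T) := by
    have h1 : ContDiffAt ℝ 1 (fun x => (starRingEnd ℂ) (leviPos E h μ D γ w x)) ((ξ, 0), T) :=
      Complex.conjCLE.contDiff.contDiffAt.comp ((ξ, (0 : ℝ)), T) (hL T)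
    have h3 := (hM T).mul (h1.inv (by rw [hLT]; simpa using hw0))
    exact h3.congr_of_eventuallyEq (Eventually.of_forall fun x => by
      simp [innerVel, physicalVelocity, div_eq_mul_inv])
  -- Only the direction `ν` of this derivative matters; the linearised section does not depend on
  -- `lv`.
  obtain ⟨lv, hVs⟩ : ∃ lv : ℝ, HasDerivAt (fun s => innerVel E h μ D γ w ((ξ, 0), s)) (lv • ν) T := by
    have h3 : ∀ s, innerVel E h μ D γ w ((ξ, 0), s) =
        ((Ω ^ 2 * (Real.sinh (Ω * s) / Ω) - Real.cosh (Ω * s) * (√2 * a)) /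
          (Real.cosh (Ω * s) - Real.sinh (Ω * s) / Ω * (√2 * a))) • ν := by
      intro s
      rw [innerVel, physicalVelocity, hLb, hMb, ← hwcw]
      simp only [Complex.real_smul, map_mul, Complex.conj_ofReal]
      push_cast
      rw [mul_div_mul_comm]
    have hne : Real.cosh (Ω * T) - Real.sinh (Ω * T) / Ω * (√2 * a) ≠ 0 := by
      intro h0
      have := hLb T
      rw [h0, zero_smul, hLT] at this
      exact hw0 (neg_eq_zero.1 this)
    have h4 := (((H.deriv_S T).const_mul (Ω ^ 2)).sub ((H.deriv_C T).mul_const (√2 * a))).div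
      ((H.deriv_C T).sub ((H.deriv_S T).mul_const (√2 * a))) hne
    refine ⟨_, (h4.smul_const ν).congr_of_eventuallyEq (Eventually.of_forall fun s => ?_)⟩
    exact h3 s
  refine ⟨τ, sectionMap γ X (innerPos E h μ D γ w) (innerVel E h μ D γ w) τ,
    hc.contDiffAt_sectionMap hD (hZ T) hV hτc hτ0 hZT, hc.sectionMap_base hτ0 hZT hVT, ?_, ?_, ?_, ?_⟩
  · intro u
    refine ⟨_, _, rfl, rfl, ?_⟩
    set N := a * (ℓ * u.1) / (2 * r) - a * k * (ℓ * u.1) + u.2 with hN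
    set η := (2 * a ^ 2 * r / μ - 1) * (ℓ * u.1 / (2 * r)) + 2 * a * r / μ * N with hη
    have hγu : HasDerivAt (fun ε : ℝ => γ (ξ + ε * u.1)) ((κ * (ℓ * u.1)) • (Complex.I * ν)) 0 := by
      have h3 : HasDerivAt (fun ε : ℝ => ξ + ε * u.1) u.1 0 := by
        simpa using ((hasDerivAt_id (0 : ℝ)).mul_const u.1).const_add ξ
      have h4 : HasDerivAt γ (deriv γ ξ) (ξ + 0 * u.1) := by
        simpa using BoundaryChart.hasDerivAt_γ hD ξ
      refine (h4.scomp (0 : ℝ) h3).congr_deriv ?_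
      rw [hc.deriv_eq hD, ← hℓ]
      module
    have hl := hc.hasDerivAt_launch hD hUd hVpos (-1) u
    rw [← ha, ← hk, ← hℓ] at hl
    have hw0u : HasDerivAt (fun ε : ℝ => leviStart γ w ((ξ, 0) + ε • u))
        ((κ * (ℓ * u.1 / (2 * r))) • (Complex.I * w)) 0 := by
      have h3 : HasDerivAt (rootNear w) (1 / (2 * w)) (γ (ξ + 0 * u.1)) := by
        rw [zero_mul, add_zero, ← hw]; exact hasDerivAt_rootNear hw0
      have h4 := h3.comp (0 : ℝ) hγu
      refine (h4.congr_deriv ?_).congr_of_eventuallyEq (Eventually.of_forall fun ε => ?_)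
      · simp only [Complex.real_smul]
        push_cast
        field_simp
        linear_combination (-(κ * ℓ * u.1 : ℂ)) * hwν
      · simp [leviStart]
    have hw0u' : HasDerivAt (fun ε : ℝ => leviStartVel E h μ D γ w ((ξ, 0) + ε • u))
        ((κ * (√2 * N)) • (Complex.I * w)) 0 := by
      have h3 := (hw0u.star).mul hl
      refine h3.congr_deriv ?_
      have e0 : ((ξ, 0) : ℝ × ℝ) + (0 : ℝ) • u = (ξ, 0) := by simp
      simp only [e0, hstart, hlaunch, Complex.real_smul, Complex.star_def, map_mul,
        Complex.conj_ofReal, Complex.conj_I, hN]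
      push_cast
      linear_combination ((κ : ℂ) * √2 * (ℓ * u.1 * a / (2 * r)  - a * k * (ℓ * u.1) + u.2) *
        Complex.I) * hcν
    have e0 : ((ξ, 0) : ℝ × ℝ) + (0 : ℝ) • u = (ξ, 0) := by simp
    have hLu : HasDerivAt (fun ε : ℝ => leviPos E h μ D γ w ((ξ, 0) + ε • u, T))
        ((κ * η) • (Complex.I * w)) 0 := by
      have h3 := (hw0u.const_smul (2 * a ^ 2 * r / μ - 1)).add (hw0u'.const_smul (√2 * a * r / μ))
      refine (h3.congr_deriv ?_).congr_of_eventuallyEq (Eventually.of_forall fun ε => ?_)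
      · rw [smul_smul, smul_smul, ← add_smul]
        congr 1
        rw [hη]
        linear_combination (a * r / μ * κ * N) * h2
      · simp only [hLeq, flowPos, ← hC, ← hS]
        rfl
    have hMu : HasDerivAt (fun ε : ℝ => leviVel E h μ D γ w ((ξ, 0) + ε • u, T))
        ((κ * (√2 * (a * (2 * a ^ 2 * r / μ - 2) * (ℓ * u.1 / (2 * r)) +
          (2 * a ^ 2 * r / μ - 1) * N))) • (Complex.I * w)) 0 := by
      have h3 := (hw0u.const_smul (Ω ^ 2 * (√2 * a * r / μ))).add
        (hw0u'.const_smul (2 * a ^ 2 * r / μ - 1))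
      refine (h3.congr_deriv ?_).congr_of_eventuallyEq (Eventually.of_forall fun ε => ?_)
      · rw [smul_smul, smul_smul, ← add_smul]
        congr 1
        have h5 : Ω ^ 2 * (√2 * a * r / μ) = √2 * a * (2 * a ^ 2 * r / μ - 2) := by
          field_simp
          linear_combination (-1) * hE
        rw [h5]
        ring
      · simp only [hMeq, flowVel, ← hC, ← hS]
        rfl
    have hZu : HasDerivAt (fun ε : ℝ => innerPos E h μ D γ w ((ξ, 0) + ε • u, T))
        ((κ * (-(2 * r * η))) • (Complex.I * ν)) 0 := by
      refine (hLu.pow 2).congr_deriv ?_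
      simp only [e0, hLT, Complex.real_smul]
      push_cast
      linear_combination (-2 * (κ : ℂ) * η * Complex.I) * hwν
    have hVu : HasDerivAt (fun ε : ℝ => innerVel E h μ D γ w ((ξ, 0) + ε • u, T))
        ((κ * (-(√2 * (a * (2 * a ^ 2 * r / μ - 2) * (ℓ * u.1 / (2 * r)) +
          (2 * a ^ 2 * r / μ - 1) * N + a * η)))) • (Complex.I * ν)) 0 := by
      have hne : star (leviPos E h μ D γ w ((ξ, 0) + (0 : ℝ) • u, T)) ≠ 0 := by
        rw [e0, hLT]; simpa using hw0
      have h3 := hMu.div hLu.star hne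
      refine h3.congr_deriv ?_
      simp only [e0, hLT, hMT, Complex.real_smul, Complex.star_def, map_mul, map_neg,
        Complex.conj_ofReal, Complex.conj_I, ← hwcw]
      push_cast
      field_simp
      ring
    rw [hc.fderiv_sectionMap hD (hZ T) hV hτc hτ0 hZT hVT hZsT hVs hZu hVu, ← hℓ, ← hk]
    congr 1
    field_simp
    ring
  · exact fun s => ⟨_, sq_nonneg _, hray s⟩
  · have hcont : ContinuousOn (fun s => Real.cosh (Ω * s) - Real.sinh (Ω * s) / Ω * (√2 * a))
        (Icc 0 T) := by fun_prop
    have hvT : Real.cosh (Ω * T) - Real.sinh (Ω * T) / Ω * (√2 * a) = -1 := by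
      rw [hC, hS]
      field_simp
      linear_combination (-(a ^ 2 * r)) * h2
    -- The real factor runs from `1` to `-1`; its zero is the collision.
    have h3 := intermediate_value_Ioo' hT.le hcont
    obtain ⟨s, hs, hs0⟩ := h3 (show (0 : ℝ) ∈ _ by rw [hvT]; simp)
    refine ⟨s, by rw [hτ0]; exact hs, ?_⟩
    rw [hLb]
    beta_reduce at hs0
    rw [hs0, zero_smul]
  · have hZt : Tendsto (fun q => innerPos E h μ D γ w (q, τ q)) (𝓝 (ξ, 0)) (𝓝 (γ ξ)) := by
      have h1 : ContinuousAt (fun q => (q, τ q)) ((ξ, 0) : ℝ × ℝ) :=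
        continuousAt_id.prodMk hτc.continuousAt
      have h3 : ContinuousAt (innerPos E h μ D γ w) ((ξ, 0), τ (ξ, 0)) := by
        rw [hτ0]; exact (hZ T).continuousAt
      have := ContinuousAt.comp (f := fun q => (q, τ q)) h3 h1
      rw [ContinuousAt, Function.comp_apply, hτ0, hZT] at this
      exact this
    filter_upwards [hτ, hZt.eventually hc.coord_eq] with q hq hq2
    refine ⟨hq.1, ?_, ?_, hq.2.2⟩
    · rw [neg_eq_zero.1 hq.2.1, zero_smul, add_zero] at hq2
      exact hq2.symm
    · simp only [sectionMap]
      field_simp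

/-! ### Snell's law, and existence and uniqueness of cycles -/

section

variable {E h μ ω : ℝ} {D : Set ℂ} {γ : ℝ → ℂ}

/-- At zero energy `√V / |u| = 1 / √2` on either side, so refraction preserves the tangential
velocity. -/
theorem snellLaw_iff {V V' : ℝ} {t u u' : ℂ} (hV : 0 < V) (hV' : 0 < V') (hu : ‖u‖ ^ 2 = 2 * V)
    (hu' : ‖u'‖ ^ 2 = 2 * V') : SnellLaw V V' t u u' ↔ inner ℝ u t = inner ℝ u' t := by
  have key : ∀ {V : ℝ} {u : ℂ}, 0 < V → ‖u‖ ^ 2 = 2 * V → √V * ‖u‖⁻¹ = 1 / √2 := by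
    intro V u hV hu
    have h1 : ‖u‖ = √2 * √V := by
      rw [← Real.sqrt_mul (by norm_num), ← hu, Real.sqrt_sq (norm_nonneg _)]
    have h2 : 0 < √V := Real.sqrt_pos.2 hV
    rw [h1]
    field_simp
  have h20 : (1 / √2 : ℝ) ≠ 0 := by positivity
  rw [SnellLaw, real_inner_smul_left, real_inner_smul_left, ← mul_assoc, ← mul_assoc, key hV hu,
    key hV' hu', mul_right_inj' h20]

theorem snellLaw_unit_iff {V V' : ℝ} {t u d : ℂ} (hV : 0 < V) (hu : ‖u‖ ^ 2 = 2 * V)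
    (hd : ‖d‖ = 1) : SnellLaw V V' t u d ↔ inner ℝ u t / √2 = √V' * inner ℝ d t := by
  have h1 : ‖u‖ = √2 * √V := by
    rw [← Real.sqrt_mul (by norm_num), ← hu, Real.sqrt_sq (norm_nonneg _)]
  have h2 : 0 < √V := Real.sqrt_pos.2 hV
  have h3 : √V * ((√2 * √V)⁻¹ * inner ℝ u t) = inner ℝ u t / √2 := by field_simp
  rw [SnellLaw, real_inner_smul_left, real_inner_smul_left, hd, inv_one, one_mul, h1, h3]

theorem isOuterArc_outerPos (hω : 0 < ω) {q : ℝ × ℝ}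
    (hq : ‖launch (outerPotential E ω) D γ 1 q‖ ^ 2 = 2 * outerPotential E ω (γ q.1)) (T : ℝ) :
    IsOuterArc E ω T (fun s => outerPos E ω D γ (q, s)) (fun s => outerVel E ω D γ (q, s)) where
  deriv_pos s _ := ((isFundamentalSystem_cos hω.ne').hasDerivAt_flowPos q s).hasDerivWithinAt
  deriv_vel s _ := by
    have := ((isFundamentalSystem_cos hω.ne').hasDerivAt_flowVel (z₀ := fun q : ℝ × ℝ => γ q.1)
      (v₀ := launch (outerPotential E ω) D γ 1) q s).hasDerivWithinAt (s := Icc 0 T)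
    refine this.congr_deriv ?_
    rw [neg_smul]; rfl
  energy s _ := by
    have := (isFundamentalSystem_cos hω.ne').norm_flowVel_sq (z₀ := fun q : ℝ × ℝ => γ q.1)
      (v₀ := launch (outerPotential E ω) D γ 1) q s
    rw [hq] at this
    simp only [outerPotential, outerPos, outerVel] at this ⊢
    linarith

theorem outerPos_zero (hω : 0 < ω) (q : ℝ × ℝ) : outerPos E ω D γ (q, 0) = γ q.1 :=
  (isFundamentalSystem_cos hω.ne').flowPos_zero (z₀ := fun q : ℝ × ℝ => γ q.1) q

theorem outerVel_zero (hω : 0 < ω) (q : ℝ × ℝ) :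
    outerVel E ω D γ (q, 0) = launch (outerPotential E ω) D γ 1 q :=
  (isFundamentalSystem_cos hω.ne').flowVel_zero (z₀ := fun q : ℝ × ℝ => γ q.1) q

theorem IsOuterArc.eq_outerPos (hω : 0 < ω) {q : ℝ × ℝ} {T : ℝ} {z v : ℝ → ℂ}
    (H : IsOuterArc E ω T z v) (h0 : z 0 = γ q.1)
    (h1 : v 0 = launch (outerPotential E ω) D γ 1 q) {s : ℝ} (hs : s ∈ Icc 0 T) :
    z s = outerPos E ω D γ (q, s) ∧ v s = outerVel E ω D γ (q, s) := by
  have := (isFundamentalSystem_cos hω.ne').unique H.deriv_pos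
    (fun s hs => (H.deriv_vel s hs).congr_deriv (by rw [neg_smul])) hs
  rw [h0, h1] at this
  exact this

theorem rootNear_ne_zero {w z : ℂ} (hw : w ≠ 0) : rootNear w z ≠ 0 :=
  mul_ne_zero hw (Complex.exp_ne_zero _)

theorem innerPos_zero (hEh : 0 < E + h) {w : ℂ} (hw : w ≠ 0) {q : ℝ × ℝ} (hq : γ q.1 ≠ 0) :
    innerPos E h μ D γ w (q, 0) = γ q.1 := by
  have H := isFundamentalSystem_cosh (Real.sqrt_pos.2 (show 0 < 2 * (E + h) by linarith)).ne'
  rw [innerPos, leviPos, H.flowPos_zero, physicalPosition, leviStart, rootNear_sq hw hq]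

theorem innerVel_zero (hEh : 0 < E + h) {w : ℂ} (hw : w ≠ 0) (q : ℝ × ℝ) :
    innerVel E h μ D γ w (q, 0) = launch (innerPotential E h μ) D γ (-1) q := by
  have H := isFundamentalSystem_cosh (Real.sqrt_pos.2 (show 0 < 2 * (E + h) by linarith)).ne'
  rw [innerVel, leviPos, leviVel, H.flowPos_zero, H.flowVel_zero, physicalVelocity, leviStartVel,
    mul_div_cancel_left₀]
  simpa [leviStart] using rootNear_ne_zero hw

theorem isRegularisedInnerArc_leviPos (hEh : 0 < E + h) {w : ℂ} (hw : w ≠ 0) {q : ℝ × ℝ}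
    (hq0 : γ q.1 ≠ 0)
    (hq : ‖launch (innerPotential E h μ) D γ (-1) q‖ ^ 2 = 2 * innerPotential E h μ (γ q.1)) (T : ℝ) :
    IsRegularisedInnerArc E h μ T (fun s => leviPos E h μ D γ w (q, s))
      (fun s => leviVel E h μ D γ w (q, s)) := by
  have hsq : √(2 * (E + h)) ^ 2 = 2 * (E + h) := Real.sq_sqrt (by linarith)
  have H := isFundamentalSystem_cosh (Real.sqrt_pos.2 (show 0 < 2 * (E + h) by linarith)).ne'
  refine ⟨fun s _ => (H.hasDerivAt_flowPos q s).hasDerivWithinAt, fun s _ => ?_, fun s _ => ?_⟩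
  · have := (H.hasDerivAt_flowVel (z₀ := leviStart γ w) (v₀ := leviStartVel E h μ D γ w)
      q s).hasDerivWithinAt (s := Icc 0 T)
    refine this.congr_deriv ?_
    rw [hsq]; rfl
  · have := H.norm_flowVel_sq (z₀ := leviStart γ w) (v₀ := leviStartVel E h μ D γ w) q s
    have h1 : ‖leviStart γ w q‖ ^ 2 = ‖γ q.1‖ := by
      rw [← norm_pow, leviStart, rootNear_sq hw hq0]
    have h3 : ‖leviStartVel E h μ D γ w q‖ ^ 2 = ‖γ q.1‖ * (2 * innerPotential E h μ (γ q.1)) := by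
      rw [leviStartVel, norm_mul, mul_pow, RCLike.norm_conj, h1, hq]
    have h4 : ‖γ q.1‖ ≠ 0 := norm_ne_zero_iff.2 hq0
    rw [h1, h3, hsq] at this
    have h5 : ‖γ q.1‖ * (2 * innerPotential E h μ (γ q.1)) = 2 * (E + h) * ‖γ q.1‖ + 2 * μ := by
      rw [innerPotential]; field_simp
    rw [h5] at this
    simp only [leviPos, leviVel]
    rw [hsq]
    linarith

/-- The initial point lifts to two square roots. Changing the sign of `w 0` changes the sign of the
whole lifted solution, which cancels in `w ^ 2` and in `w' / conj w`. -/
theorem IsRegularisedInnerArc.eq_innerPos (hEh : 0 < E + h) {w₀ : ℂ} (hw₀ : w₀ ≠ 0) {q : ℝ × ℝ}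
    (hq0 : γ q.1 ≠ 0) {T : ℝ} {w w' : ℝ → ℂ} (H : IsRegularisedInnerArc E h μ T w w')
    (h0 : physicalPosition (w 0) = γ q.1)
    (h1 : physicalVelocity (w 0) (w' 0) = launch (innerPotential E h μ) D γ (-1) q)
    {s : ℝ} (hs : s ∈ Icc 0 T) :
    physicalPosition (w s) = innerPos E h μ D γ w₀ (q, s) ∧
      physicalVelocity (w s) (w' s) = innerVel E h μ D γ w₀ (q, s) := by
  have hsq : √(2 * (E + h)) ^ 2 = 2 * (E + h) := Real.sq_sqrt (by linarith)
  have HF := isFundamentalSystem_cosh (Real.sqrt_pos.2 (show 0 < 2 * (E + h) by linarith)).ne'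
  have hw0 : w 0 ≠ 0 := by
    intro hw; rw [hw, physicalPosition] at h0; exact hq0 (by rw [← h0]; simp)
  have hcw0 : (starRingEnd ℂ) (w 0) ≠ 0 := by simpa using hw0
  have hv : w' 0 = (starRingEnd ℂ) (w 0) * launch (innerPotential E h μ) D γ (-1) q := by
    rw [← h1, physicalVelocity, mul_div_cancel₀ _ hcw0]
  have hu := HF.unique H.deriv_pos (fun s hs => (H.deriv_vel s hs).congr_deriv (by rw [hsq])) hs
  have hsqw : w 0 ^ 2 = leviStart γ w₀ q ^ 2 := by
    rw [leviStart, rootNear_sq hw₀ hq0]; exact h0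
  rcases sq_eq_sq_iff_eq_or_eq_neg.1 hsqw with hε | hε
  · have e1 : w s = leviPos E h μ D γ w₀ (q, s) := by rw [hu.1, hv, hε]; rfl
    have e2 : w' s = leviVel E h μ D γ w₀ (q, s) := by rw [hu.2, hv, hε]; rfl
    rw [e1, e2]; exact ⟨rfl, rfl⟩
  · have e1 : w s = -leviPos E h μ D γ w₀ (q, s) := by
      rw [hu.1, hv, hε, map_neg, neg_mul, smul_neg, smul_neg, ← neg_add]; rfl
    have e2 : w' s = -leviVel E h μ D γ w₀ (q, s) := by
      rw [hu.2, hv, hε, map_neg, neg_mul, smul_neg, smul_neg, ← neg_add]; rfl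
    rw [e1, e2]
    simp [physicalPosition, physicalVelocity, innerPos, innerVel]

theorem direction_spec (hD : IsRegularDomain D γ) {κ x : ℝ} (hκ : κ ^ 2 = 1)
    (hn : outwardNormal D γ x = -(κ * Complex.I) * unitTangent γ x) (α : ℝ) :
    ‖direction D γ x α‖ = 1 ∧ inner ℝ (direction D γ x α) (unitTangent γ x) = Real.sin α := by
  rw [direction, hn, inner_smul_normal_add (hD.norm_unitTangent x)]
  refine ⟨?_, rfl⟩
  rw [← sq_eq_sq₀ (norm_nonneg _) zero_le_one, norm_smul_normal_add_sq (hD.norm_unitTangent x) hκ,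
    Real.cos_sq_add_sin_sq, one_pow]

/-- The tangential momentum coordinate `σ = √V_E sin α` of an outgoing direction. -/
def toSigma (E ω : ℝ) (γ : ℝ → ℂ) (q : ℝ × ℝ) : ℝ × ℝ :=
  (q.1, √(outerPotential E ω (γ q.1)) * Real.sin q.2)

/-- The outgoing direction with a given tangential momentum coordinate. -/
def ofSigma (E ω : ℝ) (γ : ℝ → ℂ) (q : ℝ × ℝ) : ℝ × ℝ :=
  (q.1, Real.arcsin (q.2 / √(outerPotential E ω (γ q.1))))

/-- The range of the angle gives `cos α ≥ 0`, so the normal component is the nonnegative square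
root. -/
theorem smul_direction_eq_launch {q : ℝ × ℝ} (hα : q.2 ∈ Icc (-(π / 2)) (π / 2))
    (hV : 0 < outerPotential E ω (γ q.1)) :
    √(2 * outerPotential E ω (γ q.1)) • direction D γ q.1 q.2 =
      launch (outerPotential E ω) D γ 1 (toSigma E ω γ q) := by
  have hcos : 0 ≤ Real.cos q.2 := Real.cos_nonneg_of_mem_Icc ⟨by linarith [hα.1], hα.2⟩
  have h1 : outerPotential E ω (γ q.1) - (√(outerPotential E ω (γ q.1)) * Real.sin q.2) ^ 2 =
      (√(outerPotential E ω (γ q.1)) * Real.cos q.2) ^ 2 := by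
    rw [mul_pow, mul_pow, Real.sq_sqrt hV.le, Real.cos_sq']
    ring
  simp only [launch, toSigma, direction]
  rw [h1, Real.sqrt_sq (by positivity), Real.sqrt_mul (by norm_num)]
  module

theorem toSigma_sq_le {q : ℝ × ℝ} (hV : 0 < outerPotential E ω (γ q.1)) :
    (toSigma E ω γ q).2 ^ 2 ≤ outerPotential E ω (γ (toSigma E ω γ q).1) := by
  simp only [toSigma]
  rw [mul_pow, Real.sq_sqrt hV.le]
  have := Real.sin_sq_le_one q.2
  nlinarith

/-- Data of a transversal first return: `q` is followed along an outer arc of duration `τE` to the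
boundary data `s₁`, and from there along an inner arc of duration `τI` to the boundary data `s₂`. -/
structure IsReturnData (E h μ ω : ℝ) (D : Set ℂ) (γ : ℝ → ℂ) (κ : ℝ) (w₀ : ℂ) (q s₁ s₂ : ℝ × ℝ)
    (τE τI : ℝ) : Prop where
  angle : q.2 ∈ Icc (-(π / 2)) (π / 2)
  normal₀ : outwardNormal D γ q.1 = -(κ * Complex.I) * unitTangent γ q.1
  normal₁ : outwardNormal D γ s₁.1 = -(κ * Complex.I) * unitTangent γ s₁.1
  normal₂ : outwardNormal D γ s₂.1 = -(κ * Complex.I) * unitTangent γ s₂.1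
  hill₀ : 0 < outerPotential E ω (γ q.1)
  hill₁ : 0 < outerPotential E ω (γ s₁.1)
  hill₂ : 0 < outerPotential E ω (γ s₂.1)
  transversal : s₁.2 ^ 2 < innerPotential E h μ (γ s₁.1)
  sine : s₂.2 / √(outerPotential E ω (γ s₂.1)) ∈ Icc (-1) 1
  side : ∀ (z : ℝ → ℂ) (a b : ℝ), z 0 = γ s₁.1 →
    HasDerivWithinAt z (a • (-(κ * Complex.I) * unitTangent γ s₁.1) + b • unitTangent γ s₁.1)
      (Ici 0) 0 →
    (0 < a → ∀ᶠ s in 𝓝[>] 0, z s ∉ closure D) ∧ (a < 0 → ∀ᶠ s in 𝓝[>] 0, z s ∈ D)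
  τE_pos : 0 < τE
  outer_end : outerPos E ω D γ (toSigma E ω γ q, τE) = γ s₁.1
  outer_tangential :
    inner ℝ (outerVel E ω D γ (toSigma E ω γ q, τE)) (unitTangent γ s₁.1) = √2 * s₁.2
  outer_mem : ∀ s ∈ Ioo 0 τE, outerPos E ω D γ (toSigma E ω γ q, s) ∉ closure D
  τI_pos : 0 < τI
  inner_end : innerPos E h μ D γ w₀ (s₁, τI) = γ s₂.1
  inner_tangential : inner ℝ (innerVel E h μ D γ w₀ (s₁, τI)) (unitTangent γ s₂.1) = √2 * s₂.2
  inner_mem : ∀ s ∈ Ioo 0 τI, innerPos E h μ D γ w₀ (s₁, s) ∈ D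

theorem innerPotential_pos (hEh : 0 < E + h) (hμ : 0 < μ) (z : ℂ) : 0 < innerPotential E h μ z := by
  have : 0 ≤ μ / ‖z‖ := by positivity
  rw [innerPotential]; linarith

namespace IsReturnData

variable {κ : ℝ} {w₀ : ℂ} {q s₁ s₂ : ℝ × ℝ} {τE τI : ℝ}

/-- The cycle that runs along the outer arc and the inner arc of the return data. -/
def cycle (E h μ ω : ℝ) (D : Set ℂ) (γ : ℝ → ℂ) (w₀ : ℂ) (q s₁ : ℝ × ℝ) (τE τI : ℝ) : Cycle where
  z s := outerPos E ω D γ (toSigma E ω γ q, s)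
  v s := outerVel E ω D γ (toSigma E ω γ q, s)
  TE := τE
  ξm := s₁.1
  w s := leviPos E h μ D γ w₀ (s₁, s)
  w' s := leviVel E h μ D γ w₀ (s₁, s)
  TI := τI

theorem norm_innerVel_end (R : IsReturnData E h μ ω D γ κ w₀ q s₁ s₂ τE τI) (hEh : 0 < E + h)
    (hD : IsRegularDomain D γ) (hκ : κ ^ 2 = 1) (hw₀ : w₀ ≠ 0) :
    ‖innerVel E h μ D γ w₀ (s₁, τI)‖ ^ 2 = 2 * innerPotential E h μ (γ s₂.1) := by
  have hI := isRegularisedInnerArc_leviPos hEh hw₀ (hD.point_ne_zero s₁.1)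
    (norm_launch_sq hD hκ R.normal₁ (ς := -1) (by norm_num) R.transversal.le) τI
  have hend := R.inner_end
  have hne : leviPos E h μ D γ w₀ (s₁, τI) ≠ 0 := by
    intro h0
    rw [innerPos, h0, physicalPosition] at hend
    exact hD.point_ne_zero s₂.1 (by rw [← hend]; simp)
  have he := levi_civita_energy hI ⟨R.τI_pos.le, le_rfl⟩ hne
  have h2 : physicalPosition (leviPos E h μ D γ w₀ (s₁, τI)) = γ s₂.1 := hend
  rw [h2] at he
  rw [innerVel]
  linarith

theorem norm_outerVel_end (R : IsReturnData E h μ ω D γ κ w₀ q s₁ s₂ τE τI) (hω : 0 < ω)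
    (hD : IsRegularDomain D γ) (hκ : κ ^ 2 = 1) :
    ‖outerVel E ω D γ (toSigma E ω γ q, τE)‖ ^ 2 = 2 * outerPotential E ω (γ s₁.1) := by
  have hO := isOuterArc_outerPos hω
    (norm_launch_sq hD hκ (x := (toSigma E ω γ q).1) R.normal₀ (ς := 1) (by norm_num)
      (toSigma_sq_le R.hill₀)) τE
  have he := hO.energy τE ⟨R.τE_pos.le, le_rfl⟩
  change ‖outerVel E ω D γ (toSigma E ω γ q, τE)‖ ^ 2 / 2 =
    outerPotential E ω (outerPos E ω D γ (toSigma E ω γ q, τE)) at he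
  rw [R.outer_end] at he
  linarith

theorem isCycle (R : IsReturnData E h μ ω D γ κ w₀ q s₁ s₂ τE τI) (hEh : 0 < E + h) (hμ : 0 < μ)
    (hω : 0 < ω) (hD : IsRegularDomain D γ) (hκ : κ ^ 2 = 1) (hw₀ : w₀ ≠ 0) :
    IsCycle E h μ ω D γ q (ofSigma E ω γ s₂) (cycle E h μ ω D γ w₀ q s₁ τE τI) where
  angle_mem := R.angle
  TE_pos := R.τE_pos
  outer := isOuterArc_outerPos hω
    (norm_launch_sq hD hκ (x := (toSigma E ω γ q).1) R.normal₀ (ς := 1) (by norm_num)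
      (toSigma_sq_le R.hill₀)) τE
  outer_start := outerPos_zero hω (toSigma E ω γ q)
  outer_start_vel := by
    rw [smul_direction_eq_launch R.angle R.hill₀]
    exact outerVel_zero hω (toSigma E ω γ q)
  outer_mem := R.outer_mem
  outer_end := R.outer_end
  TI_pos := R.τI_pos
  inner_arc := isRegularisedInnerArc_leviPos hEh hw₀ (hD.point_ne_zero s₁.1)
    (norm_launch_sq hD hκ R.normal₁ (ς := -1) (by norm_num) R.transversal.le) τI
  inner_start := innerPos_zero hEh hw₀ (hD.point_ne_zero s₁.1)
  refraction_in := by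
    have h1 : physicalVelocity (leviPos E h μ D γ w₀ (s₁, 0)) (leviVel E h μ D γ w₀ (s₁, 0)) =
        launch (innerPotential E h μ) D γ (-1) s₁ := innerVel_zero hEh hw₀ s₁
    simp only [cycle]
    rw [h1, snellLaw_iff R.hill₁ (innerPotential_pos hEh hμ _) (R.norm_outerVel_end hω hD hκ)
      (norm_launch_sq hD hκ R.normal₁ (ς := -1) (by norm_num) R.transversal.le), R.outer_tangential]
    exact (inner_launch hD R.normal₁ (-1) s₁.2).symm
  inner_mem := R.inner_mem
  inner_end := R.inner_end
  refraction_out := by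
    have h2 := direction_spec hD hκ R.normal₂ (ofSigma E ω γ s₂).2
    have h3 : 0 < √(outerPotential E ω (γ s₂.1)) := Real.sqrt_pos.2 R.hill₂
    refine (snellLaw_unit_iff (innerPotential_pos hEh hμ _)
      (R.norm_innerVel_end hEh hD hκ hw₀) h2.1).2 ?_
    refine Eq.trans ?_ (congrArg _ h2.2.symm)
    change inner ℝ (innerVel E h μ D γ w₀ (s₁, τI)) (unitTangent γ s₂.1) / √2 = _
    rw [R.inner_tangential]
    simp only [ofSigma]
    rw [Real.sin_arcsin R.sine.1 R.sine.2]
    field_simp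
  angle_mem' := Real.arcsin_mem_Icc _

/-- Each stage of a cycle is forced: the outer arc by uniqueness for the linear equation, its
duration by the first-hit conditions, the refracted velocity by energy, Snell's law and the side it
must enter, and then the inner arc likewise. -/
theorem eq_of_isCycle (R : IsReturnData E h μ ω D γ κ w₀ q s₁ s₂ τE τI) (hEh : 0 < E + h) (hμ : 0 < μ)
    (hω : 0 < ω) (hD : IsRegularDomain D γ) (hκ : κ ^ 2 = 1) (hw₀ : w₀ ≠ 0) {ξ : ℝ}
    (hξ : |s₂.1 - ξ| < π) {q' : ℝ × ℝ} (hq' : |q'.1 - ξ| < π) {c : Cycle}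
    (hcyc : IsCycle E h μ ω D γ q q' c) : q' = ofSigma E ω γ s₂ := by
  have hnotmem : ∀ x, γ x ∉ D := fun x hx => by
    have := hD.mem_frontier x
    rw [frontier, hD.isOpen.interior_eq] at this
    exact this.2 hx
  have hmemcl : ∀ x, γ x ∈ closure D := fun x => frontier_subset_closure (hD.mem_frontier x)
  have hO : ∀ s ∈ Icc 0 c.TE, c.z s = outerPos E ω D γ (toSigma E ω γ q, s) ∧
      c.v s = outerVel E ω D γ (toSigma E ω γ q, s) := fun s hs =>
    hcyc.outer.eq_outerPos hω (q := toSigma E ω γ q) hcyc.outer_start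
      (by rw [hcyc.outer_start_vel, smul_direction_eq_launch R.angle R.hill₀]) hs
  -- If the durations differed, the shorter arc would end on the boundary at a time when the longer
  -- one is still off it.
  have hTE : c.TE = τE := by
    rcases lt_trichotomy c.TE τE with hlt | heq | hlt
    · have h1 := R.outer_mem c.TE ⟨hcyc.TE_pos, hlt⟩
      rw [← (hO c.TE ⟨hcyc.TE_pos.le, le_rfl⟩).1, hcyc.outer_end] at h1
      exact absurd (hmemcl _) h1
    · exact heq
    · have h1 := hcyc.outer_mem τE ⟨R.τE_pos, hlt⟩
      rw [(hO τE ⟨R.τE_pos.le, hlt.le⟩).1, R.outer_end] at h1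
      exact absurd (hmemcl _) h1
  have hOT := hO c.TE ⟨hcyc.TE_pos.le, le_rfl⟩
  have hm : γ c.ξm = γ s₁.1 := by rw [← hcyc.outer_end, hOT.1, hTE, R.outer_end]
  have hmt : unitTangent γ c.ξm = unitTangent γ s₁.1 := hD.unitTangent_eq hm
  set u := physicalVelocity (c.w 0) (c.w' 0) with hu
  have hstart : physicalPosition (c.w 0) = γ s₁.1 := by rw [hcyc.inner_start, hm]
  have hw0 : c.w 0 ≠ 0 := by
    intro h0
    rw [h0, physicalPosition] at hstart
    exact hD.point_ne_zero s₁.1 (by rw [← hstart]; simp)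
  have hun : ‖u‖ ^ 2 = 2 * innerPotential E h μ (γ s₁.1) := by
    have := levi_civita_energy hcyc.inner_arc ⟨le_rfl, hcyc.TI_pos.le⟩ hw0
    rw [hstart] at this
    linarith
  have hut : inner ℝ u (unitTangent γ s₁.1) = √2 * s₁.2 := by
    have h1 := hcyc.refraction_in
    rw [hmt, hm, hOT.2, hTE, snellLaw_iff R.hill₁ (innerPotential_pos hEh hμ _)
      (R.norm_outerVel_end hω hD hκ) hun, R.outer_tangential] at h1
    exact h1.symm
  have hul : u = launch (innerPotential E h μ) D γ (-1) s₁ := by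
    rcases eq_launch_or hD hκ R.normal₁ hun hut with hpos | hneg
    -- An outward launch would leave `closure D` at once, whereas the inner arc has to stay in `D`.
    -- Strict transversality makes its normal component nonzero.
    · exfalso
      have hIcc : Icc 0 c.TI ∈ 𝓝[≥] (0 : ℝ) := Icc_mem_nhdsGE hcyc.TI_pos
      have hd := (levi_civita_position hcyc.inner_arc ⟨le_rfl, hcyc.TI_pos.le⟩ hw0).mono_of_mem_nhdsWithin
        hIcc
      have hnz : 0 < 2 * ‖physicalPosition (c.w 0)‖ := by
        have : 0 < ‖physicalPosition (c.w 0)‖ := by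
          rw [hstart]; exact norm_pos_iff.2 (hD.point_ne_zero _)
        linarith
      have hsq : 0 < √(innerPotential E h μ (γ s₁.1) - s₁.2 ^ 2) :=
        Real.sqrt_pos.2 (sub_pos.2 R.transversal)
      have h20 : 0 < √2 := by positivity
      have hside := (R.side (fun τ => physicalPosition (c.w τ))
        (2 * ‖physicalPosition (c.w 0)‖ * (√2 * √(innerPotential E h μ (γ s₁.1) - s₁.2 ^ 2)))
        (2 * ‖physicalPosition (c.w 0)‖ * (√2 * s₁.2)) hstart (by
          refine hd.congr_deriv ?_
          rw [← hu, hpos, launch, R.normal₁]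
          module)).1 (by positivity)
      obtain ⟨s, hs1, hs2⟩ := (hside.and (Ioo_mem_nhdsGT hcyc.TI_pos)).exists
      exact hs1 (subset_closure (hcyc.inner_mem s hs2))
    · exact hneg
  have hI : ∀ s ∈ Icc 0 c.TI, physicalPosition (c.w s) = innerPos E h μ D γ w₀ (s₁, s) ∧
      physicalVelocity (c.w s) (c.w' s) = innerVel E h μ D γ w₀ (s₁, s) := fun s hs =>
    hcyc.inner_arc.eq_innerPos hEh hw₀ (hD.point_ne_zero _) hstart hul hs
  have hTI : c.TI = τI := by
    rcases lt_trichotomy c.TI τI with hlt | heq | hlt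
    · have h1 := R.inner_mem c.TI ⟨hcyc.TI_pos, hlt⟩
      rw [← (hI c.TI ⟨hcyc.TI_pos.le, le_rfl⟩).1, hcyc.inner_end] at h1
      exact absurd h1 (hnotmem _)
    · exact heq
    · have h1 := hcyc.inner_mem τI ⟨R.τI_pos, hlt⟩
      rw [(hI τI ⟨R.τI_pos.le, hlt.le⟩).1, R.inner_end] at h1
      exact absurd h1 (hnotmem _)
  have hIT := hI c.TI ⟨hcyc.TI_pos.le, le_rfl⟩
  have hx : q'.1 = s₂.1 := by
    refine hD.eq_of_abs_sub_lt hq' hξ.le ?_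
    rw [← hcyc.inner_end, hIT.1, hTI, R.inner_end]
  have h3 : 0 < √(outerPotential E ω (γ s₂.1)) := Real.sqrt_pos.2 R.hill₂
  have hα : Real.sin q'.2 = s₂.2 / √(outerPotential E ω (γ s₂.1)) := by
    have h1 := hcyc.refraction_out
    have h2 := direction_spec hD hκ R.normal₂ q'.2
    rw [hx, hIT.2, hTI, snellLaw_unit_iff (innerPotential_pos hEh hμ _)
      (R.norm_innerVel_end hEh hD hκ hw₀) h2.1, h2.2, R.inner_tangential] at h1
    field_simp at h1 ⊢
    linarith
  refine Prod.ext hx ?_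
  simp only [ofSigma]
  rw [← hα, Real.arcsin_sin hcyc.angle_mem'.1 hcyc.angle_mem'.2]

end IsReturnData

end

/-! ### Change of coordinates between `α` and `σ`, and the linearised return -/

section

variable {E h μ ω : ℝ} {D : Set ℂ} {γ : ℝ → ℂ} {ξ : ℝ}

theorem contDiffAt_sqrt_outerPotential (hD : IsRegularDomain D γ)
    (hHill : 0 < outerPotential E ω (γ ξ)) :
    ContDiffAt ℝ 1 (fun q : ℝ × ℝ => √(outerPotential E ω (γ q.1))) (ξ, 0) := by
  have hγc : ContDiffAt ℝ 1 (fun q : ℝ × ℝ => γ q.1) (ξ, 0) :=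
    ContDiffAt.comp (ξ, (0 : ℝ)) (hD.contDiff.contDiffAt.of_le (by norm_num)) contDiffAt_fst
  have h1 : ContDiffAt ℝ 1 (fun q : ℝ × ℝ => outerPotential E ω (γ q.1)) (ξ, 0) :=
    ContDiffAt.comp (g := outerPotential E ω) (ξ, (0 : ℝ)) (contDiffAt_outerPotential (γ ξ)) hγc
  exact h1.sqrt hHill.ne'

theorem toSigma_base : toSigma E ω γ (ξ, 0) = (ξ, 0) := by simp [toSigma]

theorem ofSigma_base : ofSigma E ω γ (ξ, 0) = (ξ, 0) := by simp [ofSigma]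

theorem contDiffAt_toSigma (hD : IsRegularDomain D γ) (hHill : 0 < outerPotential E ω (γ ξ)) :
    ContDiffAt ℝ 1 (toSigma E ω γ) (ξ, 0) :=
  contDiffAt_fst.prodMk ((contDiffAt_sqrt_outerPotential hD hHill).mul contDiffAt_snd.sin)

theorem contDiffAt_ofSigma (hD : IsRegularDomain D γ) (hHill : 0 < outerPotential E ω (γ ξ)) :
    ContDiffAt ℝ 1 (ofSigma E ω γ) (ξ, 0) := by
  have h1 : ContDiffAt ℝ 1 (fun q : ℝ × ℝ => q.2 / √(outerPotential E ω (γ q.1))) (ξ, 0) :=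
    contDiffAt_snd.div (contDiffAt_sqrt_outerPotential hD hHill) (Real.sqrt_pos.2 hHill).ne'
  have h2 : ContDiffAt ℝ 1 (fun q : ℝ × ℝ => Real.arcsin (q.2 / √(outerPotential E ω (γ q.1))))
      (ξ, 0) :=
    ContDiffAt.comp (g := Real.arcsin) (ξ, (0 : ℝ))
      (Real.contDiffAt_arcsin (by simp) (by simp)) h1
  exact contDiffAt_fst.prodMk h2

/-- The derivative of `√V_E` is multiplied by `sin 0 = 0`, so it need not be known. -/
theorem fderiv_toSigma (hD : IsRegularDomain D γ) (hHill : 0 < outerPotential E ω (γ ξ))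
    (u : ℝ × ℝ) :
    fderiv ℝ (toSigma E ω γ) (ξ, 0) u = (u.1, √(outerPotential E ω (γ ξ)) * u.2) := by
  have h1 := ((contDiffAt_sqrt_outerPotential hD hHill).differentiableAt (by norm_num)).hasFDerivAt
  have h2 := (hasFDerivAt_snd (𝕜 := ℝ) (p := ((ξ, 0) : ℝ × ℝ))).sin
  have h3 : HasFDerivAt (toSigma E ω γ) _ (ξ, 0) :=
    (hasFDerivAt_fst (𝕜 := ℝ) (p := ((ξ, 0) : ℝ × ℝ))).prodMk (h1.mul h2)
  rw [h3.fderiv]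
  simp

theorem fderiv_ofSigma (hD : IsRegularDomain D γ) (hHill : 0 < outerPotential E ω (γ ξ))
    (u : ℝ × ℝ) :
    fderiv ℝ (ofSigma E ω γ) (ξ, 0) u = (u.1, u.2 / √(outerPotential E ω (γ ξ))) := by
  have h0 : √(outerPotential E ω (γ ξ)) ≠ 0 := (Real.sqrt_pos.2 hHill).ne'
  have h1 := (((contDiffAt_sqrt_outerPotential hD hHill).inv h0).differentiableAt
    (by norm_num)).hasFDerivAt
  have h2 := (hasFDerivAt_snd (𝕜 := ℝ) (p := ((ξ, 0) : ℝ × ℝ))).mul h1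
  have h4 := (Real.hasDerivAt_arcsin (x := (0 : ℝ) * (√(outerPotential E ω (γ ξ)))⁻¹)
    (by simp) (by simp)).comp_hasFDerivAt ((ξ, 0) : ℝ × ℝ) h2
  have h3 := (hasFDerivAt_fst (𝕜 := ℝ) (p := ((ξ, 0) : ℝ × ℝ))).prodMk h4
  have h5 : HasFDerivAt (ofSigma E ω γ) _ (ξ, 0) := h3
  rw [h5.fderiv]
  simp [div_eq_inv_mul]

/-- The determinant and the trace of the linearised return map, in terms of the distance `r` to the
origin, the curvature `k`, and `a = √V_I`, `b = √V_E`. -/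
theorem det_trace_return {E μ ω r k a b ℓ : ℝ} (hE : 0 < E) (hμ : 0 < μ) (hr : 0 < r) (hb : 0 < b)
    (hℓ : 0 < ℓ) (hEn : ω ^ 2 * r ^ 2 = 2 * (E - b ^ 2)) :
    ∃ m₁₁ m₁₂ m₂₁ m₂₂ : ℝ, m₁₁ * m₂₂ - m₁₂ * m₂₁ = 1 ∧
      (m₁₁ + m₂₂) ^ 2 - 4 = factorA E μ r k a b * factorB E r k a b * factorC E μ r k a b *
        factorD μ r k a b ∧
      ∀ x α A σ N η : ℝ,
        A = (1 - 2 * b ^ 2 / E) * (ℓ * x) + 2 * b * r / E * (b * k * (ℓ * x) + b * α) →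
        σ = -(ω ^ 2 * b * r / E) * (ℓ * x) + (1 - 2 * b ^ 2 / E) * (b * k * (ℓ * x) + b * α) +
          b * k * A →
        N = a * (ℓ * (A / ℓ)) / (2 * r) - a * k * (ℓ * (A / ℓ)) + σ →
        η = (2 * a ^ 2 * r / μ - 1) * (ℓ * (A / ℓ) / (2 * r)) + 2 * a * r / μ * N →
        -(2 * r * η) / ℓ = m₁₁ * x + m₁₂ * α ∧
        (-(a * (2 * a ^ 2 * r / μ - 2) * (ℓ * (A / ℓ) / (2 * r)) + (2 * a ^ 2 * r / μ - 1) * N +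
          a * η) + 2 * r * a * k * η) / b = m₂₁ * x + m₂₂ * α := by
  -- The `e`'s are the entries of the outer matrix, and `-(2 * r * g₁)`, `-(2 * r * g₂)`, `i₂₁`,
  -- `i₂₂` those of the inner one, both in arc length and `σ`. Passing to `(ξ, α)` conjugates the
  -- product by `diag(ℓ, b)`, which affects neither trace nor determinant.
  obtain ⟨e₁₁, he₁₁⟩ : ∃ e, e = (1 - 2 * b ^ 2 / E) + 2 * b * r / E * (b * k) := ⟨_, rfl⟩
  obtain ⟨e₁₂, he₁₂⟩ : ∃ e, e = 2 * b * r / E := ⟨_, rfl⟩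
  obtain ⟨e₂₁, he₂₁⟩ : ∃ e, e = -(2 * b * (E - b ^ 2) / (r * E)) + (1 - 2 * b ^ 2 / E) * (b * k) +
    b * k * e₁₁ := ⟨_, rfl⟩
  obtain ⟨e₂₂, he₂₂⟩ : ∃ e, e = (1 - 2 * b ^ 2 / E) + b * k * e₁₂ := ⟨_, rfl⟩
  obtain ⟨n, hn⟩ : ∃ n, n = a / (2 * r) - a * k := ⟨_, rfl⟩
  obtain ⟨g₁, hg₁⟩ : ∃ g, g = (2 * a ^ 2 * r / μ - 1) / (2 * r) + 2 * a * r / μ * n := ⟨_, rfl⟩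
  obtain ⟨g₂, hg₂⟩ : ∃ g, g = 2 * a * r / μ := ⟨_, rfl⟩
  obtain ⟨i₂₁, hi₂₁⟩ : ∃ i, i = -(a * (2 * a ^ 2 * r / μ - 2) / (2 * r) +
    (2 * a ^ 2 * r / μ - 1) * n + a * g₁) + 2 * r * a * k * g₁ := ⟨_, rfl⟩
  obtain ⟨i₂₂, hi₂₂⟩ : ∃ i, i = -((2 * a ^ 2 * r / μ - 1) + a * g₂) + 2 * r * a * k * g₂ := ⟨_, rfl⟩
  have hdetE : e₁₁ * e₂₂ - e₁₂ * e₂₁ = 1 := by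
    rw [he₂₁, he₂₂, he₁₁, he₁₂]
    field_simp
    ring
  have hdetI : -(2 * r * g₁) * i₂₂ - -(2 * r * g₂) * i₂₁ = 1 := by
    rw [hi₂₁, hi₂₂, hg₁, hg₂, hn]
    field_simp
    ring
  -- The energy relation at `p` eliminates `ω`, which the factors of the discriminant do not
  -- contain.
  have hω : ω ^ 2 * b * r / E = 2 * b * (E - b ^ 2) / (r * E) := by
    field_simp
    linear_combination hEn
  refine ⟨-(2 * r * g₁) * e₁₁ + -(2 * r * g₂) * e₂₁,
    (-(2 * r * g₁) * e₁₂ + -(2 * r * g₂) * e₂₂) * b / ℓ, (i₂₁ * e₁₁ + i₂₂ * e₂₁) * ℓ / b,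
    i₂₁ * e₁₂ + i₂₂ * e₂₂, ?_, ?_, ?_⟩
  · have h1 : (-(2 * r * g₁) * e₁₂ + -(2 * r * g₂) * e₂₂) * b / ℓ * ((i₂₁ * e₁₁ + i₂₂ * e₂₁) * ℓ / b)
        = (-(2 * r * g₁) * e₁₂ + -(2 * r * g₂) * e₂₂) * (i₂₁ * e₁₁ + i₂₂ * e₂₁) := by
      field_simp
    rw [h1]
    linear_combination (e₁₁ * e₂₂ - e₁₂ * e₂₁) * hdetI + hdetE
  · rw [factorA, factorC, factorB, factorD, hi₂₁, hi₂₂, hg₁, hg₂, hn, he₂₁, he₂₂, he₁₁, he₁₂]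
    field_simp
    ring
  · intro x α A σ N η hA hσ hN hη
    have hA' : A = e₁₁ * (ℓ * x) + e₁₂ * (b * α) := by rw [hA, he₁₁, he₁₂]; ring
    have hσ' : σ = e₂₁ * (ℓ * x) + e₂₂ * (b * α) := by
      rw [hσ, hω, hA', he₂₁, he₂₂]; ring
    have hAℓ : ℓ * (A / ℓ) = A := mul_div_cancel₀ _ hℓ.ne'
    rw [hAℓ] at hN hη ⊢
    have hN' : N = n * A + σ := by rw [hN, hn]; ring
    have hη' : η = g₁ * A + g₂ * σ := by rw [hη, hN', hg₁, hg₂]; ring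
    have hout : -(a * (2 * a ^ 2 * r / μ - 2) * (A / (2 * r)) + (2 * a ^ 2 * r / μ - 1) * N + a * η) +
        2 * r * a * k * η = i₂₁ * A + i₂₂ * σ := by
      rw [hη', hN', hi₂₁, hi₂₂]; ring
    rw [hout, hη', hA', hσ']
    constructor
    · field_simp
      ring
    · field_simp
      ring

end

/-! ### Assembly -/

/-- The local first return map, together with the homothetic orbit and the linearisation of the map at
the fixed point. -/
theorem exists_firstReturnMap {E h μ ω : ℝ} {D : Set ℂ} {γ : ℝ → ℂ} {ξ : ℝ} (hE : 0 < E)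
    (hEh : 0 < E + h) (hμ : 0 < μ) (hω : 0 < ω) (hD : IsRegularDomain D γ)
    (hHill : 0 < outerPotential E ω (γ ξ)) (hperp : inner ℝ (γ ξ) (deriv γ ξ) = 0)
    (hray : {z : ℂ | ∃ t : ℝ, 0 ≤ t ∧ z = t • γ ξ} ∩ frontier D = {γ ξ}) :
    (∃ c : Cycle, IsHomotheticOrbit E h μ ω D γ ξ c) ∧
    ∃ F : ℝ × ℝ → ℝ × ℝ, IsLocalFirstReturnMap E h μ ω D γ ξ F ∧ F (ξ, 0) = (ξ, 0) ∧
      ContDiffAt ℝ 1 F (ξ, 0) ∧ ∃ m₁₁ m₁₂ m₂₁ m₂₂ : ℝ, m₁₁ * m₂₂ - m₁₂ * m₂₁ = 1 ∧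
        (m₁₁ + m₂₂) ^ 2 - 4 = discriminant E h μ ω D γ ξ ∧
        ∀ u, fderiv ℝ F (ξ, 0) u = (m₁₁ * u.1 + m₁₂ * u.2, m₂₁ * u.1 + m₂₂ * u.2) := by
  obtain ⟨ν, κ, X, Y, hc⟩ := exists_boundaryChart hD hperp hray
  obtain ⟨w₀, hw⟩ := IsAlgClosed.exists_pow_nat_eq (γ ξ) (n := 2) (by norm_num)
  have hp : γ ξ ≠ 0 := hD.point_ne_zero ξ
  have hw₀ : w₀ ≠ 0 := by rintro rfl; simp at hw; exact hp hw.symm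
  have hκ := hc.κ_sq
  obtain ⟨τE, PE, hPEc, hPE0, hPEd, hrayE, hPE⟩ := exists_outerSection hω hD hc hHill hperp
    (fun t ht => hD.smul_notMem_closure_of_one_lt hray ht) rfl rfl rfl rfl
  obtain ⟨τI, PI, hPIc, hPI0, hPId, hrayI, hcoll, hPI⟩ := exists_innerSection (μ := μ) hEh hμ hD hc
    hperp (fun t h0 h1 => hD.smul_mem_of_lt_one hray h0 h1) hw rfl rfl rfl rfl
  have hSc : ContDiffAt ℝ 1 (toSigma E ω γ) (ξ, 0) := contDiffAt_toSigma hD hHill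
  have hS0 : toSigma E ω γ (ξ, 0) = (ξ, 0) := toSigma_base
  have t₀ : Tendsto (toSigma E ω γ) (𝓝 (ξ, 0)) (𝓝 (ξ, 0)) := by
    have := hSc.continuousAt.tendsto; rwa [hS0] at this
  have tE : Tendsto PE (𝓝 (ξ, 0)) (𝓝 (ξ, 0)) := by
    have := hPEc.continuousAt.tendsto; rwa [hPE0] at this
  have tI : Tendsto PI (𝓝 (ξ, 0)) (𝓝 (ξ, 0)) := by
    have := hPIc.continuousAt.tendsto; rwa [hPI0] at this
  have t₁ := tE.comp t₀
  have t₂ := tI.comp t₁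
  have hfst : Tendsto (fun q : ℝ × ℝ => q.1) (𝓝 (ξ, 0)) (𝓝 ξ) := continuousAt_fst
  have hn : ∀ᶠ q in 𝓝 ((ξ, 0) : ℝ × ℝ),
      outwardNormal D γ q.1 = -(κ * Complex.I) * unitTangent γ q.1 :=
    hfst.eventually (hc.outwardNormal_eventuallyEq hD)
  have hγc : ContinuousAt (fun q : ℝ × ℝ => γ q.1) (ξ, 0) :=
    hD.contDiff.continuous.continuousAt.comp continuousAt_fst
  have hHc : ContinuousAt (fun q : ℝ × ℝ => outerPotential E ω (γ q.1)) (ξ, 0) :=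
    ContinuousAt.comp (g := outerPotential E ω)
      (contDiffAt_outerPotential (E := E) (ω := ω) (γ ξ)).continuousAt hγc
  have hH : ∀ᶠ q in 𝓝 ((ξ, 0) : ℝ × ℝ), 0 < outerPotential E ω (γ q.1) :=
    hHc.eventually (lt_mem_nhds hHill)
  have hIc : ContinuousAt (fun q : ℝ × ℝ => innerPotential E h μ (γ q.1) - q.2 ^ 2) (ξ, 0) := by
    have : ContinuousAt (fun q : ℝ × ℝ => innerPotential E h μ (γ q.1)) (ξ, 0) :=
      ContinuousAt.comp (g := innerPotential E h μ)
        (contDiffAt_innerPotential (E := E) (h := h) (μ := μ) hp).continuousAt hγc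
    exact this.sub (continuousAt_snd.pow 2)
  have htr : ∀ᶠ q in 𝓝 ((ξ, 0) : ℝ × ℝ), q.2 ^ 2 < innerPotential E h μ (γ q.1) := by
    have h1 : (0 : ℝ) < innerPotential E h μ (γ ((ξ, 0) : ℝ × ℝ).1) - ((ξ, 0) : ℝ × ℝ).2 ^ 2 := by
      have := innerPotential_pos hEh hμ (γ ξ)
      simpa using this
    filter_upwards [hIc.eventually (lt_mem_nhds h1)] with q hq using sub_pos.1 hq
  have hsine : ∀ᶠ q in 𝓝 ((ξ, 0) : ℝ × ℝ), q.2 / √(outerPotential E ω (γ q.1)) ∈ Icc (-1) 1 := by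
    have h1 : ContinuousAt (fun q : ℝ × ℝ => q.2 / √(outerPotential E ω (γ q.1))) (ξ, 0) :=
      continuousAt_snd.div (contDiffAt_sqrt_outerPotential hD hHill).continuousAt
        (Real.sqrt_pos.2 hHill).ne'
    refine h1.eventually (Icc_mem_nhds ?_ ?_) <;> simp
  have hangle : ∀ᶠ q in 𝓝 ((ξ, 0) : ℝ × ℝ), q.2 ∈ Icc (-(π / 2)) (π / 2) := by
    have h1 : ContinuousAt (fun q : ℝ × ℝ => q.2) (ξ, 0) := continuousAt_snd
    have := pi_pos
    refine h1.eventually (Icc_mem_nhds ?_ ?_) <;> simp <;> linarith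
  have hpi : ∀ᶠ q in 𝓝 ((ξ, 0) : ℝ × ℝ), |q.1 - ξ| < π := by
    have h1 : ContinuousAt (fun q : ℝ × ℝ => |q.1 - ξ|) (ξ, 0) := by fun_prop
    refine h1.eventually (gt_mem_nhds ?_)
    simpa using pi_pos
  -- Each partial composite fixes `(ξ, 0)` and is continuous there, so the conditions at the
  -- junction and at the end point pull back to conditions on `q`.
  have hR : ∀ᶠ q in 𝓝 ((ξ, 0) : ℝ × ℝ), IsReturnData E h μ ω D γ κ w₀ q (PE (toSigma E ω γ q))
      (PI (PE (toSigma E ω γ q))) (τE (toSigma E ω γ q)) (τI (PE (toSigma E ω γ q))) := by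
    filter_upwards [hangle, hn, hH, t₀.eventually hPE, t₁.eventually hn, t₁.eventually hH,
      t₁.eventually htr, t₁.eventually (hfst.eventually (hc.eventually_side hD)), t₁.eventually hPI,
      t₂.eventually hn, t₂.eventually hH, t₂.eventually hsine] with q a1 a2 a3 a4 a5 a6 a7 a8 a9 b1 b2 b3
    exact ⟨a1, a2, a5, b1, a3, a6, b2, a7, b3, a8, a4.1, a4.2.1, a4.2.2.1, a4.2.2.2, a9.1, a9.2.1,
      a9.2.2.1, a9.2.2.2⟩
  set F : ℝ × ℝ → ℝ × ℝ := fun q => ofSigma E ω γ (PI (PE (toSigma E ω γ q))) with hF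
  have hTc : ContDiffAt ℝ 1 (ofSigma E ω γ) (ξ, 0) := contDiffAt_ofSigma hD hHill
  have hFc : ContDiffAt ℝ 1 F (ξ, 0) := by
    have h1 : ContDiffAt ℝ 1 (fun q => PE (toSigma E ω γ q)) (ξ, 0) :=
      ContDiffAt.comp (g := PE) (ξ, (0 : ℝ)) (by rw [hS0]; exact hPEc) hSc
    have h2 : ContDiffAt ℝ 1 (fun q => PI (PE (toSigma E ω γ q))) (ξ, 0) :=
      ContDiffAt.comp (g := PI) (ξ, (0 : ℝ)) (by rw [hS0, hPE0]; exact hPIc) h1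
    exact ContDiffAt.comp (g := ofSigma E ω γ) (ξ, (0 : ℝ))
      (by rw [hS0, hPE0, hPI0]; exact hTc) h2
  have hF0 : F (ξ, 0) = (ξ, 0) := by
    simp only [hF]
    rw [hS0, hPE0, hPI0, ofSigma_base]
  have hFd : ∀ u, fderiv ℝ F (ξ, 0) u = fderiv ℝ (ofSigma E ω γ) (ξ, 0) (fderiv ℝ PI (ξ, 0)
      (fderiv ℝ PE (ξ, 0) (fderiv ℝ (toSigma E ω γ) (ξ, 0) u))) := by
    intro u
    have dS := (hSc.differentiableAt (by norm_num)).hasFDerivAt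
    have dE : HasFDerivAt PE (fderiv ℝ PE (ξ, 0)) (toSigma E ω γ (ξ, 0)) := by
      rw [hS0]; exact (hPEc.differentiableAt (by norm_num)).hasFDerivAt
    have dI : HasFDerivAt PI (fderiv ℝ PI (ξ, 0)) (PE (toSigma E ω γ (ξ, 0))) := by
      rw [hS0, hPE0]; exact (hPIc.differentiableAt (by norm_num)).hasFDerivAt
    have dT : HasFDerivAt (ofSigma E ω γ) (fderiv ℝ (ofSigma E ω γ) (ξ, 0))
        (PI (PE (toSigma E ω γ (ξ, 0)))) := by
      rw [hS0, hPE0, hPI0]; exact (hTc.differentiableAt (by norm_num)).hasFDerivAt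
    have h1 := dE.comp ((ξ, 0) : ℝ × ℝ) dS
    have h2 := HasFDerivAt.comp (g := PI) ((ξ, 0) : ℝ × ℝ) dI h1
    have h3 : HasFDerivAt F _ (ξ, 0) :=
      HasFDerivAt.comp (g := ofSigma E ω γ) ((ξ, 0) : ℝ × ℝ) dT h2
    rw [h3.fderiv]
    rfl
  refine ⟨⟨IsReturnData.cycle E h μ ω D γ w₀ (ξ, 0) (ξ, 0) (τE (ξ, 0)) (τI (ξ, 0)), ?_⟩, F, ?_, hF0,
    hFc, ?_⟩
  · have R := hR.self_of_nhds
    have hcy := R.isCycle hEh hμ hω hD hκ hw₀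
    refine ⟨?_, ?_, ?_, ?_, ?_⟩
    · rw [hS0, hPE0, hPI0, ofSigma_base] at hcy
      exact hcy
    · change outerVel E ω D γ (toSigma E ω γ (ξ, 0), 0) = _
      have hr : ‖γ ξ‖ ≠ 0 := norm_ne_zero_iff.2 hp
      rw [outerVel_zero hω, hS0, hc.launch_base hD]
      nth_rewrite 4 [hc.point_eq]
      rw [smul_smul, div_mul_cancel₀ _ hr, one_mul, Real.sqrt_mul (by norm_num)]
    · intro s hs
      change ∃ r : ℝ, 0 ≤ r ∧ outerPos E ω D γ (toSigma E ω γ (ξ, 0), s) = r • γ ξ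
      rw [hS0]
      exact hrayE s hs
    · exact fun s _ => hrayI s
    · exact hcoll
  · filter_upwards [hR, t₂.eventually hpi] with q R hq
    refine ⟨hq, fun q' hq' => ⟨?_, ?_⟩⟩
    · rintro ⟨c, hcyc⟩
      exact R.eq_of_isCycle hEh hμ hω hD hκ hw₀ hq hq' hcyc
    · rintro rfl
      exact ⟨_, R.isCycle hEh hμ hω hD hκ hw₀⟩
  · have hb : 0 < √(outerPotential E ω (γ ξ)) := Real.sqrt_pos.2 hHill
    have hEn : ω ^ 2 * ‖γ ξ‖ ^ 2 = 2 * (E - √(outerPotential E ω (γ ξ)) ^ 2) := by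
      rw [Real.sq_sqrt hHill.le, outerPotential]; ring
    obtain ⟨m₁₁, m₁₂, m₂₁, m₂₂, hdet, htrace, hm⟩ := det_trace_return (k := curvature D γ ξ)
      (a := √(innerPotential E h μ (γ ξ))) hE hμ (norm_pos_iff.2 hp) hb
      (BoundaryChart.norm_deriv_pos (ξ := ξ) hD) hEn
    refine ⟨m₁₁, m₁₂, m₂₁, m₂₂, hdet, htrace, fun u => ?_⟩
    obtain ⟨A, hA, hEd⟩ := hPEd (u.1, √(outerPotential E ω (γ ξ)) * u.2)
    rw [hFd, fderiv_toSigma hD hHill, hEd]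
    obtain ⟨N, η, hN, hη, hId⟩ := hPId (A / ‖deriv γ ξ‖, -(ω ^ 2 * √(outerPotential E ω (γ ξ)) * ‖γ ξ‖ / E)
      * (‖deriv γ ξ‖ * u.1) + (1 - 2 * √(outerPotential E ω (γ ξ)) ^ 2 / E) *
        (√(outerPotential E ω (γ ξ)) * curvature D γ ξ * (‖deriv γ ξ‖ * u.1) +
          √(outerPotential E ω (γ ξ)) * u.2) + √(outerPotential E ω (γ ξ)) * curvature D γ ξ * A)
    rw [hId, fderiv_ofSigma hD hHill]
    have := hm u.1 u.2 A _ N η hA rfl hN hη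
    exact Prod.ext this.1 this.2

/-- The value of one map is a genuine return within the parameter window, so the uniqueness clause
of the other applies to it. Equality of germs transfers both the fixed point and the derivative. -/
theorem IsLocalFirstReturnMap.eventuallyEq {E h μ ω : ℝ} {D : Set ℂ} {γ : ℝ → ℂ} {ξ : ℝ}
    {F G : ℝ × ℝ → ℝ × ℝ} (hF : IsLocalFirstReturnMap E h μ ω D γ ξ F)
    (hG : IsLocalFirstReturnMap E h μ ω D γ ξ G) : F =ᶠ[𝓝 (ξ, 0)] G := by
  filter_upwards [hF, hG] with q h1 h2
  exact (h2.2 (F q) h1.1).1 ((h1.2 (F q) h1.1).2 rfl)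

end GalacticRefraction

end

theorem theorem1 (E h μ ω : ℝ) (hE : 0 < E) (hEh : 0 < E + h) (hμ : 0 < μ) (hω : 0 < ω)
    (D : Set ℂ) (γ : ℝ → ℂ) (hD : IsRegularDomain D γ) (ξ : ℝ)
    (hHill : 0 < outerPotential E ω (γ ξ))
    (hperp : inner ℝ (γ ξ) (deriv γ ξ) = 0)
    (hray : {z : ℂ | ∃ t : ℝ, 0 ≤ t ∧ z = t • γ ξ} ∩ frontier D = {γ ξ}) :
    (∃ c : Cycle, IsHomotheticOrbit E h μ ω D γ ξ c) ∧
    (∃ F : ℝ × ℝ → ℝ × ℝ, IsLocalFirstReturnMap E h μ ω D γ ξ F) ∧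
    ∀ F : ℝ × ℝ → ℝ × ℝ, IsLocalFirstReturnMap E h μ ω D γ ξ F →
      F (ξ, 0) = (ξ, 0) ∧ ContDiffAt ℝ 1 F (ξ, 0) ∧
      (0 < discriminant E h μ ω D γ ξ →
        IsSaddle F (ξ, 0) ∧ IsLinearlyUnstable F (ξ, 0)) ∧
      (discriminant E h μ ω D γ ξ < 0 →
        IsCenter F (ξ, 0) ∧ IsLinearlyStable F (ξ, 0)) := by
  obtain ⟨horbit, F₀, hF₀, hfix, hsmooth, m₁₁, m₁₂, m₂₁, m₂₂, hdet, htrace, hlin⟩ :=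
    exists_firstReturnMap hE hEh hμ hω hD hHill hperp hray
  refine ⟨horbit, ⟨F₀, hF₀⟩, fun F hF => ?_⟩
  have heq : F =ᶠ[𝓝 (ξ, 0)] F₀ := hF.eventuallyEq hF₀
  have hfixF : F (ξ, 0) = (ξ, 0) := heq.self_of_nhds.trans hfix
  have hFc : ContDiffAt ℝ 1 F (ξ, 0) := hsmooth.congr_of_eventuallyEq heq
  have hFd : DifferentiableAt ℝ F (ξ, 0) := hFc.differentiableAt (by norm_num)
  have hlinF : ∀ u, fderiv ℝ F (ξ, 0) u = (m₁₁ * u.1 + m₁₂ * u.2, m₂₁ * u.1 + m₂₂ * u.2) := by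
    rw [heq.fderiv_eq]; exact hlin
  refine ⟨hfixF, hFc, fun hpos => ?_, fun hneg => ?_⟩
  · obtain ⟨l, hl, h1, h2⟩ := eigenvalues_of_four_lt_trace_sq _ hlinF hdet (by linarith)
    exact ⟨⟨hfixF, hFd, l, hl, h1, h2⟩, hfixF, hFd, tendsto_norm_pow_atTop_of_hasEigenvalue _ hl h1⟩
  · exact ⟨⟨hfixF, hFd, charpoly_roots_of_trace_sq_lt_four _ hlinF hdet (by linarith)⟩, hfixF, hFd,
      norm_pow_le_of_trace_sq_lt_four _ hlinF hdet (by linarith)⟩
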